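/- Let $(M^{2n},J)$ be a compact complex manifold of complex dimension $n$. For a Hermitian metric $g$ compatible with $J$, write $g_{i\bar j}$ for its components in local holomorphic coordinates, normalized so that $\omega=\frac{\sqrt{-1}}2 g_{i\bar j}\,dz^i\wedge d\bar z^j$ (so $g_{i\bar j}=\delta_{ij}$ for the Euclidean metric and $dV=\det(g_{i\bar j})$ times Lebesgue measure). Let $\nabla$ be the Chern connection, $\Gamma_{ij}^k=g^{k\bar l}\partial_i g_{j\bar l}$, with torsion $T_{ij\bar k}=\partial_i g_{j\bar k}-\partial_j g_{i\bar k}$, $T_{\bar i\bar j k}=\overline{T_{ij\bar k}}$, and curvature $\Omega_{l\bar m j\bar k}=-g_{p\bar k}\partial_{\bar m}\Gamma_{lj}^p$. Put $S_{j\bar k}=g^{l\bar m}\Omega_{l\bar m j\bar k}$ and $Q=\frac12Q^1-\frac14Q^2-\frac12Q^3+Q^4$, where $$Q^1_{i\bar j}=g^{k\bar l}g^{m\bar n}T_{ik\bar n}T_{\bar j\bar l m},\qquad Q^2_{i\bar j}=g^{k\bar l}g^{m\bar n}T_{\bar l\bar n i}T_{km\bar j},\qquad Q^3_{i\bar j}=g^{k\bar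 l}g^{m\bar n}T_{ik\bar l}T_{\bar j\bar n m},$$ $$Q^4_{i\bar j}=\tfrac12 g^{k\bar l}g^{m\bar n}\left(T_{mk\bar l}T_{\bar n\bar j i}+T_{\bar n\bar l k}T_{mi\bar j}\right).$$ Define the volume-normalized Hermitian curvature flow operator $$\mathcal F(g)=S-Q-\frac1n\left(\int_M \operatorname{tr}_g(S-Q)\,dV\right)g .$$ **Proposition.** Let $g(a)$, $a\in(-\varepsilon,\varepsilon)$, be a smooth one-parameter family of Hermitian metrics on $M$ compatible with $J$, all of unit volume, with $\frac{\partial}{\partial a}g(a)\big|_{a=0}=h$, and suppose that $g(0)$ is Kähler–Einstein, i.e. Kähler with Ricci curvature equal to a constant real multiple of $g(0)$. Then $$\frac{\partial}{\partial a}\mathcal F(g(a))\Big|_{a=0}=\nabla^*\nabla h-\overset{\circ}{R}(h),$$ where, with respect to $g(0)$, $$(\nabla^*\nabla h)_{j\bar k}=-g^{l\bar m}\nabla_l\nabla_{\bar m}h_{j\bar k},\qquad \overset{\circ}{R}(h)_{k\bar l}=h^{i\bar j}R_{k\bar j i\bar l},\qquad h^{i\bar j}=g^{i\bar q}g^{p\bar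 j}h_{p\bar q},$$ and $R=\Omega(g(0))$ is the curvature of the Kähler metric $g(0)$. -/

import Mathlib

open scoped Manifold ContDiff

noncomputable section

namespace HermitianFlow

/-! ### Hermitian calculus in a coordinate domain of `ℂⁿ`

A Hermitian metric enters through its coefficient matrix `G z i j = g_{i j̄}(z)`, and a `(1,1)`-tensor
`h` through `H z i j = h_{i j̄}(z)`. All differentiations are real differentiations on `ℂⁿ`. -/

section Local

variable {n : ℕ}

/-- The Wirtinger derivative `∂ f / ∂ zⁱ`. -/
def dz (i : Fin n) (f : (Fin n → ℂ) → ℂ) (z : Fin n → ℂ) : ℂ :=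
  (1 / 2 : ℂ) * (fderiv ℝ f z (Pi.single i 1) - Complex.I * fderiv ℝ f z (Pi.single i Complex.I))

/-- The Wirtinger derivative `∂ f / ∂ z̄ⁱ`. -/
def dzbar (i : Fin n) (f : (Fin n → ℂ) → ℂ) (z : Fin n → ℂ) : ℂ :=
  (1 / 2 : ℂ) * (fderiv ℝ f z (Pi.single i 1) + Complex.I * fderiv ℝ f z (Pi.single i Complex.I))

variable (G : (Fin n → ℂ) → Matrix (Fin n) (Fin n) ℂ)

/-- The inverse metric `g^{k l̄}`, normalised by `∑ l, g^{k l̄} g_{j l̄} = δ_{jk}`. -/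
def gInv (z : Fin n → ℂ) (k l : Fin n) : ℂ := (G z)⁻¹ l k

/-- The Christoffel symbols `Γ_{ij}^k = g^{k l̄} ∂_i g_{j l̄}` of the Chern connection. -/
def chernGamma (z : Fin n → ℂ) (i j k : Fin n) : ℂ :=
  ∑ l, gInv G z k l * dz i (fun w => G w j l) z

/-- The torsion of the Chern connection with its last index lowered,
`T_{i j k̄} = ∂_i g_{j k̄} - ∂_j g_{i k̄}`. -/
def torsion (z : Fin n → ℂ) (i j k : Fin n) : ℂ :=
  dz i (fun w => G w j k) z - dz j (fun w => G w i k) z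

/-- The conjugate torsion `T_{ī j̄ k}`. -/
def torsionBar (z : Fin n → ℂ) (i j k : Fin n) : ℂ := star (torsion G z i j k)

/-- The Chern curvature `Ω_{l m̄ j k̄} = - g_{p k̄} ∂_m̄ Γ_{l j}^p`. -/
def chernCurv (z : Fin n → ℂ) (l m j k : Fin n) : ℂ :=
  -∑ p, G z p k * dzbar m (fun w => chernGamma G w l j p) z

/-- `S_{j k̄} = g^{l m̄} Ω_{l m̄ j k̄}`. -/
def chernS (z : Fin n → ℂ) (j k : Fin n) : ℂ :=
  ∑ l, ∑ m, gInv G z l m * chernCurv G z l m j k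

/-- `Q¹_{i j̄} = g^{k l̄} g^{m n̄} T_{i k n̄} T_{j̄ l̄ m}`. -/
def Q1 (z : Fin n → ℂ) (i j : Fin n) : ℂ :=
  ∑ k, ∑ l, ∑ m, ∑ q, gInv G z k l * gInv G z m q * torsion G z i k q * torsionBar G z j l m

/-- `Q²_{i j̄} = g^{k l̄} g^{m n̄} T_{l̄ n̄ i} T_{k m j̄}`. -/
def Q2 (z : Fin n → ℂ) (i j : Fin n) : ℂ :=
  ∑ k, ∑ l, ∑ m, ∑ q, gInv G z k l * gInv G z m q * torsionBar G z l q i * torsion G z k m j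

/-- `Q³_{i j̄} = g^{k l̄} g^{m n̄} T_{i k l̄} T_{j̄ n̄ m}`. -/
def Q3 (z : Fin n → ℂ) (i j : Fin n) : ℂ :=
  ∑ k, ∑ l, ∑ m, ∑ q, gInv G z k l * gInv G z m q * torsion G z i k l * torsionBar G z j q m

/-- `Q⁴_{i j̄} = ½ g^{k l̄} g^{m n̄} (T_{m k l̄} T_{n̄ j̄ i} + T_{n̄ l̄ k} T_{m i j̄})`. -/
def Q4 (z : Fin n → ℂ) (i j : Fin n) : ℂ :=
  (1 / 2 : ℂ) * ∑ k, ∑ l, ∑ m, ∑ q, gInv G z k l * gInv G z m q *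
    (torsion G z m k l * torsionBar G z q j i + torsionBar G z q l k * torsion G z m i j)

/-- `Q = ½ Q¹ - ¼ Q² - ½ Q³ + Q⁴`. -/
def torsionQ (z : Fin n → ℂ) (i j : Fin n) : ℂ :=
  (1 / 2 : ℂ) * Q1 G z i j - (1 / 4 : ℂ) * Q2 G z i j - (1 / 2 : ℂ) * Q3 G z i j + Q4 G z i j

/-- The trace `tr_g (S - Q) = g^{i j̄} (S - Q)_{i j̄}`. -/
def traceSQ (z : Fin n → ℂ) : ℂ :=
  ∑ i, ∑ j, gInv G z i j * (chernS G z i j - torsionQ G z i j)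

/-- The covariant derivative `∇_m̄ h_{j k̄} = ∂_m̄ h_{j k̄} - Γ_{m̄ k̄}^{p̄} h_{j p̄}` of a
`(1,1)`-tensor, where `Γ_{m̄ k̄}^{p̄}` is the conjugate of `Γ_{m k}^p`. -/
def covBar (H : (Fin n → ℂ) → Matrix (Fin n) (Fin n) ℂ) (z : Fin n → ℂ) (m j k : Fin n) : ℂ :=
  dzbar m (fun w => H w j k) z - ∑ p, star (chernGamma G z m k p) * H z j p

/-- The second covariant derivative
`∇_l ∇_m̄ h_{j k̄} = ∂_l (∇_m̄ h_{j k̄}) - Γ_{l j}^p ∇_m̄ h_{p k̄}`. -/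
def cov2 (H : (Fin n → ℂ) → Matrix (Fin n) (Fin n) ℂ) (z : Fin n → ℂ) (l m j k : Fin n) : ℂ :=
  dz l (fun w => covBar G H w m j k) z - ∑ p, chernGamma G z l j p * covBar G H z m p k

/-- The rough Laplacian `(∇*∇ h)_{j k̄} = - g^{l m̄} ∇_l ∇_m̄ h_{j k̄}`. -/
def roughLaplacian (H : (Fin n → ℂ) → Matrix (Fin n) (Fin n) ℂ) (z : Fin n → ℂ)
    (j k : Fin n) : ℂ :=
  -∑ l, ∑ m, gInv G z l m * cov2 G H z l m j k

/-- `h^{i j̄} = g^{i q̄} g^{p j̄} h_{p q̄}`. -/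
def raise (H : (Fin n → ℂ) → Matrix (Fin n) (Fin n) ℂ) (z : Fin n → ℂ) (i j : Fin n) : ℂ :=
  ∑ p, ∑ q, gInv G z i q * gInv G z p j * H z p q

/-- `R̊(h)_{k l̄} = h^{i j̄} R_{k j̄ i l̄}`. -/
def curvAction (H : (Fin n → ℂ) → Matrix (Fin n) (Fin n) ℂ) (z : Fin n → ℂ)
    (k l : Fin n) : ℂ :=
  ∑ i, ∑ j, raise G H z i j * chernCurv G z k j i l

end Local

/-! ### Hermitian metrics on a complex manifold -/

section Global

variable {n : ℕ} {M : Type*} [TopologicalSpace M] [ChartedSpace (Fin n → ℂ) M]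

/-- The (real) tangent space at `x`; its almost complex structure `J` is multiplication by `i`. -/
abbrev Tan (x : M) : Type := TangentSpace 𝓘(ℂ, Fin n → ℂ) x

/-- The coefficients `b_{i j̄}(z)`, in a holomorphic chart `e` with coordinates `zⁱ = xⁱ + √-1 yⁱ`,
of a `J`-invariant real symmetric `2`-tensor `b`:
`b_{i j̄} = b(∂/∂xⁱ, ∂/∂xʲ) + √-1 b(∂/∂xⁱ, J ∂/∂xʲ)`, so that `b` is the real part of
`∑ b_{i j̄} dzⁱ ⊗ dz̄ʲ`. For the Euclidean metric of `ℂⁿ` the coefficients are `δ_{ij}`. -/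
def coeff (b : ∀ x : M, LinearMap.BilinForm ℝ (Tan (n := n) x))
    (e : OpenPartialHomeomorph M (Fin n → ℂ)) (z : Fin n → ℂ) : Matrix (Fin n) (Fin n) ℂ :=
  Matrix.of fun i j =>
    let X : Fin n → Tan (n := n) (e.symm z) := fun k =>
      mfderiv 𝓘(ℂ, Fin n → ℂ) 𝓘(ℂ, Fin n → ℂ) e.symm z
        (Pi.single k 1 : Fin n → ℂ)
    (b (e.symm z) (X i) (X j) : ℂ) + Complex.I * (b (e.symm z) (X i) (Complex.I • X j) : ℂ)

variable (n M) in
/-- A smooth Riemannian metric on the complex manifold `M` that is compatible with the complex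
structure `J`. -/
structure HermitianMetric where
  form : ∀ x : M, LinearMap.BilinForm ℝ (Tan (n := n) x)
  symm : ∀ x u v, form x u v = form x v u
  compat : ∀ x u v, form x (Complex.I • u) (Complex.I • v) = form x u v
  pos : ∀ x u, u ≠ 0 → 0 < form x u u
  smooth : ∀ e ∈ IsManifold.maximalAtlas 𝓘(ℂ, Fin n → ℂ) ω M, ∀ i j,
    ContDiffOn ℝ ∞ (fun z => coeff form e z i j) e.target

namespace HermitianMetric

/-- The coefficient matrix `g_{i j̄}` in a holomorphic chart. -/
def mat (g : HermitianMetric n M) (e : OpenPartialHomeomorph M (Fin n → ℂ)) (z : Fin n → ℂ) :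
    Matrix (Fin n) (Fin n) ℂ := coeff g.form e z

/-- The Riemannian volume measure: in every holomorphic chart it is `det (g_{i j̄})` times Lebesgue
measure. It is built as the least upper bound, among measures on `M`, of these mutually compatible
measures on the chart domains. -/
def vol [MeasurableSpace M] (g : HermitianMetric n M) : MeasureTheory.Measure M :=
  ⨆ e ∈ IsManifold.maximalAtlas 𝓘(ℂ, Fin n → ℂ) ω M,
    MeasureTheory.Measure.map e.symm
      ((MeasureTheory.volume.restrict e.target).withDensity
        fun z => ENNReal.ofReal (g.mat e z).det.re)

/-- The function `tr_g (S - Q)` on `M`; a scalar, so it may be computed in any chart. -/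
def traceSQ (g : HermitianMetric n M) (x : M) : ℂ :=
  HermitianFlow.traceSQ (g.mat (chartAt (Fin n → ℂ) x)) (chartAt (Fin n → ℂ) x x)

/-- The volume-normalised operator `𝓕(g) = S - Q - (1/n) (∫_M tr_g (S - Q) dV) g`, in components
in the chart `e`. -/
def opF [MeasurableSpace M] (g : HermitianMetric n M)
    (e : OpenPartialHomeomorph M (Fin n → ℂ)) (z : Fin n → ℂ) (j k : Fin n) : ℂ :=
  chernS (g.mat e) z j k - torsionQ (g.mat e) z j k
    - (1 / n : ℂ) * (∫ x, g.traceSQ x ∂g.vol) * g.mat e z j k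

/-- `g` is Kähler: the torsion of its Chern connection vanishes (equivalently `dω = 0`). -/
def IsKahler (g : HermitianMetric n M) : Prop :=
  ∀ e ∈ IsManifold.maximalAtlas 𝓘(ℂ, Fin n → ℂ) ω M, ∀ z ∈ e.target, ∀ i j k,
    torsion (g.mat e) z i j k = 0

/-- `g` is Kähler–Einstein: it is Kähler and its Ricci curvature, which for a Kähler metric is `S`,
is a constant real multiple of `g`. -/
def IsKahlerEinstein (g : HermitianMetric n M) : Prop :=
  g.IsKahler ∧ ∃ c : ℝ, ∀ e ∈ IsManifold.maximalAtlas 𝓘(ℂ, Fin n → ℂ) ω M, ∀ z ∈ e.target,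
    ∀ j k, chernS (g.mat e) z j k = (c : ℂ) * g.mat e z j k

end HermitianMetric

/-- The family `g(a)`, `|a| < ε`, depends smoothly on the parameter and the point jointly. -/
def SmoothFamily (g : ℝ → HermitianMetric n M) (ε : ℝ) : Prop :=
  ∀ e ∈ IsManifold.maximalAtlas 𝓘(ℂ, Fin n → ℂ) ω M, ∀ i j,
    ContDiffOn ℝ ∞ (fun p : ℝ × (Fin n → ℂ) => (g p.1).mat e p.2 i j)
      (Set.Ioo (-ε) ε ×ˢ e.target)

end Global

end HermitianFlow

end

/-! Write h for the derivative of g(a) at a = 0. Differentiating Ω_{l m̄} = -∂_m̄∂_l g + ∂_l g · g⁻¹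
· ∂_m̄ g and exchanging the a-derivative with the z-derivatives gives δΩ_{l m̄} = h g⁻¹ Ω_{l m̄} -
∇_l∇_m̄ h (`cfdM_curvMat`), for any Hermitian metric. Contracting with g^{l m̄}, whose variation is
-h^{l m̄}, yields δS = h g⁻¹ S + ∇*∇h - h^{l m̄} Ω_{l m̄} (`cfdM_sMat`). At a Kähler–Einstein metric
S = c g, so the first term is c h, and the last one is R̊(h) by a Kähler symmetry of the curvature
(`curvAction_eq`). Since Q is quadratic in the torsion, which vanishes at a = 0, δQ = 0
(`cfd_qForm`).

The normalising term must therefore vary by -c h. At a = 0 one has tr(S - Q) = nc and volume 1, so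
the coefficient of g is c, and it has to be shown stationary (`hasDerivAt_integral_traceSQ`). The
variation of tr(S - Q) is -Δ tr h - c tr h (`cfd_scalSQ`), and that of dV is tr h dV
(`cfd_det_family`), which contributes nc tr h. Now ∫ tr h = 0 because the volume is constant, and ∫
Δ tr h = 0 by the divergence theorem on a Kähler manifold (`integral_laplacian`).

The parameter a is treated as one more coordinate: a family of metrics is, in a chart, a
matrix-valued function on ℝ × ℂⁿ, and `cfd` handles ∂_a, ∂_i and ∂_ī uniformly. The variation
formulas then reduce to product rules and commuting derivatives. The global statements need that
tr(S - Q) and Δ do not depend on the chart (`scalSQ_change`, `lapl_change`), that the supremum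
measure `vol` has the expected density in each chart (`vol_restrict_source`), and a partition of
unity. -/

namespace HermitianFlow

open Complex Matrix

/-- The conjugate of a complexified direction. -/
def conjDir {X : Type*} [AddCommGroup X] (ξ : X × X) : X × X := (ξ.1, -ξ.2)

@[simp] lemma conjDir_conjDir {X : Type*} [AddCommGroup X] (ξ : X × X) :
    conjDir (conjDir ξ) = ξ := by simp [conjDir]

/-! ### Derivatives of scalar and matrix functions in complexified directions. -/

section Calculus

variable {X : Type*} [NormedAddCommGroup X] [NormedSpace ℝ X]

/-- The derivative of `f` in the complexified direction `ξ.1 + √-1 ξ.2`. -/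
noncomputable def cfd (ξ : X × X) (f : X → ℂ) (x : X) : ℂ :=
  fderiv ℝ f x ξ.1 + I * fderiv ℝ f x ξ.2

variable {ξ η : X × X} {f g : X → ℂ} {x : X}

lemma cfd_congr (h : f =ᶠ[nhds x] g) : cfd ξ f x = cfd ξ g x := by
  simp only [cfd, h.fderiv_eq]

@[simp] lemma cfd_const (c : ℂ) : cfd ξ (fun _ => c) x = 0 := by simp [cfd]

lemma cfd_add (hf : DifferentiableAt ℝ f x) (hg : DifferentiableAt ℝ g x) :
    cfd ξ (fun y => f y + g y) x = cfd ξ f x + cfd ξ g x := by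
  simp only [cfd, fderiv_fun_add hf hg, _root_.add_apply]; ring

lemma cfd_sub (hf : DifferentiableAt ℝ f x) (hg : DifferentiableAt ℝ g x) :
    cfd ξ (fun y => f y - g y) x = cfd ξ f x - cfd ξ g x := by
  simp only [cfd, fderiv_fun_sub hf hg, _root_.sub_apply]; ring

lemma cfd_mul (hf : DifferentiableAt ℝ f x) (hg : DifferentiableAt ℝ g x) :
    cfd ξ (fun y => f y * g y) x = cfd ξ f x * g x + f x * cfd ξ g x := by
  simp only [cfd, fderiv_fun_mul hf hg, _root_.add_apply, _root_.smul_apply, smul_eq_mul]; ring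

lemma cfd_sum {ι : Type*} {s : Finset ι} {F : ι → X → ℂ}
    (hF : ∀ i ∈ s, DifferentiableAt ℝ (F i) x) :
    cfd ξ (fun y => ∑ i ∈ s, F i y) x = ∑ i ∈ s, cfd ξ (F i) x := by
  simp only [cfd, fderiv_fun_sum hF, _root_.sum_apply, Finset.sum_add_distrib, Finset.mul_sum]

/-- Conjugation is real-linear, so it passes through `fderiv` and only flips the sign of the factor
`I`. -/
lemma cfd_star (f : X → ℂ) : cfd ξ (fun y => star (f y)) x = star (cfd (conjDir ξ) f x) := by
  have : fderiv ℝ (fun y => star (f y)) x = (starL' ℝ : ℂ ≃L[ℝ] ℂ).toContinuousLinearMap ∘L fderiv ℝ f x :=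
    (starL' ℝ : ℂ ≃L[ℝ] ℂ).comp_fderiv
  simp only [cfd, this, conjDir]
  simp

lemma contDiffOn_cfd {U : Set X} (hU : IsOpen U) (hf : ContDiffOn ℝ ∞ f U) :
    ContDiffOn ℝ ∞ (cfd ξ f) U := by
  have h := hf.fderiv_of_isOpen (m := ∞) hU (by simp)
  exact (h.clm_apply contDiffOn_const).add (contDiffOn_const.mul (h.clm_apply contDiffOn_const))

lemma differentiableAt_of_contDiffOn {F : Type*} [NormedAddCommGroup F] [NormedSpace ℝ F]
    {f : X → F} {U : Set X} (hU : IsOpen U) (hf : ContDiffOn ℝ ∞ f U)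
    (hx : x ∈ U) : DifferentiableAt ℝ f x :=
  (hf.contDiffAt (hU.mem_nhds hx)).differentiableAt (by simp)

/-- Symmetry of the real second derivative, extended complex-bilinearly. On ℝ × ℂⁿ this includes the
exchange of the parameter derivative with ∂_i and ∂_ī. -/
lemma cfd_comm {U : Set X} (hU : IsOpen U) (hf : ContDiffOn ℝ ∞ f U) (hx : x ∈ U) :
    cfd ξ (cfd η f) x = cfd η (cfd ξ f) x := by
  have h1 : ContDiffAt ℝ ∞ f x := hf.contDiffAt (hU.mem_nhds hx)
  have h2 : IsSymmSndFDerivAt ℝ f x := h1.isSymmSndFDerivAt (by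
    rw [minSmoothness_of_isRCLikeNormedField]; exact WithTop.coe_le_coe.2 le_top)
  have h3 : DifferentiableAt ℝ (fderiv ℝ f) x :=
    differentiableAt_of_contDiffOn hU (hf.fderiv_of_isOpen (m := ∞) hU (by simp)) hx
  have key : ∀ v w : X, fderiv ℝ (fun y => fderiv ℝ f y v) x w = fderiv ℝ (fderiv ℝ f) x w v := by
    intro v w
    rw [fderiv_clm_apply h3 (differentiableAt_const v)]
    simp
  have hd : ∀ v : X, DifferentiableAt ℝ (fun y => fderiv ℝ f y v) x := fun v =>
    h3.clm_apply (differentiableAt_const v)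
  have e : ∀ ξ η : X × X, cfd ξ (cfd η f) x =
      (fderiv ℝ (fderiv ℝ f) x ξ.1 η.1 + I * fderiv ℝ (fderiv ℝ f) x ξ.1 η.2) +
      I * (fderiv ℝ (fderiv ℝ f) x ξ.2 η.1 + I * fderiv ℝ (fderiv ℝ f) x ξ.2 η.2) := by
    intro ξ η
    have : ∀ w, fderiv ℝ (cfd η f) x w = fderiv ℝ (fderiv ℝ f) x w η.1 +
        I * fderiv ℝ (fderiv ℝ f) x w η.2 := by
      intro w
      have : cfd η f = fun y => fderiv ℝ f y η.1 + I * fderiv ℝ f y η.2 := rfl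
      rw [this, fderiv_fun_add (hd _) ((hd _).const_mul I), fderiv_const_mul (hd _)]
      simp [key]
    rw [cfd, this, this]
  rw [e, e, h2.eq ξ.1 η.1, h2.eq ξ.1 η.2, h2.eq ξ.2 η.1, h2.eq ξ.2 η.2]
  ring

/-! ### Matrix-valued functions -/

variable {n : ℕ}

/-- Entrywise smoothness of a matrix-valued function. -/
def SmoothMatOn (F : X → Matrix (Fin n) (Fin n) ℂ) (U : Set X) : Prop :=
  ∀ j k, ContDiffOn ℝ ∞ (fun y => F y j k) U

/-- Entrywise differentiability of a matrix-valued function. -/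
def DiffMatAt (F : X → Matrix (Fin n) (Fin n) ℂ) (x : X) : Prop :=
  ∀ j k, DifferentiableAt ℝ (fun y => F y j k) x

/-- The entrywise derivative of a matrix-valued function in a complexified direction. -/
noncomputable def cfdM (ξ : X × X) (F : X → Matrix (Fin n) (Fin n) ℂ) (x : X) :
    Matrix (Fin n) (Fin n) ℂ :=
  Matrix.of fun j k => cfd ξ (fun y => F y j k) x

variable {F H : X → Matrix (Fin n) (Fin n) ℂ} {U : Set X}

lemma SmoothMatOn.diffMatAt (hU : IsOpen U) (hF : SmoothMatOn F U) (hx : x ∈ U) :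
    DiffMatAt F x := fun j k => differentiableAt_of_contDiffOn hU (hF j k) hx

lemma SmoothMatOn.cfdM (hU : IsOpen U) (hF : SmoothMatOn F U) : SmoothMatOn (cfdM ξ F) U :=
  fun j k => contDiffOn_cfd hU (hF j k)

lemma SmoothMatOn.congr (hF : SmoothMatOn F U) (h : ∀ y ∈ U, H y = F y) : SmoothMatOn H U :=
  fun j k => (hF j k).congr fun y hy => by rw [h y hy]

lemma SmoothMatOn.mul (hF : SmoothMatOn F U) (hH : SmoothMatOn H U) :
    SmoothMatOn (fun y => F y * H y) U := fun j k => by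
  simp only [Matrix.mul_apply]
  exact ContDiffOn.sum fun i _ => (hF j i).mul (hH i k)

lemma SmoothMatOn.sub (hF : SmoothMatOn F U) (hH : SmoothMatOn H U) :
    SmoothMatOn (fun y => F y - H y) U := fun j k => (hF j k).sub (hH j k)

lemma SmoothMatOn.neg (hF : SmoothMatOn F U) : SmoothMatOn (fun y => - F y) U :=
  fun j k => (hF j k).neg

lemma SmoothMatOn.trace (hF : SmoothMatOn F U) : ContDiffOn ℝ ∞ (fun y => (F y).trace) U := by
  simp only [Matrix.trace, Matrix.diag]
  exact ContDiffOn.sum fun i _ => hF i i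

lemma contDiffOn_star {f : X → ℂ} (hf : ContDiffOn ℝ ∞ f U) :
    ContDiffOn ℝ ∞ (fun y => star (f y)) U :=
  (starL' ℝ : ℂ ≃L[ℝ] ℂ).toContinuousLinearMap.contDiff.comp_contDiffOn hf

lemma SmoothMatOn.conjTranspose (hF : SmoothMatOn F U) : SmoothMatOn (fun y => (F y)ᴴ) U :=
  fun j k => contDiffOn_star (hF k j)

lemma SmoothMatOn.det (hF : SmoothMatOn F U) : ContDiffOn ℝ ∞ (fun y => (F y).det) U := by
  simp only [Matrix.det_apply]
  exact ContDiffOn.sum fun σ _ => (contDiffOn_prod fun i _ => hF _ _).const_smul _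

lemma SmoothMatOn.inv (hF : SmoothMatOn F U) (h0 : ∀ y ∈ U, (F y).det ≠ 0) :
    SmoothMatOn (fun y => (F y)⁻¹) U := fun j k => by
  simp only [Matrix.inv_def, Matrix.smul_apply, Ring.inverse_eq_inv', smul_eq_mul]
  refine (hF.det.inv h0).mul ?_
  simp only [Matrix.adjugate_apply]
  refine SmoothMatOn.det fun a b => ?_
  by_cases hak : a = k
  · subst hak; simpa using contDiffOn_const
  · simpa [Matrix.updateRow_ne hak] using hF a b

lemma cfdM_congr (h : F =ᶠ[nhds x] H) : cfdM ξ F x = cfdM ξ H x := by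
  ext j k
  exact cfd_congr (h.mono fun y hy => by simp only [hy])

lemma cfdM_mul (hF : DiffMatAt F x) (hH : DiffMatAt H x) :
    cfdM ξ (fun y => F y * H y) x = cfdM ξ F x * H x + F x * cfdM ξ H x := by
  ext j k
  simp only [cfdM, Matrix.of_apply, Matrix.add_apply, Matrix.mul_apply]
  rw [cfd_sum (F := fun i y => F y j i * H y i k) fun i _ => (hF j i).mul (hH i k),
    ← Finset.sum_add_distrib]
  exact Finset.sum_congr rfl fun i _ => cfd_mul (hF j i) (hH i k)

lemma cfdM_sub (hF : DiffMatAt F x) (hH : DiffMatAt H x) :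
    cfdM ξ (fun y => F y - H y) x = cfdM ξ F x - cfdM ξ H x := by
  ext j k
  exact cfd_sub (hF j k) (hH j k)

lemma cfdM_trace (hF : DiffMatAt F x) :
    cfd ξ (fun y => (F y).trace) x = (cfdM ξ F x).trace := by
  simp only [Matrix.trace, Matrix.diag]
  exact cfd_sum fun i _ => hF i i

lemma cfdM_conjTranspose (F : X → Matrix (Fin n) (Fin n) ℂ) :
    cfdM ξ (fun y => (F y)ᴴ) x = (cfdM (conjDir ξ) F x)ᴴ := by
  ext j k
  exact cfd_star _

lemma cfdM_comm (hU : IsOpen U) (hF : SmoothMatOn F U) (hx : x ∈ U) :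
    cfdM ξ (cfdM η F) x = cfdM η (cfdM ξ F) x := by
  ext j k
  exact cfd_comm hU (hF j k) hx

/-- Obtained by differentiating F F⁻¹ = 1. -/
lemma cfdM_inv (hU : IsOpen U) (hF : SmoothMatOn F U) (h0 : ∀ y ∈ U, (F y).det ≠ 0)
    (hx : x ∈ U) :
    cfdM ξ (fun y => (F y)⁻¹) x = -((F x)⁻¹ * cfdM ξ F x * (F x)⁻¹) := by
  have h1 : cfdM ξ (fun y => F y * (F y)⁻¹) x = 0 := by
    rw [cfdM_congr (H := fun _ => 1)]
    · ext j k; simp [cfdM]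
    · filter_upwards [hU.mem_nhds hx] with y hy
      exact Matrix.mul_nonsing_inv _ (isUnit_iff_ne_zero.2 (h0 y hy))
  rw [cfdM_mul (hF.diffMatAt hU hx) ((hF.inv h0).diffMatAt hU hx)] at h1
  have h2 := congrArg (fun A => (F x)⁻¹ * A) h1
  simp only [mul_add, ← mul_assoc, mul_zero,
    Matrix.nonsing_inv_mul _ (isUnit_iff_ne_zero.2 (h0 x hx)), one_mul] at h2
  exact eq_neg_of_add_eq_zero_right h2

lemma differentiableAt_prod {ι : Type*} [DecidableEq ι] {s : Finset ι} {f : ι → X → ℂ}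
    (hf : ∀ i ∈ s, DifferentiableAt ℝ (f i) x) :
    DifferentiableAt ℝ (fun y => ∏ i ∈ s, f i y) x :=
  (HasFDerivAt.finsetProd fun i hi => (hf i hi).hasFDerivAt).differentiableAt

lemma cfd_prod {ι : Type*} [DecidableEq ι] {s : Finset ι} {f : ι → X → ℂ}
    (hf : ∀ i ∈ s, DifferentiableAt ℝ (f i) x) :
    cfd ξ (fun y => ∏ i ∈ s, f i y) x = ∑ i ∈ s, (∏ j ∈ s.erase i, f j x) * cfd ξ (f i) x := by
  simp only [cfd, fderiv_finsetProd hf, _root_.sum_apply, _root_.smul_apply, smul_eq_mul,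
    mul_add, Finset.sum_add_distrib, Finset.mul_sum]
  congr 1
  exact Finset.sum_congr rfl fun i _ => by ring

/-- Jacobi's formula. Differentiating the Leibniz expansion gives the sum of the determinants in
which one column is replaced by its derivative; Cramer's rule identifies this sum with tr(adj F ·
F'). -/
lemma cfd_det (hF : DiffMatAt F x) (h0 : (F x).det ≠ 0) :
    cfd ξ (fun y => (F y).det) x = (F x).det * ((F x)⁻¹ * cfdM ξ F x).trace := by
  have h1 : cfd ξ (fun y => (F y).det) x =
      ∑ σ : Equiv.Perm (Fin n), ((σ.sign : ℤ) : ℂ) *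
        ∑ i, (∏ j ∈ Finset.univ.erase i, F x (σ j) j) * cfdM ξ F x (σ i) i := by
    simp only [Matrix.det_apply']
    rw [cfd_sum (F := fun (σ : Equiv.Perm (Fin n)) y => ((σ.sign : ℤ) : ℂ) * ∏ i, F y (σ i) i)]
    · refine Finset.sum_congr rfl fun σ _ => ?_
      rw [cfd_mul (f := fun _ => ((σ.sign : ℤ) : ℂ)) (differentiableAt_const _), cfd_const,
        zero_mul, zero_add, cfd_prod fun i _ => hF _ _]
      · rfl
      · exact differentiableAt_prod fun i _ => hF _ _
    · intro σ _
      exact (differentiableAt_prod fun i _ => hF _ _).const_mul _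
  have h2 : ((F x).adjugate * cfdM ξ F x).trace =
      ∑ i, ((F x).updateCol i fun a => cfdM ξ F x a i).det := by
    simp only [Matrix.trace, Matrix.diag]
    refine Finset.sum_congr rfl fun i _ => ?_
    rw [← Matrix.cramer_apply, Matrix.cramer_eq_adjugate_mulVec]
    simp [Matrix.mul_apply, Matrix.mulVec, dotProduct]
  have h3 : (F x).adjugate = (F x).det • (F x)⁻¹ := by
    rw [Matrix.inv_def, smul_smul, Ring.mul_inverse_cancel _ (isUnit_iff_ne_zero.2 h0), one_smul]
  rw [← smul_eq_mul, ← Matrix.trace_smul, ← Matrix.smul_mul, ← h3, h2, h1]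
  simp only [Matrix.det_apply', Finset.mul_sum]
  rw [Finset.sum_comm]
  refine Finset.sum_congr rfl fun i _ => Finset.sum_congr rfl fun σ _ => ?_
  rw [← Finset.prod_erase_mul _ _ (Finset.mem_univ i), Matrix.updateCol_self]
  congr 2
  refine Finset.prod_congr rfl fun j hj => ?_
  rw [Matrix.updateCol_ne (Finset.ne_of_mem_erase hj)]

end Calculus

end HermitianFlow

namespace HermitianFlow

open Complex Matrix

/-! ### The Chern connection and curvature as matrix expressions, and the variation of the
curvature. -/

section Chern

variable {X : Type*} [NormedAddCommGroup X] [NormedSpace ℝ X] {n : ℕ}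

/-- The matrix `(Γ_{ζ j}^k)_{jk}` of Christoffel symbols in the direction `ζ`. -/
noncomputable def gammaMat (ζ : X × X) (G : X → Matrix (Fin n) (Fin n) ℂ) (x : X) :
    Matrix (Fin n) (Fin n) ℂ := cfdM ζ G x * (G x)⁻¹

/-- The matrix `(Ω_{ζ η j k̄})_{jk}` of the Chern curvature. -/
noncomputable def curvMat (ζ η : X × X) (G : X → Matrix (Fin n) (Fin n) ℂ) (x : X) :
    Matrix (Fin n) (Fin n) ℂ :=
  -cfdM η (cfdM ζ G) x + cfdM ζ G x * (G x)⁻¹ * cfdM η G x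

/-- The matrix `(∇_η h_{j k̄})_{jk}`. -/
noncomputable def covMat (η : X × X) (G H : X → Matrix (Fin n) (Fin n) ℂ) (x : X) :
    Matrix (Fin n) (Fin n) ℂ := cfdM η H x - H x * (G x)⁻¹ * cfdM η G x

/-- The matrix `(∇_ζ ∇_η h_{j k̄})_{jk}`. -/
noncomputable def cov2Mat (ζ η : X × X) (G H : X → Matrix (Fin n) (Fin n) ℂ) (x : X) :
    Matrix (Fin n) (Fin n) ℂ := cfdM ζ (covMat η G H) x - gammaMat ζ G x * covMat η G H x

/-- The matrix `(S_{j k̄})_{jk}` for the coordinate directions `ζ`. -/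
noncomputable def sMat (ζ : Fin n → X × X) (G : X → Matrix (Fin n) (Fin n) ℂ) (x : X) :
    Matrix (Fin n) (Fin n) ℂ :=
  ∑ l, ∑ m, (G x)⁻¹ m l • curvMat (ζ l) (conjDir (ζ m)) G x

variable {ζ η τ : X × X} {G H : X → Matrix (Fin n) (Fin n) ℂ} {U : Set X} {x : X}

lemma smoothMatOn_gammaMat (hU : IsOpen U) (hG : SmoothMatOn G U) (h0 : ∀ y ∈ U, (G y).det ≠ 0) :
    SmoothMatOn (gammaMat ζ G) U := (hG.cfdM hU).mul (hG.inv h0)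

lemma smoothMatOn_covMat (hU : IsOpen U) (hG : SmoothMatOn G U) (h0 : ∀ y ∈ U, (G y).det ≠ 0)
    (hH : SmoothMatOn H U) : SmoothMatOn (covMat η G H) U :=
  (hH.cfdM hU).sub ((hH.mul (hG.inv h0)).mul (hG.cfdM hU))

lemma smoothMatOn_curvMat (hU : IsOpen U) (hG : SmoothMatOn G U) (h0 : ∀ y ∈ U, (G y).det ≠ 0) :
    SmoothMatOn (curvMat ζ η G) U := by
  intro j k
  exact (((hG.cfdM hU).cfdM hU).neg j k).add
    ((((hG.cfdM hU).mul (hG.inv h0)).mul (hG.cfdM hU)) j k)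

lemma smoothMatOn_sMat {ζ : Fin n → X × X} (hU : IsOpen U) (hG : SmoothMatOn G U)
    (h0 : ∀ y ∈ U, (G y).det ≠ 0) :
    SmoothMatOn (sMat ζ G) U := by
  intro j k
  simp only [sMat, Matrix.sum_apply, Matrix.smul_apply, smul_eq_mul]
  exact ContDiffOn.sum fun l _ => ContDiffOn.sum fun m _ =>
    (hG.inv h0 m l).mul (smoothMatOn_curvMat hU hG h0 j k)

/-- The product rule for Γ = ∂_ζ G · G⁻¹ turns the definition of the curvature through Γ into the
form of `curvMat`, in which no derivative of G⁻¹ occurs. -/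
lemma curvMat_eq (hU : IsOpen U) (hG : SmoothMatOn G U) (h0 : ∀ y ∈ U, (G y).det ≠ 0)
    (hx : x ∈ U) : -(cfdM η (gammaMat ζ G) x * G x) = curvMat ζ η G x := by
  have hd := hG.diffMatAt hU hx
  have : cfdM η (gammaMat ζ G) x = _ :=
    cfdM_mul ((hG.cfdM hU).diffMatAt hU hx) ((hG.inv h0).diffMatAt hU hx)
  rw [this, cfdM_inv hU hG h0 hx, curvMat]
  simp only [add_mul, mul_neg, neg_mul, mul_assoc,
    Matrix.nonsing_inv_mul _ (isUnit_iff_ne_zero.2 (h0 x hx)), mul_one]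
  abel

/-- Tracing the endomorphism index leaves a single derivative of the scalar tr Γ. Coordinate
invariance of tr S is checked on this form, which avoids transforming second derivatives of G. -/
lemma trace_inv_mul_curvMat (hU : IsOpen U) (hG : SmoothMatOn G U)
    (h0 : ∀ y ∈ U, (G y).det ≠ 0) (hx : x ∈ U) :
    ((G x)⁻¹ * curvMat ζ η G x).trace = -cfd η (fun y => (gammaMat ζ G y).trace) x := by
  rw [← curvMat_eq hU hG h0 hx,
    cfdM_trace ((smoothMatOn_gammaMat hU hG h0).diffMatAt hU hx), mul_neg, Matrix.trace_neg,
    Matrix.trace_mul_comm, mul_assoc, Matrix.mul_nonsing_inv _ (isUnit_iff_ne_zero.2 (h0 x hx)),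
    mul_one]

/-- The first variation of the Chern curvature. -/
lemma cfdM_curvMat (hU : IsOpen U) (hG : SmoothMatOn G U) (h0 : ∀ y ∈ U, (G y).det ≠ 0)
    (hx : x ∈ U) :
    cfdM τ (curvMat ζ η G) x =
      cfdM τ G x * (G x)⁻¹ * curvMat ζ η G x - cov2Mat ζ η G (cfdM τ G) x := by
  have hD : ∀ ξ : X × X, SmoothMatOn (cfdM ξ G) U := fun ξ => hG.cfdM hU
  have hI := hG.inv h0
  have e1 : cfdM τ (curvMat ζ η G) x = -cfdM τ (cfdM η (cfdM ζ G)) x +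
      ((cfdM τ (cfdM ζ G) x * (G x)⁻¹ + cfdM ζ G x * -((G x)⁻¹ * cfdM τ G x * (G x)⁻¹)) *
        cfdM η G x + cfdM ζ G x * (G x)⁻¹ * cfdM τ (cfdM η G) x) := by
    have : curvMat ζ η G = fun y =>
        cfdM ζ G y * (G y)⁻¹ * cfdM η G y - cfdM η (cfdM ζ G) y := by
      funext y; rw [curvMat]; abel
    rw [this, cfdM_sub ((((hD ζ).mul hI).mul (hD η)).diffMatAt hU hx)
      (((hD ζ).cfdM hU).diffMatAt hU hx),
      cfdM_mul (F := fun y => cfdM ζ G y * (G y)⁻¹) (((hD ζ).mul hI).diffMatAt hU hx)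
        ((hD η).diffMatAt hU hx),
      cfdM_mul ((hD ζ).diffMatAt hU hx) (hI.diffMatAt hU hx), cfdM_inv hU hG h0 hx]
    abel
  have e2 : cfdM ζ (covMat η G (cfdM τ G)) x = cfdM ζ (cfdM η (cfdM τ G)) x -
      ((cfdM ζ (cfdM τ G) x * (G x)⁻¹ + cfdM τ G x * -((G x)⁻¹ * cfdM ζ G x * (G x)⁻¹)) *
        cfdM η G x + cfdM τ G x * (G x)⁻¹ * cfdM ζ (cfdM η G) x) := by
    have : covMat η G (cfdM τ G) = fun y =>
        cfdM η (cfdM τ G) y - cfdM τ G y * (G y)⁻¹ * cfdM η G y := rfl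
    rw [this, cfdM_sub (((hD τ).cfdM hU).diffMatAt hU hx)
        ((((hD τ).mul hI).mul (hD η)).diffMatAt hU hx),
      cfdM_mul (F := fun y => cfdM τ G y * (G y)⁻¹) (((hD τ).mul hI).diffMatAt hU hx)
        ((hD η).diffMatAt hU hx),
      cfdM_mul ((hD τ).diffMatAt hU hx) (hI.diffMatAt hU hx), cfdM_inv hU hG h0 hx]
  -- The third derivatives of G agree after two exchanges, the inner one performed on a
  -- neighbourhood of x. What remains is algebra in first and second derivatives.
  have c1 : cfdM τ (cfdM η (cfdM ζ G)) x = cfdM ζ (cfdM η (cfdM τ G)) x := by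
    rw [cfdM_comm hU (hD ζ) hx]
    rw [cfdM_congr (F := cfdM τ (cfdM ζ G)) (H := cfdM ζ (cfdM τ G))]
    · rw [cfdM_comm hU (hD τ) hx]
    · filter_upwards [hU.mem_nhds hx] with y hy using cfdM_comm hU hG hy
  rw [cov2Mat, e1, e2, c1, gammaMat, covMat, curvMat, cfdM_comm (ξ := τ) (η := ζ) hU hG hx,
    cfdM_comm (ξ := τ) (η := η) hU hG hx, cfdM_comm (ξ := ζ) (η := η) hU hG hx]
  simp only [mul_add, mul_sub, add_mul, mul_neg, neg_mul, mul_assoc]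
  abel

/-- The covariant derivative is compatible with traces. -/
lemma trace_inv_mul_cov2Mat (hU : IsOpen U) (hG : SmoothMatOn G U) (h0 : ∀ y ∈ U, (G y).det ≠ 0)
    (hH : SmoothMatOn H U) (hx : x ∈ U) :
    ((G x)⁻¹ * cov2Mat ζ η G H x).trace =
      cfd ζ (cfd η fun y => ((G y)⁻¹ * H y).trace) x := by
  have hI := hG.inv h0
  have hC := smoothMatOn_covMat (η := η) hU hG h0 hH
  -- The derivative of G⁻¹ reproduces the connection term of `covMat` by cyclicity of the trace; the
  -- outer derivative below works in the same way with `gammaMat`.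
  have e1 : ∀ y ∈ U, cfd η (fun y => ((G y)⁻¹ * H y).trace) y =
      ((G y)⁻¹ * covMat η G H y).trace := by
    intro y hy
    rw [cfdM_trace ((hI.mul hH).diffMatAt hU hy), cfdM_mul (hI.diffMatAt hU hy)
      (hH.diffMatAt hU hy), cfdM_inv hU hG h0 hy, covMat, mul_sub, Matrix.trace_sub,
      Matrix.trace_add, neg_mul, Matrix.trace_neg]
    have : ((G y)⁻¹ * cfdM η G y * (G y)⁻¹ * H y).trace =
        ((G y)⁻¹ * (H y * (G y)⁻¹ * cfdM η G y)).trace := by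
      rw [mul_assoc, Matrix.trace_mul_comm]; simp only [mul_assoc]
    rw [this]; ring
  rw [cfd_congr (g := fun y => ((G y)⁻¹ * covMat η G H y).trace)]
  · rw [cfdM_trace ((hI.mul hC).diffMatAt hU hx), cfdM_mul (hI.diffMatAt hU hx)
      (hC.diffMatAt hU hx), cfdM_inv hU hG h0 hx, cov2Mat, gammaMat, mul_sub, Matrix.trace_sub,
      Matrix.trace_add, neg_mul, Matrix.trace_neg]
    simp only [mul_assoc]
    ring
  · filter_upwards [hU.mem_nhds hx] with y hy using e1 y hy

lemma cfdM_conj_of_isHermitian (hU : IsOpen U) (hh : ∀ y ∈ U, (G y).IsHermitian) (hx : x ∈ U) :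
    (cfdM ζ G x)ᴴ = cfdM (conjDir ζ) G x := by
  have := cfdM_conjTranspose (ξ := conjDir ζ) (x := x) G
  rw [conjDir_conjDir] at this
  rw [← this]
  refine cfdM_congr ?_
  filter_upwards [hU.mem_nhds hx] with y hy using hh y hy

end Chern

end HermitianFlow

namespace HermitianFlow

open Complex Matrix

/-! ### The algebra of Q: its trace, and invariance under a change of frame. -/

section TorsionQuadratic

variable {n : ℕ}

/-- The quadratic expression `Q_{i j̄}` as a function of the inverse matrix `P` of the metric and
the torsion `T`. -/
noncomputable def qForm (P : Matrix (Fin n) (Fin n) ℂ) (T : Fin n → Matrix (Fin n) (Fin n) ℂ)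
    (i j : Fin n) : ℂ :=
  (1 / 2 : ℂ) * (∑ k, ∑ l, ∑ m, ∑ q, P l k * P q m * T i k q * star (T j l m))
  - (1 / 4 : ℂ) * (∑ k, ∑ l, ∑ m, ∑ q, P l k * P q m * star (T l q i) * T k m j)
  - (1 / 2 : ℂ) * (∑ k, ∑ l, ∑ m, ∑ q, P l k * P q m * T i k l * star (T j q m))
  + (1 / 2 : ℂ) * ∑ k, ∑ l, ∑ m, ∑ q, P l k * P q m *
    (T m k l * star (T q j i) + star (T q l k) * T m i j)

/-- The squared norm of the torsion. -/
noncomputable def torsionNormSq (P : Matrix (Fin n) (Fin n) ℂ)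
    (T : Fin n → Matrix (Fin n) (Fin n) ℂ) : ℂ :=
  ∑ i, ∑ j, P j i * (P * T i * P * (T j)ᴴ).trace

/-- The squared norm of the trace of the torsion. -/
noncomputable def torsionTraceNormSq (P : Matrix (Fin n) (Fin n) ℂ)
    (T : Fin n → Matrix (Fin n) (Fin n) ℂ) : ℂ :=
  ∑ i, ∑ j, P j i * ((P * T i).trace * star (P * T j).trace)

lemma sum_pair_comm {ι : Type*} [Fintype ι] (f : ι → ι → ι → ι → ℂ) :
    ∑ i, ∑ j, ∑ k, ∑ l, f i j k l = ∑ k, ∑ l, ∑ i, ∑ j, f i j k l := by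
  simp only [← Fintype.sum_prod_type' (f := fun _ _ => (_ : ℂ))]
  have := Finset.sum_comm (s := (Finset.univ : Finset (ι × ι)))
    (t := (Finset.univ : Finset (ι × ι))) (f := fun p q => f p.1 p.2 q.1 q.2)
  simpa only [Fintype.sum_prod_type] using this

variable {P : Matrix (Fin n) (Fin n) ℂ} (T : Fin n → Matrix (Fin n) (Fin n) ℂ)

lemma trace_mul_eq_sum (A : Matrix (Fin n) (Fin n) ℂ) :
    (P * A).trace = ∑ k, ∑ l, P l k * A k l := by
  simp only [Matrix.trace, Matrix.diag, Matrix.mul_apply]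
  exact Finset.sum_comm

lemma star_trace_mul_eq_sum (hP : P.IsHermitian) (A : Matrix (Fin n) (Fin n) ℂ) :
    star (P * A).trace = ∑ k, ∑ l, P l k * star (A l k) := by
  rw [trace_mul_eq_sum, star_sum, Finset.sum_comm]
  refine Finset.sum_congr rfl fun k _ => ?_
  rw [star_sum]
  refine Finset.sum_congr rfl fun l _ => ?_
  rw [star_mul', hP.apply]

lemma torsionNormSq_eq_sum : torsionNormSq P T =
    ∑ i, ∑ j, ∑ k, ∑ l, ∑ m, ∑ q, P j i * (P l k * P q m * T i k q * star (T j l m)) := by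
  simp only [torsionNormSq]
  refine Finset.sum_congr rfl fun i _ => Finset.sum_congr rfl fun j _ => ?_
  rw [mul_assoc, mul_assoc, trace_mul_eq_sum]
  simp only [Finset.mul_sum]
  refine Finset.sum_congr rfl fun k _ => Finset.sum_congr rfl fun l _ => ?_
  rw [Matrix.mul_apply, Finset.mul_sum, Finset.mul_sum, Finset.sum_comm]
  refine Finset.sum_congr rfl fun q _ => ?_
  simp only [Matrix.mul_apply, Matrix.conjTranspose_apply, Finset.mul_sum]
  refine Finset.sum_congr rfl fun m _ => ?_
  ring

/-- Relabelling indices shows that Q¹ and Q² both trace to |T|², while Q³ and Q⁴ both trace to |tr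
T|². The coefficients are ½ - ¼ = ¼ and -½ + 1 = ½. -/
lemma trace_qForm (hP : P.IsHermitian) :
    ∑ i, ∑ j, P j i * qForm P T i j =
      (1 / 4 : ℂ) * torsionNormSq P T + (1 / 2 : ℂ) * torsionTraceNormSq P T := by
  have h1 : ∑ i, ∑ j, P j i * (∑ k, ∑ l, ∑ m, ∑ q, P l k * P q m * T i k q * star (T j l m)) =
      torsionNormSq P T := by
    simp only [torsionNormSq_eq_sum, Finset.mul_sum]
  have h2 : ∑ i, ∑ j, P j i * (∑ k, ∑ l, ∑ m, ∑ q, P l k * P q m * star (T l q i) * T k m j) =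
      torsionNormSq P T := by
    simp only [torsionNormSq_eq_sum, Finset.mul_sum]
    rw [sum_pair_comm]
    refine Finset.sum_congr rfl fun k _ => Finset.sum_congr rfl fun l _ => ?_
    rw [sum_pair_comm]
    refine Finset.sum_congr rfl fun m _ => Finset.sum_congr rfl fun q _ => ?_
    refine Finset.sum_congr rfl fun i _ => Finset.sum_congr rfl fun j _ => ?_
    ring
  have h3 : ∑ i, ∑ j, P j i * (∑ k, ∑ l, ∑ m, ∑ q, P l k * P q m * T i k l * star (T j q m)) =
      torsionTraceNormSq P T := by
    refine Finset.sum_congr rfl fun i _ => Finset.sum_congr rfl fun j _ => ?_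
    rw [trace_mul_eq_sum, star_trace_mul_eq_sum hP]
    simp only [Finset.mul_sum, Finset.sum_mul]
    rw [sum_pair_comm]
    refine Finset.sum_congr rfl fun k _ => Finset.sum_congr rfl fun l _ => ?_
    refine Finset.sum_congr rfl fun m _ => Finset.sum_congr rfl fun q _ => ?_
    ring
  have h4 : ∑ i, ∑ j, P j i * (∑ k, ∑ l, ∑ m, ∑ q, P l k * P q m *
      (T m k l * star (T q j i) + star (T q l k) * T m i j)) = 2 * torsionTraceNormSq P T := by
    have ha : torsionTraceNormSq P T = ∑ m, ∑ q, ∑ i, ∑ j, ∑ k, ∑ l,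
        P q m * (P l k * T m k l) * (P j i * star (T q j i)) := by
      refine Finset.sum_congr rfl fun m _ => Finset.sum_congr rfl fun q _ => ?_
      rw [trace_mul_eq_sum, star_trace_mul_eq_sum hP]
      simp only [Finset.mul_sum, Finset.sum_mul]
      simp only [mul_assoc]
    have hb : torsionTraceNormSq P T = ∑ m, ∑ q, ∑ i, ∑ j, ∑ k, ∑ l,
        P q m * (P j i * T m i j) * (P l k * star (T q l k)) := by
      rw [ha]
      refine Finset.sum_congr rfl fun m _ => Finset.sum_congr rfl fun q _ => ?_
      rw [sum_pair_comm]
    rw [two_mul]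
    nth_rw 1 [ha]
    rw [hb]
    simp only [← Finset.sum_add_distrib, Finset.mul_sum]
    have : ∀ i j, ∑ k, ∑ l, ∑ m, ∑ q, P j i * (P l k * P q m *
      (T m k l * star (T q j i) + star (T q l k) * T m i j)) = ∑ m, ∑ q, ∑ k, ∑ l,
      P j i * (P l k * P q m * (T m k l * star (T q j i) + star (T q l k) * T m i j)) :=
      fun i j => sum_pair_comm _
    simp only [this]
    rw [sum_pair_comm]
    refine Finset.sum_congr rfl fun m _ => Finset.sum_congr rfl fun q _ => ?_
    refine Finset.sum_congr rfl fun i _ => Finset.sum_congr rfl fun j _ => ?_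
    refine Finset.sum_congr rfl fun k _ => Finset.sum_congr rfl fun l _ => ?_
    ring
  have e : ∀ i j, P j i * qForm P T i j =
      (1 / 2 : ℂ) * (P j i * ∑ k, ∑ l, ∑ m, ∑ q, P l k * P q m * T i k q * star (T j l m))
      - (1 / 4 : ℂ) * (P j i * ∑ k, ∑ l, ∑ m, ∑ q, P l k * P q m * star (T l q i) * T k m j)
      - (1 / 2 : ℂ) * (P j i * ∑ k, ∑ l, ∑ m, ∑ q, P l k * P q m * T i k l * star (T j q m))
      + (1 / 2 : ℂ) * (P j i * ∑ k, ∑ l, ∑ m, ∑ q, P l k * P q m *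
        (T m k l * star (T q j i) + star (T q l k) * T m i j)) := by
    intro i j; rw [qForm]; ring
  simp only [e, Finset.sum_add_distrib, Finset.sum_sub_distrib, ← Finset.mul_sum]
  rw [h1, h2, h3, h4]
  ring

lemma inverse_metric_change {P' A : Matrix (Fin n) (Fin n) ℂ} (hA : IsUnit A.det)
    (hP : P = (Aᴴ)⁻¹ * P' * A⁻¹) (a b : Fin n) :
    P' b a = ∑ i, ∑ j, P j i * (A i a * star (A j b)) := by
  have hA' : IsUnit (Aᴴ).det := by rw [Matrix.det_conjTranspose]; exact hA.star
  have : P' = Aᴴ * P * A := by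
    rw [hP]
    simp only [mul_assoc, Matrix.nonsing_inv_mul _ hA, mul_one]
    rw [← mul_assoc, Matrix.mul_nonsing_inv _ hA', one_mul]
  rw [this]
  simp only [Matrix.mul_apply, Matrix.conjTranspose_apply, Finset.sum_mul]
  refine Finset.sum_congr rfl fun i _ => Finset.sum_congr rfl fun j _ => ?_
  ring

/-- The contractions of the torsion are invariant under changes of frame. -/
lemma torsionNormSq_change {P' A : Matrix (Fin n) (Fin n) ℂ}
    {T T' : Fin n → Matrix (Fin n) (Fin n) ℂ} (hA : IsUnit A.det)
    (hP : P = (Aᴴ)⁻¹ * P' * A⁻¹)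
    (hT : ∀ i, T i = ∑ a, A i a • (A * T' a * Aᴴ)) :
    torsionNormSq P T = torsionNormSq P' T' := by
  have hA' : IsUnit (Aᴴ).det := by rw [Matrix.det_conjTranspose]; exact hA.star
  have hP' := inverse_metric_change hA hP
  have key : ∀ a b, (P * (A * T' a * Aᴴ) * P * (A * T' b * Aᴴ)ᴴ).trace =
      (P' * T' a * P' * (T' b)ᴴ).trace := by
    intro a b
    rw [hP]
    simp only [Matrix.conjTranspose_mul, Matrix.conjTranspose_conjTranspose, mul_assoc]
    simp only [← mul_assoc (A⁻¹) A, ← mul_assoc (Aᴴ) ((Aᴴ)⁻¹), Matrix.nonsing_inv_mul _ hA,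
      Matrix.mul_nonsing_inv _ hA', one_mul]
    rw [Matrix.trace_mul_comm]
    simp only [mul_assoc, Matrix.mul_nonsing_inv _ hA', mul_one]
  have e : ∀ i j, (P * T i * P * (T j)ᴴ).trace =
      ∑ a, ∑ b, (A i a * star (A j b)) * (P' * T' a * P' * (T' b)ᴴ).trace := by
    intro i j
    simp only [← key]
    rw [hT i, hT j]
    simp only [Matrix.conjTranspose_sum, Matrix.conjTranspose_smul,
      Matrix.sum_mul, Matrix.mul_smul, Matrix.smul_mul, Matrix.trace_sum, Matrix.trace_smul,
      smul_eq_mul, Finset.mul_sum]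
    rw [Finset.sum_comm]
    refine Finset.sum_congr rfl fun a _ => Finset.sum_congr rfl fun b _ => ?_
    ring
  simp only [torsionNormSq, e, hP', Finset.mul_sum, Finset.sum_mul]
  rw [sum_pair_comm]
  refine Finset.sum_congr rfl fun a _ => Finset.sum_congr rfl fun b _ => ?_
  refine Finset.sum_congr rfl fun i _ => Finset.sum_congr rfl fun j _ => ?_
  ring

lemma torsionTraceNormSq_change {P' A : Matrix (Fin n) (Fin n) ℂ}
    {T T' : Fin n → Matrix (Fin n) (Fin n) ℂ} (hA : IsUnit A.det)
    (hP : P = (Aᴴ)⁻¹ * P' * A⁻¹)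
    (hT : ∀ i, T i = ∑ a, A i a • (A * T' a * Aᴴ)) :
    torsionTraceNormSq P T = torsionTraceNormSq P' T' := by
  have hA' : IsUnit (Aᴴ).det := by rw [Matrix.det_conjTranspose]; exact hA.star
  have hP' := inverse_metric_change hA hP
  have key : ∀ a, (P * (A * T' a * Aᴴ)).trace = (P' * T' a).trace := by
    intro a
    rw [hP]
    simp only [mul_assoc]
    rw [← mul_assoc (A⁻¹) A, Matrix.nonsing_inv_mul _ hA, one_mul, Matrix.trace_mul_comm]
    simp only [mul_assoc, Matrix.mul_nonsing_inv _ hA', mul_one]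
  have e : ∀ i, (P * T i).trace = ∑ a, A i a * (P' * T' a).trace := by
    intro i
    simp only [← key]
    rw [hT i]
    simp only [Matrix.mul_sum, Matrix.mul_smul, Matrix.trace_sum, Matrix.trace_smul, smul_eq_mul]
  simp only [torsionTraceNormSq, e, hP', star_sum, star_mul', Finset.mul_sum, Finset.sum_mul]
  rw [sum_pair_comm]
  rw [Finset.sum_comm]
  refine Finset.sum_congr rfl fun a _ => Finset.sum_congr rfl fun b _ => ?_
  refine Finset.sum_congr rfl fun i _ => Finset.sum_congr rfl fun j _ => ?_
  ring

end TorsionQuadratic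

end HermitianFlow

namespace HermitianFlow

open Complex Matrix

/-! ### First variation of S, of Q and of tr(S - Q). -/

section Variation

variable {X : Type*} [NormedAddCommGroup X] [NormedSpace ℝ X] {n : ℕ}

/-- The torsion matrices `(T_{i j k̄})_{jk}` for the coordinate directions `ζ`. -/
noncomputable def torMat (ζ : Fin n → X × X) (G : X → Matrix (Fin n) (Fin n) ℂ) (x : X)
    (i : Fin n) : Matrix (Fin n) (Fin n) ℂ :=
  Matrix.of fun j k => cfdM (ζ i) G x j k - cfdM (ζ j) G x i k

/-- The trace of `S - Q`. -/
noncomputable def scalSQ (ζ : Fin n → X × X) (G : X → Matrix (Fin n) (Fin n) ℂ) (x : X) : ℂ :=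
  ((G x)⁻¹ * sMat ζ G x).trace -
    ∑ i, ∑ j, (G x)⁻¹ j i * qForm (G x)⁻¹ (torMat ζ G x) i j

/-- The complex Laplacian `g^{l m̄} ∂_l ∂_m̄ v`. -/
noncomputable def lapl (ζ : Fin n → X × X) (G : X → Matrix (Fin n) (Fin n) ℂ) (v : X → ℂ)
    (x : X) : ℂ :=
  ∑ l, ∑ m, (G x)⁻¹ m l * cfd (ζ l) (cfd (conjDir (ζ m)) v) x

variable {ζ : Fin n → X × X} {τ : X × X} {G H : X → Matrix (Fin n) (Fin n) ℂ} {U : Set X} {x : X}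

lemma scalSQ_eq (hG : (G x).IsHermitian) : scalSQ ζ G x =
    ∑ l, ∑ m, (G x)⁻¹ m l * ((G x)⁻¹ * curvMat (ζ l) (conjDir (ζ m)) G x).trace -
      ((1 / 4 : ℂ) * torsionNormSq (G x)⁻¹ (torMat ζ G x) +
        (1 / 2 : ℂ) * torsionTraceNormSq (G x)⁻¹ (torMat ζ G x)) := by
  rw [scalSQ, trace_qForm _ hG.inv, sMat]
  simp only [Matrix.mul_sum, Matrix.mul_smul, Matrix.trace_sum, Matrix.trace_smul, smul_eq_mul]

lemma contDiffOn_torMat (hU : IsOpen U) (hG : SmoothMatOn G U) (i : Fin n) :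
    SmoothMatOn (fun y => torMat ζ G y i) U :=
  fun j k => (hG.cfdM hU j k).sub (hG.cfdM hU i k)

lemma contDiffOn_qForm {P : X → Matrix (Fin n) (Fin n) ℂ}
    {T : X → Fin n → Matrix (Fin n) (Fin n) ℂ} (hP : SmoothMatOn P U)
    (hT : ∀ i, SmoothMatOn (fun y => T y i) U) (i j : Fin n) :
    ContDiffOn ℝ ∞ (fun y => qForm (P y) (T y) i j) U := by
  have hPP : ∀ k l m q, ContDiffOn ℝ ∞ (fun y => P y l k * P y q m) U := fun k l m q =>
    (hP l k).mul (hP q m)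
  have hS : ∀ i j k, ContDiffOn ℝ ∞ (fun y => star (T y i j k)) U := fun i j k =>
    contDiffOn_star (hT i j k)
  refine (((contDiffOn_const.mul ?_).sub (contDiffOn_const.mul ?_)).sub
    (contDiffOn_const.mul ?_)).add (contDiffOn_const.mul ?_) <;>
  refine ContDiffOn.sum fun k _ => ContDiffOn.sum fun l _ => ContDiffOn.sum fun m _ =>
    ContDiffOn.sum fun q _ => ?_
  · exact ((hPP k l m q).mul (hT i k q)).mul (hS j l m)
  · exact ((hPP k l m q).mul (hS l q i)).mul (hT k m j)
  · exact ((hPP k l m q).mul (hT i k l)).mul (hS j q m)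
  · exact (hPP k l m q).mul (((hT m k l).mul (hS q j i)).add ((hS q l k).mul (hT m i j)))

lemma contDiffOn_scalSQ (hU : IsOpen U) (hG : SmoothMatOn G U) (h0 : ∀ y ∈ U, (G y).det ≠ 0) :
    ContDiffOn ℝ ∞ (scalSQ ζ G) U :=
  ((hG.inv h0).mul (smoothMatOn_sMat hU hG h0)).trace.sub <|
    ContDiffOn.sum fun i _ => ContDiffOn.sum fun j _ =>
      (hG.inv h0 j i).mul (contDiffOn_qForm (hG.inv h0) (contDiffOn_torMat hU hG) i j)

lemma cfd_mul_of_eq_zero {f g : X → ℂ} (hf : DifferentiableAt ℝ f x) (hg : DifferentiableAt ℝ g x)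
    (hf0 : f x = 0) (hg0 : g x = 0) : cfd τ (fun y => f y * g y) x = 0 := by
  rw [cfd_mul hf hg, hf0, hg0]; ring

/-- A quadratic expression in the torsion has vanishing derivative where the torsion vanishes. -/
lemma cfd_qForm {P : X → Matrix (Fin n) (Fin n) ℂ} {T : X → Fin n → Matrix (Fin n) (Fin n) ℂ}
    (hP : DiffMatAt P x) (hT : ∀ i, DiffMatAt (fun y => T y i) x) (h0 : ∀ i, T x i = 0)
    (i j : Fin n) : cfd τ (fun y => qForm (P y) (T y) i j) x = 0 := by
  have hPP : ∀ k l m q, DifferentiableAt ℝ (fun y => P y l k * P y q m) x := fun k l m q =>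
    (hP l k).mul (hP q m)
  have hS : ∀ i j k, DifferentiableAt ℝ (fun y => star (T y i j k)) x := fun i j k =>
    (hT i j k).star
  have h0' : ∀ i j k, T x i j k = 0 := fun i j k => by rw [h0]; rfl
  have sum0 : ∀ (F : Fin n → Fin n → Fin n → Fin n → X → ℂ),
      (∀ k l m q, DifferentiableAt ℝ (F k l m q) x ∧ cfd τ (F k l m q) x = 0) →
      DifferentiableAt ℝ (fun y => ∑ k, ∑ l, ∑ m, ∑ q, F k l m q y) x ∧
      cfd τ (fun y => ∑ k, ∑ l, ∑ m, ∑ q, F k l m q y) x = 0 := by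
    intro F hF
    have step : ∀ F : Fin n → X → ℂ, (∀ k, DifferentiableAt ℝ (F k) x ∧ cfd τ (F k) x = 0) →
      DifferentiableAt ℝ (fun y => ∑ k, F k y) x ∧ cfd τ (fun y => ∑ k, F k y) x = 0 := by
      intro F hF
      refine ⟨DifferentiableAt.fun_sum fun k _ => (hF k).1, ?_⟩
      rw [cfd_sum fun k _ => (hF k).1]
      exact Finset.sum_eq_zero fun k _ => (hF k).2
    exact step _ fun k => step _ fun l => step _ fun m => step _ fun q => hF k l m q
  have quad : ∀ {A s t : X → ℂ}, DifferentiableAt ℝ A x → DifferentiableAt ℝ s x →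
      DifferentiableAt ℝ t x → s x = 0 → t x = 0 →
      DifferentiableAt ℝ (fun y => A y * s y * t y) x ∧ cfd τ (fun y => A y * s y * t y) x = 0 :=
    fun hA hs ht hs0 ht0 =>
      ⟨(hA.mul hs).mul ht, cfd_mul_of_eq_zero (hA.mul hs) ht (by simp [hs0]) ht0⟩
  have h1 := sum0 (fun k l m q y => P y l k * P y q m * T y i k q * star (T y j l m))
    fun k l m q => quad (hPP k l m q) (hT i k q) (hS j l m) (h0' _ _ _) (by simp [h0'])
  have h2 := sum0 (fun k l m q y => P y l k * P y q m * star (T y l q i) * T y k m j)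
    fun k l m q => quad (hPP k l m q) (hS l q i) (hT k m j) (by simp [h0']) (h0' _ _ _)
  have h3 := sum0 (fun k l m q y => P y l k * P y q m * T y i k l * star (T y j q m))
    fun k l m q => quad (hPP k l m q) (hT i k l) (hS j q m) (h0' _ _ _) (by simp [h0'])
  have h4 := sum0 (fun k l m q y => P y l k * P y q m *
      (T y m k l * star (T y q j i) + star (T y q l k) * T y m i j))
    fun k l m q => by
      have ha := quad (hPP k l m q) (hT m k l) (hS q j i) (h0' _ _ _) (by simp [h0'])
      have hb := quad (hPP k l m q) (hS q l k) (hT m i j) (by simp [h0']) (h0' _ _ _)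
      have e : (fun y => P y l k * P y q m *
          (T y m k l * star (T y q j i) + star (T y q l k) * T y m i j)) = fun y =>
          P y l k * P y q m * T y m k l * star (T y q j i) +
            P y l k * P y q m * star (T y q l k) * T y m i j := by funext y; ring
      refine ⟨e ▸ ha.1.add hb.1, ?_⟩
      rw [e, cfd_add ha.1 hb.1, ha.2, hb.2, add_zero]
  have hc : ∀ (c : ℂ) {f : X → ℂ}, DifferentiableAt ℝ f x ∧ cfd τ f x = 0 →
      DifferentiableAt ℝ (fun y => c * f y) x ∧ cfd τ (fun y => c * f y) x = 0 := by
    intro c f hf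
    refine ⟨hf.1.const_mul c, ?_⟩
    rw [cfd_mul (differentiableAt_const c) hf.1, hf.2, cfd_const]; ring
  have h1 := hc (1 / 2) h1
  have h2 := hc (1 / 4) h2
  have h3 := hc (1 / 2) h3
  have h4 := hc (1 / 2) h4
  simp only [qForm]
  rw [cfd_add ((h1.1.fun_sub h2.1).fun_sub h3.1) h4.1, cfd_sub (h1.1.fun_sub h2.1) h3.1,
    cfd_sub h1.1 h2.1,
    h1.2, h2.2, h3.2, h4.2]
  ring

/-- The first variation of `S`. -/
lemma cfdM_sMat (hU : IsOpen U) (hG : SmoothMatOn G U) (h0 : ∀ y ∈ U, (G y).det ≠ 0)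
    (hx : x ∈ U) :
    cfdM τ (sMat ζ G) x =
      cfdM τ G x * (G x)⁻¹ * sMat ζ G x
      - ∑ l, ∑ m, (G x)⁻¹ m l • cov2Mat (ζ l) (conjDir (ζ m)) G (cfdM τ G) x
      - ∑ l, ∑ m, ((G x)⁻¹ * cfdM τ G x * (G x)⁻¹) m l •
          curvMat (ζ l) (conjDir (ζ m)) G x := by
  have hI := hG.inv h0
  have hC : ∀ l m, SmoothMatOn (curvMat (ζ l) (conjDir (ζ m)) G) U := fun l m =>
    smoothMatOn_curvMat hU hG h0
  have e : ∀ j k, cfdM τ (sMat ζ G) x j k = ∑ l, ∑ m,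
      (cfdM τ (fun y => (G y)⁻¹) x m l * curvMat (ζ l) (conjDir (ζ m)) G x j k +
        (G x)⁻¹ m l * cfdM τ (curvMat (ζ l) (conjDir (ζ m)) G) x j k) := by
    intro j k
    have hd : ∀ l m, DifferentiableAt ℝ
        (fun y => (G y)⁻¹ m l * curvMat (ζ l) (conjDir (ζ m)) G y j k) x := fun l m =>
      (hI.diffMatAt hU hx m l).mul ((hC l m).diffMatAt hU hx j k)
    simp only [cfdM, sMat, Matrix.of_apply, Matrix.sum_apply, Matrix.smul_apply, smul_eq_mul]
    rw [cfd_sum (F := fun l y => ∑ m, (G y)⁻¹ m l * curvMat (ζ l) (conjDir (ζ m)) G y j k)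
      fun l _ => DifferentiableAt.fun_sum fun m _ => hd l m]
    refine Finset.sum_congr rfl fun l _ => ?_
    rw [cfd_sum fun m _ => hd l m]
    refine Finset.sum_congr rfl fun m _ => ?_
    rw [cfd_mul (hI.diffMatAt hU hx m l) ((hC l m).diffMatAt hU hx j k)]
  have e2 : cfdM τ (sMat ζ G) x = ∑ l, ∑ m,
      (cfdM τ (fun y => (G y)⁻¹) x m l • curvMat (ζ l) (conjDir (ζ m)) G x +
        (G x)⁻¹ m l • cfdM τ (curvMat (ζ l) (conjDir (ζ m)) G) x) := by
    ext j k
    rw [e]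
    simp only [Matrix.sum_apply, Matrix.add_apply, Matrix.smul_apply, smul_eq_mul]
  rw [e2, sMat, cfdM_inv hU hG h0 hx]
  simp only [cfdM_curvMat hU hG h0 hx, Matrix.mul_sum, Matrix.mul_smul,
    ← Finset.sum_sub_distrib, smul_sub, Matrix.neg_apply, neg_smul]
  refine Finset.sum_congr rfl fun l _ => Finset.sum_congr rfl fun m _ => ?_
  abel

/-- The first variation of the trace of `S - Q` at a Kähler–Einstein metric. -/
lemma cfd_scalSQ (hU : IsOpen U) (hG : SmoothMatOn G U) (h0 : ∀ y ∈ U, (G y).det ≠ 0)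
    (hx : x ∈ U) (hT : ∀ i, torMat ζ G x i = 0) {c : ℂ} (hS : sMat ζ G x = c • G x)
    (hsymm : ∀ l m j k, curvMat (ζ l) (conjDir (ζ m)) G x j k =
      curvMat (ζ j) (conjDir (ζ k)) G x l m) :
    cfd τ (scalSQ ζ G) x = -lapl ζ G (fun y => ((G y)⁻¹ * cfdM τ G y).trace) x
      - c * ((G x)⁻¹ * cfdM τ G x).trace := by
  have hI := hG.inv h0
  have hu := isUnit_iff_ne_zero.2 (h0 x hx)
  have hSm := smoothMatOn_sMat (ζ := ζ) hU hG h0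
  have hTm := contDiffOn_torMat (ζ := ζ) hU hG
  have hq : ∀ i j, ContDiffOn ℝ ∞ (fun y => qForm (G y)⁻¹ (torMat ζ G y) i j) U :=
    contDiffOn_qForm hI hTm
  have hq0 : ∀ i j, qForm (G x)⁻¹ (torMat ζ G x) i j = 0 := by
    intro i j; simp [qForm, hT]
  have hsum : ∀ i j, ContDiffOn ℝ ∞
      (fun y => (G y)⁻¹ j i * qForm (G y)⁻¹ (torMat ζ G y) i j) U :=
    fun i j => (hI j i).mul (hq i j)
  -- The contribution of Q drops out: both `qForm` and its derivative vanish at x. The torsion is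
  -- only assumed to vanish at x, because along a family it does so only on the slice a = 0.
  have e1 : cfd τ (fun y => ∑ i, ∑ j, (G y)⁻¹ j i * qForm (G y)⁻¹ (torMat ζ G y) i j) x = 0 := by
    rw [cfd_sum fun i _ => differentiableAt_of_contDiffOn hU
      (ContDiffOn.sum fun j _ => hsum i j) hx]
    refine Finset.sum_eq_zero fun i _ => ?_
    rw [cfd_sum fun j _ => differentiableAt_of_contDiffOn hU (hsum i j) hx]
    refine Finset.sum_eq_zero fun j _ => ?_
    rw [cfd_mul (hI.diffMatAt hU hx j i) (differentiableAt_of_contDiffOn hU (hq i j) hx), hq0,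
      cfd_qForm (hI.diffMatAt hU hx) (fun i => (hTm i).diffMatAt hU hx) hT]
    ring
  have e2 : cfd τ (scalSQ ζ G) x = cfd τ (fun y => ((G y)⁻¹ * sMat ζ G y).trace) x := by
    have : scalSQ ζ G = fun y => ((G y)⁻¹ * sMat ζ G y).trace -
      ∑ i, ∑ j, (G y)⁻¹ j i * qForm (G y)⁻¹ (torMat ζ G y) i j := rfl
    rw [this, cfd_sub (differentiableAt_of_contDiffOn hU (hI.mul hSm).trace hx)
      (differentiableAt_of_contDiffOn hU
        (ContDiffOn.sum fun i _ => ContDiffOn.sum fun j _ => hsum i j) hx), e1, sub_zero]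
  -- By the pair symmetry, tracing over the last two indices agrees with the contraction over the
  -- first two, which is S and hence c g.
  have tr : ∀ l m, ((G x)⁻¹ * curvMat (ζ l) (conjDir (ζ m)) G x).trace = c * G x l m := by
    intro l m
    have : sMat ζ G x l m = c * G x l m := by rw [hS]; rfl
    rw [← this, trace_mul_eq_sum, sMat]
    simp only [Matrix.sum_apply, Matrix.smul_apply, smul_eq_mul]
    exact Finset.sum_congr rfl fun j _ => Finset.sum_congr rfl fun k _ => by rw [hsymm]
  rw [e2, cfdM_trace ((hI.mul hSm).diffMatAt hU hx), cfdM_mul (hI.diffMatAt hU hx)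
    (hSm.diffMatAt hU hx), cfdM_inv hU hG h0 hx, cfdM_sMat hU hG h0 hx, hS]
  simp only [Matrix.mul_sub, Matrix.trace_add, Matrix.trace_sub, Matrix.mul_sum, Matrix.mul_smul,
    Matrix.trace_sum, Matrix.trace_smul, smul_eq_mul, neg_mul, Matrix.trace_neg,
    trace_inv_mul_cov2Mat hU hG h0 (hG.cfdM hU) hx, tr, mul_assoc,
    Matrix.nonsing_inv_mul _ hu, mul_one]
  -- The variation of G⁻¹ in tr(G⁻¹ S) cancels the term h G⁻¹ S of δS; this contraction of h with
  -- the traced curvature is the c tr h that survives.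
  have e3 : ∑ l, ∑ m, ((G x)⁻¹ * (cfdM τ G x * (G x)⁻¹)) m l * (c * G x l m) =
      c * ((G x)⁻¹ * cfdM τ G x).trace := by
    have : ((G x)⁻¹ * cfdM τ G x).trace = (((G x)⁻¹ * (cfdM τ G x * (G x)⁻¹)) * G x).trace := by
      simp only [mul_assoc, Matrix.nonsing_inv_mul _ hu, mul_one]
    rw [this, trace_mul_eq_sum]
    simp only [Finset.mul_sum]
    exact Finset.sum_congr rfl fun l _ => Finset.sum_congr rfl fun m _ => by ring
  rw [e3, lapl]
  ring

end Variation

/-! ### Kähler symmetries of the curvature, and the divergence form of the Laplacian. -/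

section Kahler

variable {X : Type*} [NormedAddCommGroup X] [NormedSpace ℝ X] {n : ℕ}
  {ζ : Fin n → X × X} {η : X × X} {G : X → Matrix (Fin n) (Fin n) ℂ} {U : Set X} {x : X}

lemma cfdM_symm_of_torMat (hT : ∀ i, torMat ζ G x i = 0) (i j k : Fin n) :
    cfdM (ζ i) G x j k = cfdM (ζ j) G x i k :=
  sub_eq_zero.1 (congrFun (congrFun (hT i) j) k)

/-- Where the torsion vanishes the Christoffel symbols Γ_{ij}^p are symmetric in i and j. The
torsion must vanish near x, since Γ is differentiated once more. -/
lemma curvMat_symm_left (hU : IsOpen U) (hG : SmoothMatOn G U) (h0 : ∀ y ∈ U, (G y).det ≠ 0)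
    (hT : ∀ y ∈ U, ∀ i, torMat ζ G y i = 0) (hx : x ∈ U) (i j k : Fin n) :
    curvMat (ζ i) η G x j k = curvMat (ζ j) η G x i k := by
  rw [← curvMat_eq hU hG h0 hx, ← curvMat_eq hU hG h0 hx]
  simp only [Matrix.neg_apply, Matrix.mul_apply]
  congr 1
  refine Finset.sum_congr rfl fun p _ => ?_
  congr 1
  refine cfd_congr ?_
  filter_upwards [hU.mem_nhds hx] with y hy
  simp only [gammaMat, Matrix.mul_apply, cfdM_symm_of_torMat (hT y hy) i j]

/-- Conjugation exchanges ∂_l with ∂_l̄ because G is Hermitian, and the two derivatives in the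
second-order term commute. -/
lemma curvMat_conjTranspose (hU : IsOpen U) (hG : SmoothMatOn G U)
    (hh : ∀ y ∈ U, (G y).IsHermitian) (hx : x ∈ U) (l m : Fin n) :
    (curvMat (ζ l) (conjDir (ζ m)) G x)ᴴ = curvMat (ζ m) (conjDir (ζ l)) G x := by
  have e1 : (cfdM (conjDir (ζ m)) (cfdM (ζ l) G) x)ᴴ =
      cfdM (conjDir (ζ l)) (cfdM (ζ m) G) x := by
    have := cfdM_conjTranspose (ξ := ζ m) (x := x) (cfdM (ζ l) G)
    rw [← this, cfdM_congr (H := cfdM (conjDir (ζ l)) G), cfdM_comm hU hG hx]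
    filter_upwards [hU.mem_nhds hx] with y hy using cfdM_conj_of_isHermitian hU hh hy
  have e2 : (cfdM (conjDir (ζ m)) G x)ᴴ = cfdM (ζ m) G x := by
    rw [cfdM_conj_of_isHermitian hU hh hx, conjDir_conjDir]
  rw [curvMat, Matrix.conjTranspose_add, Matrix.conjTranspose_neg, e1, Matrix.conjTranspose_mul,
    Matrix.conjTranspose_mul, e2, cfdM_conj_of_isHermitian hU hh hx, (hh x hx).inv.eq, curvMat,
    mul_assoc]

/-- Exchange the two unbarred indices, conjugate so that the barred ones become unbarred, exchange
those, and conjugate back. -/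
lemma curvMat_symm (hU : IsOpen U) (hG : SmoothMatOn G U) (h0 : ∀ y ∈ U, (G y).det ≠ 0)
    (hh : ∀ y ∈ U, (G y).IsHermitian) (hT : ∀ y ∈ U, ∀ i, torMat ζ G y i = 0) (hx : x ∈ U)
    (l m j k : Fin n) :
    curvMat (ζ l) (conjDir (ζ m)) G x j k = curvMat (ζ j) (conjDir (ζ k)) G x l m := by
  have hc : ∀ l m j k, curvMat (ζ l) (conjDir (ζ m)) G x j k =
      star (curvMat (ζ m) (conjDir (ζ l)) G x k j) := by
    intro l m j k
    rw [← curvMat_conjTranspose hU hG hh hx m l]; rfl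
  rw [curvMat_symm_left hU hG h0 hT hx l j k, hc, curvMat_symm_left hU hG h0 hT hx m k l, ← hc]

/-- On a Kähler manifold the Laplacian is a divergence. -/
lemma det_mul_lapl (hU : IsOpen U) (hG : SmoothMatOn G U) (h0 : ∀ y ∈ U, (G y).det ≠ 0)
    (hT : ∀ y ∈ U, ∀ i, torMat ζ G y i = 0) (hx : x ∈ U) {v : X → ℂ} (hv : ContDiffOn ℝ ∞ v U) :
    (G x).det * lapl ζ G v x =
      ∑ l, cfd (ζ l) (fun y => ∑ m, (G y).det * (G y)⁻¹ m l * cfd (conjDir (ζ m)) v y) x := by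
  have hI := hG.inv h0
  have hd : ∀ m, DifferentiableAt ℝ (cfd (conjDir (ζ m)) v) x := fun m =>
    differentiableAt_of_contDiffOn hU (contDiffOn_cfd hU hv) hx
  have hdet : DifferentiableAt ℝ (fun y => (G y).det) x :=
    differentiableAt_of_contDiffOn hU hG.det hx
  have hdI : ∀ m l, DifferentiableAt ℝ (fun y => (G y).det * (G y)⁻¹ m l) x := fun m l =>
    hdet.mul (hI.diffMatAt hU hx m l)
  -- The Kähler identity Σ_l ∂_l(det g · g^{l m̄}) = 0. Jacobi's formula and the derivative of the
  -- inverse give two terms, which cancel because ∂_l g_{p q̄} = ∂_p g_{l q̄}.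
  have key : ∀ m, ∑ l, cfd (ζ l) (fun y => (G y).det * (G y)⁻¹ m l) x = 0 := by
    intro m
    have e : ∀ l, cfd (ζ l) (fun y => (G y).det * (G y)⁻¹ m l) x = (G x).det *
        (((G x)⁻¹ * cfdM (ζ l) G x).trace * (G x)⁻¹ m l -
          ((G x)⁻¹ * cfdM (ζ l) G x * (G x)⁻¹) m l) := by
      intro l
      rw [cfd_mul hdet (hI.diffMatAt hU hx m l), cfd_det (hG.diffMatAt hU hx) (h0 x hx)]
      have : cfd (ζ l) (fun y => (G y)⁻¹ m l) x = cfdM (ζ l) (fun y => (G y)⁻¹) x m l := rfl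
      rw [this, cfdM_inv hU hG h0 hx, Matrix.neg_apply]
      ring
    simp only [e, ← Finset.mul_sum, Finset.sum_sub_distrib]
    have e2 : ∑ l, ((G x)⁻¹ * cfdM (ζ l) G x * (G x)⁻¹) m l =
        ∑ l, ((G x)⁻¹ * cfdM (ζ l) G x).trace * (G x)⁻¹ m l := by
      simp only [mul_assoc, Matrix.mul_apply (M := (G x)⁻¹) (i := m)]
      rw [Finset.sum_comm]
      refine Finset.sum_congr rfl fun p _ => ?_
      rw [← Finset.mul_sum, mul_comm]
      congr 1
      rw [Matrix.trace_mul_comm]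
      simp only [Matrix.trace, Matrix.diag, Matrix.mul_apply]
      exact Finset.sum_congr rfl fun l _ => Finset.sum_congr rfl fun q _ => by
        rw [cfdM_symm_of_torMat (hT x hx)]
    rw [e2, sub_self, mul_zero]
  have e3 : ∀ l, cfd (ζ l) (fun y => ∑ m, (G y).det * (G y)⁻¹ m l * cfd (conjDir (ζ m)) v y) x =
      ∑ m, (cfd (ζ l) (fun y => (G y).det * (G y)⁻¹ m l) x * cfd (conjDir (ζ m)) v x +
        (G x).det * (G x)⁻¹ m l * cfd (ζ l) (cfd (conjDir (ζ m)) v) x) := by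
    intro l
    rw [cfd_sum (F := fun m y => (G y).det * (G y)⁻¹ m l * cfd (conjDir (ζ m)) v y)
      fun m _ => (hdI m l).mul (hd m)]
    exact Finset.sum_congr rfl fun m _ => cfd_mul (hdI m l) (hd m)
  simp only [e3, Finset.sum_add_distrib]
  rw [Finset.sum_comm (f := fun l m => cfd (ζ l) (fun y => (G y).det * (G y)⁻¹ m l) x *
    cfd (conjDir (ζ m)) v x)]
  simp only [← Finset.sum_mul, key, zero_mul, Finset.sum_const_zero, zero_add, lapl,
    Finset.mul_sum, mul_assoc]

end Kahler

end HermitianFlow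

namespace HermitianFlow

open Complex Matrix

/-! ### Translation of the index expressions of the statement into matrices. -/

section Bridge

variable {n : ℕ}

/-- The coordinate direction `∂/∂zⁱ`. -/
noncomputable def hol (i : Fin n) : (Fin n → ℂ) × (Fin n → ℂ) :=
  ((1 / 2 : ℝ) • Pi.single i 1, -((1 / 2 : ℝ) • Pi.single i I))

lemma dz_eq (i : Fin n) : dz i = cfd (hol i) := by
  funext f z
  simp only [dz, cfd, hol, map_smul, map_neg, Complex.real_smul]
  push_cast
  ring

lemma dzbar_eq (i : Fin n) : dzbar i = cfd (conjDir (hol i)) := by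
  funext f z
  simp only [dzbar, cfd, hol, conjDir, map_smul, neg_neg, Complex.real_smul]
  push_cast
  ring

variable {G H : (Fin n → ℂ) → Matrix (Fin n) (Fin n) ℂ} {U : Set (Fin n → ℂ)} {z : Fin n → ℂ}

lemma chernGamma_eq (z : Fin n → ℂ) (i j k : Fin n) :
    chernGamma G z i j k = gammaMat (hol i) G z j k := by
  simp only [chernGamma, gammaMat, gInv, dz_eq, Matrix.mul_apply, cfdM, Matrix.of_apply]
  exact Finset.sum_congr rfl fun l _ => mul_comm _ _

lemma chernCurv_eq (hU : IsOpen U) (hG : SmoothMatOn G U) (h0 : ∀ y ∈ U, (G y).det ≠ 0)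
    (hz : z ∈ U) (l m j k : Fin n) :
    chernCurv G z l m j k = curvMat (hol l) (conjDir (hol m)) G z j k := by
  rw [← curvMat_eq hU hG h0 hz]
  simp only [chernCurv, chernGamma_eq, dzbar_eq, Matrix.neg_apply, Matrix.mul_apply, cfdM,
    Matrix.of_apply]
  congr 1
  exact Finset.sum_congr rfl fun p _ => mul_comm _ _

lemma chernS_eq (hU : IsOpen U) (hG : SmoothMatOn G U) (h0 : ∀ y ∈ U, (G y).det ≠ 0)
    (hz : z ∈ U) (j k : Fin n) : chernS G z j k = sMat hol G z j k := by
  simp only [chernS, chernCurv_eq hU hG h0 hz, gInv, sMat, Matrix.sum_apply, Matrix.smul_apply,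
    smul_eq_mul]

lemma torsion_eq (z : Fin n → ℂ) (i j k : Fin n) : torsion G z i j k = torMat hol G z i j k := by
  simp only [torsion, dz_eq, torMat, cfdM, Matrix.of_apply]

lemma torsionQ_eq (z : Fin n → ℂ) (i j : Fin n) :
    torsionQ G z i j = qForm (G z)⁻¹ (torMat hol G z) i j := by
  simp only [torsionQ, Q1, Q2, Q3, Q4, torsionBar, torsion_eq, gInv, qForm]

lemma traceSQ_eq (hU : IsOpen U) (hG : SmoothMatOn G U) (h0 : ∀ y ∈ U, (G y).det ≠ 0)
    (hz : z ∈ U) : traceSQ G z = scalSQ hol G z := by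
  simp only [traceSQ, chernS_eq hU hG h0 hz, torsionQ_eq, gInv, scalSQ, trace_mul_eq_sum, mul_sub,
    Finset.sum_sub_distrib]

lemma covBar_eq (hU : IsOpen U) (hh : ∀ y ∈ U, (G y).IsHermitian) (hz : z ∈ U) (m j k : Fin n) :
    covBar G H z m j k = covMat (conjDir (hol m)) G H z j k := by
  have : (gammaMat (hol m) G z)ᴴ = (G z)⁻¹ * cfdM (conjDir (hol m)) G z := by
    rw [gammaMat, Matrix.conjTranspose_mul, (hh z hz).inv.eq, cfdM_conj_of_isHermitian hU hh hz]
  simp only [covBar, dzbar_eq, chernGamma_eq, covMat, Matrix.sub_apply, mul_assoc]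
  rw [← this, Matrix.mul_apply]
  congr 1
  exact Finset.sum_congr rfl fun p _ => mul_comm _ _

lemma cov2_eq (hU : IsOpen U) (hh : ∀ y ∈ U, (G y).IsHermitian) (hz : z ∈ U) (l m j k : Fin n) :
    cov2 G H z l m j k = cov2Mat (hol l) (conjDir (hol m)) G H z j k := by
  simp only [cov2, cov2Mat, dz_eq, chernGamma_eq, Matrix.sub_apply, Matrix.mul_apply,
    covBar_eq hU hh hz]
  congr 1
  refine cfd_congr ?_
  filter_upwards [hU.mem_nhds hz] with y hy using covBar_eq hU hh hy m j k

lemma roughLaplacian_eq (hU : IsOpen U) (hh : ∀ y ∈ U, (G y).IsHermitian) (hz : z ∈ U)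
    (j k : Fin n) :
    roughLaplacian G H z j k =
      -(∑ l, ∑ m, (G z)⁻¹ m l • cov2Mat (hol l) (conjDir (hol m)) G H z) j k := by
  simp only [roughLaplacian, cov2_eq hU hh hz, gInv, Matrix.sum_apply, Matrix.smul_apply,
    smul_eq_mul]

/-- R̊(h) contracts h with the second and third indices of the curvature, whereas δS produces a
contraction with the first two. The Kähler symmetry in the unbarred indices reconciles them. -/
lemma curvAction_eq (hU : IsOpen U) (hG : SmoothMatOn G U) (h0 : ∀ y ∈ U, (G y).det ≠ 0)
    (hT : ∀ y ∈ U, ∀ i, torMat hol G y i = 0) (hz : z ∈ U) (j k : Fin n) :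
    curvAction G H z j k = (∑ l, ∑ m, ((G z)⁻¹ * H z * (G z)⁻¹) m l •
          curvMat (hol l) (conjDir (hol m)) G z) j k := by
  simp only [curvAction, chernCurv_eq hU hG h0 hz, Matrix.sum_apply, Matrix.smul_apply,
    smul_eq_mul]
  refine Finset.sum_congr rfl fun l _ => Finset.sum_congr rfl fun m _ => ?_
  rw [curvMat_symm_left hU hG h0 hT hz]
  congr 1
  simp only [raise, gInv, Matrix.mul_apply, Finset.sum_mul]
  rw [Finset.sum_comm]
  exact Finset.sum_congr rfl fun p _ => Finset.sum_congr rfl fun q _ => by ring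

end Bridge

/-! ### Restriction from ℝ × X to a slice with fixed parameter. -/

section Slice

variable {X : Type*} [NormedAddCommGroup X] [NormedSpace ℝ X] {n : ℕ}

/-- A direction in `X` as a direction in `ℝ × X`. -/
def sliceDir {X : Type*} (ξ : X × X) : (ℝ × X) × (ℝ × X) := ((0, ξ.1), (0, ξ.2))

/-- The direction of the parameter in `ℝ × X`. -/
def paramDir (X : Type*) [Zero X] : (ℝ × X) × (ℝ × X) := ((1, 0), 0)

lemma conjDir_sliceDir {X : Type*} [AddCommGroup X] (ξ : X × X) : conjDir (sliceDir ξ) = sliceDir (conjDir ξ) := by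
  simp [conjDir, sliceDir]

variable {ξ η : X × X} {a : ℝ} {x : X} {V : Set (ℝ × X)}

lemma hasDerivAt_cfd_paramDir {f : ℝ × X → ℂ} (hf : DifferentiableAt ℝ f (a, x)) :
    HasDerivAt (fun s => f (s, x)) (cfd (paramDir X) f (a, x)) a := by
  have h1 : HasFDerivAt (fun s : ℝ => (s, x)) (ContinuousLinearMap.inl ℝ ℝ X) a :=
    hasFDerivAt_prodMk_left a x
  have h2 := (hf.hasFDerivAt.comp a h1).hasDerivAt
  simpa [cfd, paramDir, Function.comp_def] using h2

lemma cfd_slice {f : ℝ × X → ℂ} (hf : DifferentiableAt ℝ f (a, x)) :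
    cfd ξ (fun w => f (a, w)) x = cfd (sliceDir ξ) f (a, x) := by
  have h1 : HasFDerivAt (fun w : X => (a, w)) (ContinuousLinearMap.inr ℝ ℝ X) x :=
    hasFDerivAt_prodMk_right a x
  have h2 := (hf.hasFDerivAt.comp x h1).fderiv
  have h3 : fderiv ℝ (fun w => f (a, w)) x = fderiv ℝ f (a, x) ∘L ContinuousLinearMap.inr ℝ ℝ X :=
    h2
  simp [cfd, h3, sliceDir]

lemma isOpen_slice {X : Type*} [TopologicalSpace X] {V : Set (ℝ × X)} (hV : IsOpen V) (a : ℝ) : IsOpen {w : X | (a, w) ∈ V} :=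
  hV.preimage (by fun_prop)

lemma contDiffOn_slice {f : ℝ × X → ℂ} (hf : ContDiffOn ℝ ∞ f V) (a : ℝ) :
    ContDiffOn ℝ ∞ (fun w => f (a, w)) {w : X | (a, w) ∈ V} :=
  hf.comp (contDiff_const.prodMk contDiff_id).contDiffOn fun _ h => h

variable {F H : ℝ × X → Matrix (Fin n) (Fin n) ℂ}

lemma cfdM_slice (hF : DiffMatAt F (a, x)) :
    cfdM ξ (fun w => F (a, w)) x = cfdM (sliceDir ξ) F (a, x) := by
  ext j k
  exact cfd_slice (hF j k)

lemma cfdM_cfdM_slice (hV : IsOpen V) (hF : SmoothMatOn F V) (hx : (a, x) ∈ V) :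
    cfdM η (cfdM ξ fun w => F (a, w)) x = cfdM (sliceDir η) (cfdM (sliceDir ξ) F) (a, x) := by
  rw [← cfdM_slice ((hF.cfdM hV).diffMatAt hV hx)]
  refine cfdM_congr ?_
  filter_upwards [(isOpen_slice hV a).mem_nhds hx] with y hy
  exact cfdM_slice (hF.diffMatAt hV hy)

lemma curvMat_slice (hV : IsOpen V) (hF : SmoothMatOn F V) (hx : (a, x) ∈ V) :
    curvMat ξ η (fun w => F (a, w)) x = curvMat (sliceDir ξ) (sliceDir η) F (a, x) := by
  simp only [curvMat, cfdM_cfdM_slice hV hF hx, cfdM_slice (hF.diffMatAt hV hx)]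

lemma covMat_slice (hV : IsOpen V) (hF : SmoothMatOn F V) (hH : SmoothMatOn H V)
    (hx : (a, x) ∈ V) :
    covMat η (fun w => F (a, w)) (fun w => H (a, w)) x = covMat (sliceDir η) F H (a, x) := by
  simp only [covMat, cfdM_slice (hF.diffMatAt hV hx), cfdM_slice (hH.diffMatAt hV hx)]

lemma cov2Mat_slice (hV : IsOpen V) (hF : SmoothMatOn F V) (h0 : ∀ y ∈ V, (F y).det ≠ 0)
    (hH : SmoothMatOn H V) (hx : (a, x) ∈ V) :
    cov2Mat ξ η (fun w => F (a, w)) (fun w => H (a, w)) x =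
      cov2Mat (sliceDir ξ) (sliceDir η) F H (a, x) := by
  simp only [cov2Mat, gammaMat, covMat_slice hV hF hH hx, cfdM_slice (hF.diffMatAt hV hx)]
  congr 1
  rw [← cfdM_slice ((smoothMatOn_covMat hV hF h0 hH).diffMatAt hV hx)]
  refine cfdM_congr ?_
  filter_upwards [(isOpen_slice hV a).mem_nhds hx] with y hy
  exact covMat_slice hV hF hH hy

variable {ζ : Fin n → X × X}

lemma sMat_slice (hV : IsOpen V) (hF : SmoothMatOn F V) (hx : (a, x) ∈ V) :
    sMat ζ (fun w => F (a, w)) x = sMat (fun i => sliceDir (ζ i)) F (a, x) := by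
  simp only [sMat, curvMat_slice hV hF hx, conjDir_sliceDir]

lemma torMat_slice (hV : IsOpen V) (hF : SmoothMatOn F V) (hx : (a, x) ∈ V) :
    torMat ζ (fun w => F (a, w)) x = torMat (fun i => sliceDir (ζ i)) F (a, x) := by
  funext i
  simp only [torMat, cfdM_slice (hF.diffMatAt hV hx)]

lemma scalSQ_slice (hV : IsOpen V) (hF : SmoothMatOn F V) (hx : (a, x) ∈ V) :
    scalSQ ζ (fun w => F (a, w)) x = scalSQ (fun i => sliceDir (ζ i)) F (a, x) := by
  simp only [scalSQ, sMat_slice hV hF hx, torMat_slice hV hF hx]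

lemma lapl_slice (hV : IsOpen V) {v : ℝ × X → ℂ} (hv : ContDiffOn ℝ ∞ v V) (hx : (a, x) ∈ V) :
    lapl ζ (fun w => F (a, w)) (fun w => v (a, w)) x =
      lapl (fun i => sliceDir (ζ i)) F v (a, x) := by
  simp only [lapl]
  refine Finset.sum_congr rfl fun l _ => Finset.sum_congr rfl fun m _ => ?_
  congr 1
  rw [conjDir_sliceDir, ← cfd_slice (differentiableAt_of_contDiffOn hV (contDiffOn_cfd hV hv) hx)]
  refine cfd_congr ?_
  filter_upwards [(isOpen_slice hV a).mem_nhds hx] with y hy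
  exact cfd_slice (differentiableAt_of_contDiffOn hV hv hy)

end Slice

end HermitianFlow

namespace HermitianFlow

open Complex Matrix

/-! ### Wirtinger calculus under holomorphic maps. -/

section Wirtinger

variable {n : ℕ}

/-- The decomposition df = Σ (∂_a f dzᵃ + ∂_ā f dz̄ᵃ), from expanding v in the real basis e_a, i
e_a. -/
lemma fderiv_eq_sum_cfd (f : (Fin n → ℂ) → ℂ) (z v : Fin n → ℂ) :
    fderiv ℝ f z v =
      ∑ a, (v a * cfd (hol a) f z + star (v a) * cfd (conjDir (hol a)) f z) := by
  have hv : v = ∑ a, ((v a).re • (Pi.single a (1 : ℂ) : Fin n → ℂ) +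
      (v a).im • (Pi.single a I : Fin n → ℂ)) := by
    ext b
    simp only [Finset.sum_apply, Pi.add_apply, Pi.smul_apply, Complex.real_smul]
    rw [Finset.sum_eq_single b]
    · simp [Complex.re_add_im]
    · intro a _ hab; simp [Pi.single_eq_of_ne hab.symm]
    · simp
  conv_lhs => rw [hv]
  rw [map_sum]
  refine Finset.sum_congr rfl fun a _ => ?_
  simp only [map_add, map_smul, Complex.real_smul, cfd, hol, conjDir, map_neg, neg_neg]
  have h1 : v a = (v a).re + (v a).im * I := (Complex.re_add_im _).symm
  have h2 : star (v a) = (v a).re - (v a).im * I := by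
    conv_lhs => rw [h1]
    simp only [star_add, star_mul', RCLike.star_def, conj_ofReal, conj_I, mul_neg, sub_eq_add_neg]
  rw [h2]
  conv_rhs => enter [1, 1]; rw [h1]
  push_cast
  ring_nf
  simp only [I_sq]
  ring

variable {φ : (Fin n → ℂ) → (Fin n → ℂ)} {z : Fin n → ℂ} {V V' : Set (Fin n → ℂ)}

/-- The holomorphic Jacobian matrix `(∂φᵃ/∂zⁱ)_{ia}`. -/
noncomputable def jac (φ : (Fin n → ℂ) → (Fin n → ℂ)) (z : Fin n → ℂ) :
    Matrix (Fin n) (Fin n) ℂ :=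
  Matrix.of fun i a => fderiv ℂ φ z (Pi.single i 1) a

lemma fderiv_real_comp {f : (Fin n → ℂ) → ℂ} (hφ : DifferentiableAt ℂ φ z)
    (hf : DifferentiableAt ℝ f (φ z)) (v : Fin n → ℂ) :
    fderiv ℝ (fun w => f (φ w)) z v = fderiv ℝ f (φ z) (fderiv ℂ φ z v) := by
  have h := hf.hasFDerivAt.comp z (hφ.hasFDerivAt.restrictScalars ℝ)
  have h2 : fderiv ℝ (fun w => f (φ w)) z = _ := h.fderiv
  rw [h2]; rfl

lemma single_I (i : Fin n) : (Pi.single i I : Fin n → ℂ) = I • Pi.single i 1 := by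
  rw [← Pi.single_smul]; simp

/-- The terms with ∂_ā f cancel because the derivative of φ is complex linear. -/
lemma cfd_hol_comp {f : (Fin n → ℂ) → ℂ} (hφ : DifferentiableAt ℂ φ z)
    (hf : DifferentiableAt ℝ f (φ z)) (i : Fin n) :
    cfd (hol i) (fun w => f (φ w)) z = ∑ a, jac φ z i a * cfd (hol a) f (φ z) := by
  rw [← dz_eq, dz, fderiv_real_comp hφ hf, fderiv_real_comp hφ hf, single_I, map_smul,
    fderiv_eq_sum_cfd f, fderiv_eq_sum_cfd f, Finset.mul_sum, ← Finset.sum_sub_distrib,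
    Finset.mul_sum]
  refine Finset.sum_congr rfl fun a _ => ?_
  rw [jac, Matrix.of_apply, Pi.smul_apply, smul_eq_mul, star_mul']
  simp only [RCLike.star_def, conj_I]
  ring_nf
  simp only [I_sq]
  ring

lemma cfd_conj_hol_comp {f : (Fin n → ℂ) → ℂ} (hφ : DifferentiableAt ℂ φ z)
    (hf : DifferentiableAt ℝ f (φ z)) (i : Fin n) :
    cfd (conjDir (hol i)) (fun w => f (φ w)) z =
      ∑ a, star (jac φ z i a) * cfd (conjDir (hol a)) f (φ z) := by
  have h := cfd_hol_comp hφ hf.star i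
  have h1 := cfd_star (ξ := hol i) (x := z) (fun w => f (φ w))
  rw [← star_inj, ← h1, h, star_sum]
  refine Finset.sum_congr rfl fun a _ => ?_
  rw [star_mul', star_star, ← cfd_star]

lemma cfd_conj_hol_of_differentiableAt {u : (Fin n → ℂ) → ℂ} (hu : DifferentiableAt ℂ u z)
    (i : Fin n) : cfd (conjDir (hol i)) u z = 0 := by
  have h : fderiv ℝ u z = (fderiv ℂ u z).restrictScalars ℝ :=
    (hu.hasFDerivAt.restrictScalars ℝ).fderiv
  rw [← dzbar_eq, dzbar, h, ContinuousLinearMap.coe_restrictScalars', single_I, map_smul,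
    smul_eq_mul]
  ring_nf
  simp only [I_sq]
  ring

lemma jac_eq_cfd (hφ : DifferentiableAt ℂ φ z) (i a : Fin n) :
    jac φ z i a = cfd (hol i) (fun w => φ w a) z := by
  have hu : DifferentiableAt ℂ (fun w => φ w a) z := differentiableAt_pi.1 hφ a
  have h : fderiv ℝ (fun w => φ w a) z = (fderiv ℂ (fun w => φ w a) z).restrictScalars ℝ :=
    (hu.hasFDerivAt.restrictScalars ℝ).fderiv
  have h2 : ∀ v, fderiv ℂ (fun w => φ w a) z v = fderiv ℂ φ z v a := by
    intro v
    rw [fderiv_pi (φ := fun a w => φ w a) (differentiableAt_pi.1 hφ)]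
    rfl
  rw [← dz_eq, dz, h, ContinuousLinearMap.coe_restrictScalars', single_I, map_smul, smul_eq_mul,
    h2, jac, Matrix.of_apply]
  ring_nf
  simp only [I_sq]
  ring

end Wirtinger

end HermitianFlow

namespace HermitianFlow

open Complex Matrix

section Holomorphic

variable {n : ℕ} {φ : (Fin n → ℂ) → (Fin n → ℂ)} {z : Fin n → ℂ} {V V' : Set (Fin n → ℂ)}

lemma differentiableAt_of_contDiffOn_omega (hV : IsOpen V) (hφ : ContDiffOn ℂ ω φ V)
    (hz : z ∈ V) : DifferentiableAt ℂ φ z :=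
  (hφ.contDiffAt (hV.mem_nhds hz)).differentiableAt (by simp)

lemma contDiffOn_real_of_omega (hφ : ContDiffOn ℂ ω φ V) : ContDiffOn ℝ ∞ φ V :=
  (hφ.of_le le_top).restrict_scalars ℝ

lemma contDiffOn_real_apply (hφ : ContDiffOn ℂ ω φ V) (a : Fin n) :
    ContDiffOn ℝ ∞ (fun w => φ w a) V :=
  contDiffOn_pi.1 (contDiffOn_real_of_omega hφ) a

lemma jac_entry_eqOn (hV : IsOpen V) (hφ : ContDiffOn ℂ ω φ V) (i a : Fin n) :
    Set.EqOn (fun w => jac φ w i a) (cfd (hol i) fun w => φ w a) V := fun _ hw =>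
  jac_eq_cfd (differentiableAt_of_contDiffOn_omega hV hφ hw) i a

lemma smoothMatOn_jac (hV : IsOpen V) (hφ : ContDiffOn ℂ ω φ V) : SmoothMatOn (jac φ) V :=
  fun i a => (contDiffOn_cfd hV (contDiffOn_real_apply hφ a)).congr (jac_entry_eqOn hV hφ i a)

lemma cfd_jac_eq (hV : IsOpen V) (hφ : ContDiffOn ℂ ω φ V) (hz : z ∈ V)
    (ξ : (Fin n → ℂ) × (Fin n → ℂ)) (i a : Fin n) :
    cfd ξ (fun w => jac φ w i a) z = cfd ξ (cfd (hol i) fun w => φ w a) z :=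
  cfd_congr ((jac_entry_eqOn hV hφ i a).eventuallyEq_of_mem (hV.mem_nhds hz))

lemma cfdM_hol_jac_symm (hV : IsOpen V) (hφ : ContDiffOn ℂ ω φ V) (hz : z ∈ V) (i j a : Fin n) :
    cfdM (hol i) (jac φ) z j a = cfdM (hol j) (jac φ) z i a := by
  simp only [cfdM, Matrix.of_apply, cfd_jac_eq hV hφ hz]
  exact cfd_comm hV (contDiffOn_real_apply hφ a) hz

/-- After commuting derivatives, ∂_ī falls on the holomorphic function φᵃ itself. -/
lemma cfdM_conj_jac (hV : IsOpen V) (hφ : ContDiffOn ℂ ω φ V) (hz : z ∈ V) (i : Fin n) :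
    cfdM (conjDir (hol i)) (jac φ) z = 0 := by
  ext j a
  simp only [cfdM, Matrix.of_apply, cfd_jac_eq hV hφ hz]
  rw [cfd_comm hV (contDiffOn_real_apply hφ a) hz, cfd_congr (g := fun _ => 0), cfd_const]
  · rfl
  · filter_upwards [hV.mem_nhds hz] with w hw
    exact cfd_conj_hol_of_differentiableAt
      (differentiableAt_pi.1 (differentiableAt_of_contDiffOn_omega hV hφ hw) a) i

end Holomorphic

/-! ### Invariance of tr(S - Q) and of the Laplacian under holomorphic changes of coordinates. -/

section Invariance

variable {n : ℕ} {φ : (Fin n → ℂ) → (Fin n → ℂ)} {z : Fin n → ℂ} {V V' : Set (Fin n → ℂ)}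
  {G G' : (Fin n → ℂ) → Matrix (Fin n) (Fin n) ℂ}

lemma contDiffOn_comp_omega (hφ : ContDiffOn ℂ ω φ V) (hm : Set.MapsTo φ V V')
    {f : (Fin n → ℂ) → ℂ} (hf : ContDiffOn ℝ ∞ f V') : ContDiffOn ℝ ∞ (fun w => f (φ w)) V :=
  hf.comp (contDiffOn_real_of_omega hφ) hm

lemma smoothMatOn_comp (hφ : ContDiffOn ℂ ω φ V) (hm : Set.MapsTo φ V V')
    (hG' : SmoothMatOn G' V') : SmoothMatOn (fun w => G' (φ w)) V := fun j k =>
  contDiffOn_comp_omega hφ hm (hG' j k)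

/-- The transformation of the derivative of the metric coefficients. -/
lemma cfdM_change (hV : IsOpen V) (hV' : IsOpen V') (hφ : ContDiffOn ℂ ω φ V)
    (hm : Set.MapsTo φ V V') (hG' : SmoothMatOn G' V')
    (hG : ∀ w ∈ V, G w = jac φ w * G' (φ w) * (jac φ w)ᴴ) (hz : z ∈ V) (i : Fin n) :
    cfdM (hol i) G z = cfdM (hol i) (jac φ) z * G' (φ z) * (jac φ z)ᴴ +
      ∑ a, jac φ z i a • (jac φ z * cfdM (hol a) G' (φ z) * (jac φ z)ᴴ) := by
  have hA := smoothMatOn_jac hV hφ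
  have hC := smoothMatOn_comp hφ hm hG'
  rw [cfdM_congr (H := fun w => jac φ w * G' (φ w) * (jac φ w)ᴴ),
    cfdM_mul (F := fun w => jac φ w * G' (φ w)) ((hA.mul hC).diffMatAt hV hz)
      (hA.conjTranspose.diffMatAt hV hz),
    cfdM_mul (hA.diffMatAt hV hz) (hC.diffMatAt hV hz), cfdM_conjTranspose,
    cfdM_conj_jac hV hφ hz]
  · have e : cfdM (hol i) (fun w => G' (φ w)) z =
        ∑ a, jac φ z i a • cfdM (hol a) G' (φ z) := by
      ext j k
      simp only [cfdM, Matrix.of_apply, Matrix.sum_apply, Matrix.smul_apply, smul_eq_mul]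
      exact cfd_hol_comp (differentiableAt_of_contDiffOn_omega hV hφ hz)
        (differentiableAt_of_contDiffOn hV' (hG' j k) (hm hz)) i
    rw [e, Matrix.conjTranspose_zero, mul_zero, add_zero, add_mul, Matrix.mul_sum, Matrix.sum_mul]
    simp only [Matrix.mul_smul, Matrix.smul_mul]
  · filter_upwards [hV.mem_nhds hz] with w hw using hG w hw

/-- The inhomogeneous term ∂_i A · G' · Aᴴ in the transformation of ∂_i G is symmetric in its first
two indices, since A is a Jacobian, and disappears on antisymmetrising: the torsion is a tensor. -/
lemma torMat_change (hV : IsOpen V) (hV' : IsOpen V') (hφ : ContDiffOn ℂ ω φ V)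
    (hm : Set.MapsTo φ V V') (hG' : SmoothMatOn G' V')
    (hG : ∀ w ∈ V, G w = jac φ w * G' (φ w) * (jac φ w)ᴴ) (hz : z ∈ V) (i : Fin n) :
    torMat hol G z i = ∑ a, jac φ z i a • (jac φ z * torMat hol G' (φ z) a * (jac φ z)ᴴ) := by
  have e0 : ∀ i j k, (cfdM (hol i) (jac φ) z * G' (φ z) * (jac φ z)ᴴ) j k =
      (cfdM (hol j) (jac φ) z * G' (φ z) * (jac φ z)ᴴ) i k := by
    intro i j k
    simp only [mul_assoc, Matrix.mul_apply (M := cfdM _ _ _), cfdM_hol_jac_symm hV hφ hz i j]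
  have e1 : ∀ (i j k : Fin n) (B : Fin n → Matrix (Fin n) (Fin n) ℂ),
      (∑ a, jac φ z i a • (jac φ z * B a * (jac φ z)ᴴ)) j k =
      ∑ a, ∑ b, ∑ c, jac φ z i a * jac φ z j b * B a b c * star (jac φ z k c) := by
    intro i j k B
    simp only [Matrix.sum_apply, Matrix.smul_apply, smul_eq_mul, mul_assoc (jac φ z) _ _,
      Matrix.mul_apply, Matrix.conjTranspose_apply, Finset.mul_sum]
    exact Finset.sum_congr rfl fun a _ => Finset.sum_congr rfl fun b _ =>
      Finset.sum_congr rfl fun c _ => by ring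
  ext j k
  rw [torMat, Matrix.of_apply, cfdM_change hV hV' hφ hm hG' hG hz,
    cfdM_change hV hV' hφ hm hG' hG hz, Matrix.add_apply, Matrix.add_apply, e0 i j k, e1, e1, e1]
  rw [Finset.sum_comm (f := fun a b => ∑ c, jac φ z j a * jac φ z i b *
    cfdM (hol a) G' (φ z) b c * star (jac φ z k c))]
  rw [add_sub_add_left_eq_sub]
  simp only [← Finset.sum_sub_distrib, torMat, Matrix.of_apply]
  exact Finset.sum_congr rfl fun a _ => Finset.sum_congr rfl fun b _ =>
      Finset.sum_congr rfl fun c _ => by ring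

lemma inv_change {A B : Matrix (Fin n) (Fin n) ℂ} :
    (A * B * Aᴴ)⁻¹ = (Aᴴ)⁻¹ * B⁻¹ * A⁻¹ := by
  rw [Matrix.mul_inv_rev, Matrix.mul_inv_rev, mul_assoc]

lemma trace_gammaMat_change (hV : IsOpen V) (hV' : IsOpen V') (hφ : ContDiffOn ℂ ω φ V)
    (hm : Set.MapsTo φ V V') (hG' : SmoothMatOn G' V') (h0' : ∀ y ∈ V', (G' y).det ≠ 0)
    (hA0 : ∀ w ∈ V, (jac φ w).det ≠ 0)
    (hG : ∀ w ∈ V, G w = jac φ w * G' (φ w) * (jac φ w)ᴴ) (hz : z ∈ V) (i : Fin n) :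
    (gammaMat (hol i) G z).trace = (cfdM (hol i) (jac φ) z * (jac φ z)⁻¹).trace +
      ∑ a, jac φ z i a * (gammaMat (hol a) G' (φ z)).trace := by
  have hu := isUnit_iff_ne_zero.2 (hA0 z hz)
  have hu' : IsUnit ((jac φ z)ᴴ).det := by rw [Matrix.det_conjTranspose]; exact hu.star
  have hug := isUnit_iff_ne_zero.2 (h0' _ (hm hz))
  rw [gammaMat, cfdM_change hV hV' hφ hm hG' hG hz, hG z hz, inv_change, add_mul,
    Matrix.trace_add, Matrix.sum_mul, Matrix.trace_sum]
  congr 1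
  · congr 1
    simp only [mul_assoc]
    rw [← mul_assoc ((jac φ z)ᴴ), Matrix.mul_nonsing_inv _ hu', one_mul, ← mul_assoc (G' (φ z)),
      Matrix.mul_nonsing_inv _ hug, one_mul]
  · refine Finset.sum_congr rfl fun a _ => ?_
    rw [Matrix.smul_mul, Matrix.trace_smul, smul_eq_mul]
    congr 1
    simp only [mul_assoc]
    rw [← mul_assoc ((jac φ z)ᴴ), Matrix.mul_nonsing_inv _ hu', one_mul, Matrix.trace_mul_comm]
    simp only [mul_assoc, Matrix.nonsing_inv_mul _ hu, mul_one, gammaMat]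

/-- The inhomogeneous part tr(∂A · A⁻¹) of tr Γ is holomorphic, so ∂_m̄ removes it, and ∂_m̄ tr Γ_l
transforms as a (1,1)-tensor. -/
lemma cfd_trace_gammaMat_change (hV : IsOpen V) (hV' : IsOpen V') (hφ : ContDiffOn ℂ ω φ V)
    (hm : Set.MapsTo φ V V') (hG' : SmoothMatOn G' V') (h0' : ∀ y ∈ V', (G' y).det ≠ 0)
    (hA0 : ∀ w ∈ V, (jac φ w).det ≠ 0)
    (hG : ∀ w ∈ V, G w = jac φ w * G' (φ w) * (jac φ w)ᴴ) (hz : z ∈ V) (l m : Fin n) :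
    cfd (conjDir (hol m)) (fun y => (gammaMat (hol l) G y).trace) z =
      ∑ a, ∑ b, jac φ z l a * star (jac φ z m b) *
        cfd (conjDir (hol b)) (fun y => (gammaMat (hol a) G' y).trace) (φ z) := by
  have hA := smoothMatOn_jac hV hφ
  have hD := hA.cfdM (ξ := hol l) hV
  have hI := hA.inv hA0
  have hΓ : ∀ a, ContDiffOn ℝ ∞ (fun y => (gammaMat (hol a) G' y).trace) V' := fun a =>
    (smoothMatOn_gammaMat hV' hG' h0').trace
  have hΓφ : ∀ a, DifferentiableAt ℝ (fun w => (gammaMat (hol a) G' (φ w)).trace) z := fun a =>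
    differentiableAt_of_contDiffOn hV (contDiffOn_comp_omega hφ hm (hΓ a)) hz
  rw [cfd_congr (g := fun w => (cfdM (hol l) (jac φ) w * (jac φ w)⁻¹).trace +
      ∑ a, jac φ w l a * (gammaMat (hol a) G' (φ w)).trace), cfd_add
      (differentiableAt_of_contDiffOn hV (hD.mul hI).trace hz)
      (DifferentiableAt.fun_sum fun a _ => (hA.diffMatAt hV hz l a).fun_mul (hΓφ a)),
    cfdM_trace ((hD.mul hI).diffMatAt hV hz),
    cfdM_mul (hD.diffMatAt hV hz) (hI.diffMatAt hV hz), cfdM_inv hV hA hA0 hz,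
    cfdM_comm hV hA hz, cfdM_conj_jac hV hφ hz, cfdM_congr (H := fun _ => 0)]
  · have e : cfdM (hol l) (fun _ : Fin n → ℂ => (0 : Matrix (Fin n) (Fin n) ℂ)) z = 0 := by
      ext j k; simp [cfdM]
    rw [e, cfd_sum fun a _ => (hA.diffMatAt hV hz l a).fun_mul (hΓφ a)]
    simp only [zero_mul, mul_zero, neg_zero, add_zero, Matrix.trace_zero, zero_add]
    refine Finset.sum_congr rfl fun a _ => ?_
    have e2 : cfd (conjDir (hol m)) (fun w => jac φ w l a) z = 0 :=
      congrFun (congrFun (cfdM_conj_jac hV hφ hz m) l) a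
    rw [cfd_mul (hA.diffMatAt hV hz l a) (hΓφ a), e2, zero_mul, zero_add,
      cfd_conj_hol_comp (f := fun y => (gammaMat (hol a) G' y).trace)
        (differentiableAt_of_contDiffOn_omega hV hφ hz)
        (differentiableAt_of_contDiffOn hV' (hΓ a) (hm hz)), Finset.mul_sum]
    simp only [mul_assoc]
  · filter_upwards [hV.mem_nhds hz] with w hw using cfdM_conj_jac hV hφ hw m
  · filter_upwards [hV.mem_nhds hz] with w hw using
      trace_gammaMat_change hV hV' hφ hm hG' h0' hA0 hG hw l

/-- Contraction of a `(1,1)`-tensor with the metric is invariant. -/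
lemma sum_inv_mul_change {P P' A : Matrix (Fin n) (Fin n) ℂ} (hA : IsUnit A.det)
    (hP : P = (Aᴴ)⁻¹ * P' * A⁻¹) {B B' : Fin n → Fin n → ℂ}
    (hB : ∀ l m, B l m = ∑ a, ∑ b, A l a * star (A m b) * B' a b) :
    ∑ l, ∑ m, P m l * B l m = ∑ a, ∑ b, P' b a * B' a b := by
  simp only [inverse_metric_change hA hP, hB, Finset.mul_sum, Finset.sum_mul]
  rw [sum_pair_comm]
  exact Finset.sum_congr rfl fun a _ => Finset.sum_congr rfl fun b _ =>
    Finset.sum_congr rfl fun l _ => Finset.sum_congr rfl fun m _ => by ring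

lemma smoothMatOn_of_change (hV : IsOpen V) (hφ : ContDiffOn ℂ ω φ V)
    (hm : Set.MapsTo φ V V') (hG' : SmoothMatOn G' V')
    (hG : ∀ w ∈ V, G w = jac φ w * G' (φ w) * (jac φ w)ᴴ) : SmoothMatOn G V :=
  (((smoothMatOn_jac hV hφ).mul (smoothMatOn_comp hφ hm hG')).mul
    (smoothMatOn_jac hV hφ).conjTranspose).congr hG

/-- The trace of `S - Q` does not depend on the coordinates. -/
lemma scalSQ_change (hV : IsOpen V) (hV' : IsOpen V') (hφ : ContDiffOn ℂ ω φ V)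
    (hm : Set.MapsTo φ V V') (hG' : SmoothMatOn G' V') (h0' : ∀ y ∈ V', (G' y).det ≠ 0)
    (hh' : ∀ y ∈ V', (G' y).IsHermitian) (hA0 : ∀ w ∈ V, (jac φ w).det ≠ 0)
    (hG : ∀ w ∈ V, G w = jac φ w * G' (φ w) * (jac φ w)ᴴ) (hz : z ∈ V) :
    scalSQ hol G z = scalSQ hol G' (φ z) := by
  have hu := isUnit_iff_ne_zero.2 (hA0 z hz)
  have hGs := smoothMatOn_of_change hV hφ hm hG' hG
  have h0 : ∀ w ∈ V, (G w).det ≠ 0 := by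
    intro w hw
    rw [hG w hw, Matrix.det_mul, Matrix.det_mul, Matrix.det_conjTranspose]
    exact mul_ne_zero (mul_ne_zero (hA0 w hw) (h0' _ (hm hw))) (star_ne_zero.2 (hA0 w hw))
  have hh : (G z).IsHermitian := by
    rw [hG z hz, Matrix.IsHermitian, Matrix.conjTranspose_mul, Matrix.conjTranspose_mul,
      Matrix.conjTranspose_conjTranspose, (hh' _ (hm hz)).eq, mul_assoc]
  have hP : (G z)⁻¹ = ((jac φ z)ᴴ)⁻¹ * (G' (φ z))⁻¹ * (jac φ z)⁻¹ := by rw [hG z hz, inv_change]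
  have hT := torMat_change hV hV' hφ hm hG' hG hz
  -- The trace of Q is a combination of two invariant norms; only the curvature part remains.
  rw [scalSQ_eq hh, scalSQ_eq (hh' _ (hm hz)), torsionNormSq_change hu hP hT,
    torsionTraceNormSq_change hu hP hT]
  congr 1
  refine sum_inv_mul_change hu hP fun l m => ?_
  rw [trace_inv_mul_curvMat hV hGs h0 hz,
    cfd_trace_gammaMat_change hV hV' hφ hm hG' h0' hA0 hG hz]
  simp only [trace_inv_mul_curvMat hV' hG' h0' (hm hz), mul_neg, Finset.sum_neg_distrib]

/-- The Laplacian does not depend on the coordinates. -/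
lemma lapl_change (hV : IsOpen V) (hV' : IsOpen V') (hφ : ContDiffOn ℂ ω φ V)
    (hm : Set.MapsTo φ V V') (hA0 : ∀ w ∈ V, (jac φ w).det ≠ 0)
    (hG : ∀ w ∈ V, G w = jac φ w * G' (φ w) * (jac φ w)ᴴ) (hz : z ∈ V)
    {v : (Fin n → ℂ) → ℂ} (hv : ContDiffOn ℝ ∞ v V') :
    lapl hol G (fun w => v (φ w)) z = lapl hol G' v (φ z) := by
  have hu := isUnit_iff_ne_zero.2 (hA0 z hz)
  have hP : (G z)⁻¹ = ((jac φ z)ᴴ)⁻¹ * (G' (φ z))⁻¹ * (jac φ z)⁻¹ := by rw [hG z hz, inv_change]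
  have hA := smoothMatOn_jac hV hφ
  refine sum_inv_mul_change hu hP fun l m => ?_
  have hd : ∀ b, ContDiffOn ℝ ∞ (cfd (conjDir (hol b)) v) V' := fun b => contDiffOn_cfd hV' hv
  have hdφ : ∀ b, DifferentiableAt ℝ (fun w => cfd (conjDir (hol b)) v (φ w)) z := fun b =>
    differentiableAt_of_contDiffOn hV (contDiffOn_comp_omega hφ hm (hd b)) hz
  have hAs : ∀ b, DifferentiableAt ℝ (fun w => star (jac φ w m b)) z := fun b =>
    (hA.diffMatAt hV hz m b).star
  rw [cfd_congr (g := fun w => ∑ b, star (jac φ w m b) * cfd (conjDir (hol b)) v (φ w)),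
    cfd_sum fun b _ => (hAs b).fun_mul (hdφ b), Finset.sum_comm]
  · refine Finset.sum_congr rfl fun b _ => ?_
    -- The conjugate Jacobian is antiholomorphic, so ∂_l of it vanishes and no first-order term in v
    -- appears.
    have e2 : cfd (conjDir (hol l)) (fun w => jac φ w m b) z = 0 :=
      congrFun (congrFun (cfdM_conj_jac hV hφ hz l) m) b
    rw [cfd_mul (hAs b) (hdφ b), cfd_star, e2, star_zero, zero_mul, zero_add,
      cfd_hol_comp (differentiableAt_of_contDiffOn_omega hV hφ hz)
        (differentiableAt_of_contDiffOn hV' (hd b) (hm hz)), Finset.mul_sum]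
    exact Finset.sum_congr rfl fun a _ => by ring
  · filter_upwards [hV.mem_nhds hz] with w hw
    exact cfd_conj_hol_comp (differentiableAt_of_contDiffOn_omega hV hφ hw)
      (differentiableAt_of_contDiffOn hV' hv (hm hw)) m

end Invariance

end HermitianFlow

namespace HermitianFlow

open Complex Matrix

/-! ### The sesquilinear form of a J-invariant symmetric form. -/

section Sesquilinear

variable {W : Type*} [AddCommGroup W] [Module ℂ W] [Module ℝ W]

/-- The sesquilinear form `B(u, v) + √-1 B(u, J v)` attached to a real bilinear form. -/
def sesqForm (B : LinearMap.BilinForm ℝ W) (u v : W) : ℂ := (B u v : ℂ) + I * (B u (I • v) : ℂ)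

variable {B : LinearMap.BilinForm ℝ W}

lemma form_I_left (hc : ∀ u v, B (I • u) (I • v) = B u v) (u v : W) :
    B (I • u) v = -B u (I • v) := by
  rw [← hc (I • u) v, smul_smul, I_mul_I, neg_smul, one_smul, map_neg]
  rfl

lemma star_sesqForm (hs : ∀ u v, B u v = B v u) (hc : ∀ u v, B (I • u) (I • v) = B u v)
    (u v : W) : star (sesqForm B u v) = sesqForm B v u := by
  simp only [sesqForm, star_add, star_mul', RCLike.star_def, conj_ofReal, conj_I]
  rw [hs v u, hs v (I • u), form_I_left hc]
  push_cast
  ring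

lemma sesqForm_self (hs : ∀ u v, B u v = B v u) (hc : ∀ u v, B (I • u) (I • v) = B u v)
    (u : W) : sesqForm B u u = B u u := by
  have h1 : B u (I • u) = 0 := by
    have := form_I_left hc u u
    rw [hs (I • u) u] at this
    linarith
  simp [sesqForm, h1]

variable [IsScalarTower ℝ ℂ W]

lemma complex_smul_eq (c : ℂ) (u : W) : c • u = c.re • u + c.im • (I • u) := by
  conv_lhs => rw [← Complex.re_add_im c, add_smul, mul_smul]
  rw [← algebraMap_smul ℂ c.re u, ← algebraMap_smul ℂ c.im (I • u)]
  rfl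

lemma sesqForm_sum_smul_right {ι : Type*} (s : Finset ι) (u : W) (c : ι → ℂ) (v : ι → W) :
    sesqForm B u (∑ i ∈ s, c i • v i) = ∑ i ∈ s, star (c i) * sesqForm B u (v i) := by
  simp only [sesqForm, Finset.smul_sum, map_sum, Complex.ofReal_sum, Finset.mul_sum,
    ← Finset.sum_add_distrib]
  refine Finset.sum_congr rfl fun i _ => ?_
  rw [smul_comm I (c i), complex_smul_eq (c i), complex_smul_eq (c i) (I • v i), smul_smul I I]
  simp only [map_add, map_smul, I_mul_I, neg_smul, one_smul, map_neg, smul_eq_mul]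
  have : star (c i) = (c i).re - (c i).im * I := by
    conv_lhs => rw [← Complex.re_add_im (c i)]
    simp only [star_add, star_mul', RCLike.star_def, conj_ofReal, conj_I, mul_neg, sub_eq_add_neg]
  rw [this]
  push_cast
  ring_nf
  simp only [I_sq]
  ring

lemma sesqForm_sum_smul_left (hc : ∀ u v, B (I • u) (I • v) = B u v) {ι : Type*} (s : Finset ι)
    (u : ι → W) (c : ι → ℂ) (v : W) :
    sesqForm B (∑ i ∈ s, c i • u i) v = ∑ i ∈ s, c i * sesqForm B (u i) v := by
  simp only [sesqForm, map_sum, LinearMap.sum_apply, Complex.ofReal_sum,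
    Finset.mul_sum, ← Finset.sum_add_distrib]
  refine Finset.sum_congr rfl fun i _ => ?_
  rw [complex_smul_eq (c i)]
  simp only [map_add, map_smul, LinearMap.add_apply, LinearMap.smul_apply, form_I_left hc,
    smul_smul, I_mul_I, neg_smul, one_smul, map_neg, smul_eq_mul, neg_neg]
  conv_rhs => enter [1]; rw [← Complex.re_add_im (c i)]
  push_cast
  ring_nf
  simp only [I_sq]
  ring

end Sesquilinear

/-! ### Chart transitions. -/

section Overlap

variable {n : ℕ} {M : Type*} [TopologicalSpace M]
  {e e' : OpenPartialHomeomorph M (Fin n → ℂ)} {z : Fin n → ℂ}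

/-- The domain of the change of coordinates from `e` to `e'`. -/
def overlap (e e' : OpenPartialHomeomorph M (Fin n → ℂ)) : Set (Fin n → ℂ) :=
  (e.symm.trans e').source

/-- The change of coordinates from `e` to `e'`. -/
noncomputable def transition (e e' : OpenPartialHomeomorph M (Fin n → ℂ)) (z : Fin n → ℂ) : Fin n → ℂ :=
  e' (e.symm z)

lemma isOpen_overlap (e e' : OpenPartialHomeomorph M (Fin n → ℂ)) : IsOpen (overlap e e') :=
  (e.symm.trans e').open_source

lemma mem_overlap : z ∈ overlap e e' ↔ z ∈ e.target ∧ e.symm z ∈ e'.source := by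
  simp [overlap]

lemma mapsTo_transition (e e' : OpenPartialHomeomorph M (Fin n → ℂ)) :
    Set.MapsTo (transition e e') (overlap e e') e'.target := fun _ hz =>
  e'.map_source (mem_overlap.1 hz).2

lemma symm_transition (hz : z ∈ overlap e e') : e'.symm (transition e e' z) = e.symm z :=
  e'.left_inv (mem_overlap.1 hz).2

end Overlap

/-! ### Transformation and positivity of the metric coefficients. -/

section Charts

variable {n : ℕ} {M : Type*} [TopologicalSpace M] [ChartedSpace (Fin n → ℂ) M]

variable (n M) in
/-- The holomorphic charts of `M`. -/
abbrev holAtlas : Set (OpenPartialHomeomorph M (Fin n → ℂ)) :=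
  IsManifold.maximalAtlas 𝓘(ℂ, Fin n → ℂ) ω M

/-- The derivative of the inverse of a chart. -/
noncomputable def symmDeriv (e : OpenPartialHomeomorph M (Fin n → ℂ)) (z : Fin n → ℂ) :
    (Fin n → ℂ) →L[ℂ] (Fin n → ℂ) :=
  mfderiv 𝓘(ℂ, Fin n → ℂ) 𝓘(ℂ, Fin n → ℂ) e.symm z

variable {e e' : OpenPartialHomeomorph M (Fin n → ℂ)} {z : Fin n → ℂ}

/-- A field of bilinear forms, with the tangent spaces identified with `ℂⁿ`. -/
noncomputable def formAt (b : ∀ x : M, LinearMap.BilinForm ℝ (Tan (n := n) x)) (x : M) :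
    LinearMap.BilinForm ℝ (Fin n → ℂ) := b x

lemma coeff_apply (b : ∀ x : M, LinearMap.BilinForm ℝ (Tan (n := n) x)) (i j : Fin n) :
    coeff b e z i j = sesqForm (formAt b (e.symm z)) (symmDeriv e z (Pi.single i 1))
      (symmDeriv e z (Pi.single j 1)) := rfl

lemma mdifferentiable_of_mem_holAtlas (he : e ∈ holAtlas n M) :
    e.MDifferentiable 𝓘(ℂ, Fin n → ℂ) 𝓘(ℂ, Fin n → ℂ) :=
  ⟨(contMDiffOn_of_mem_maximalAtlas he).mdifferentiableOn (by simp),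
    (contMDiffOn_symm_of_mem_maximalAtlas he).mdifferentiableOn (by simp)⟩

lemma symmDeriv_injective (he : e ∈ holAtlas n M) (hz : z ∈ e.target) :
    Function.Injective (symmDeriv e z) :=
  (mdifferentiable_of_mem_holAtlas he).symm.mfderiv_injective hz

lemma contDiffOn_transition (he : e ∈ holAtlas n M) (he' : e' ∈ holAtlas n M) :
    ContDiffOn ℂ ω (transition e e') (overlap e e') := by
  have h := (ModelWithCorners.contDiffOn_extendCoordChange he he')
  rw [ModelWithCorners.extendCoordChange_source] at h
  simp only [modelWithCornersSelf_coe, Set.image_id] at h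
  exact h

lemma symmDeriv_eq (he : e ∈ holAtlas n M) (he' : e' ∈ holAtlas n M) (hz : z ∈ overlap e e') :
    symmDeriv e z = symmDeriv e' (transition e e' z) ∘L fderiv ℂ (transition e e') z := by
  have h1 : MDifferentiableAt 𝓘(ℂ, Fin n → ℂ) 𝓘(ℂ, Fin n → ℂ) e'.symm (transition e e' z) :=
    (mdifferentiable_of_mem_holAtlas he').mdifferentiableAt_symm (mapsTo_transition e e' hz)
  have h2 : MDifferentiableAt 𝓘(ℂ, Fin n → ℂ) 𝓘(ℂ, Fin n → ℂ) (transition e e') z :=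
    (differentiableAt_of_contDiffOn_omega (isOpen_overlap e e')
      (contDiffOn_transition he he') hz).mdifferentiableAt
  have h3 := mfderiv_comp z h1 h2
  rw [mfderiv_eq_fderiv] at h3
  have h4 : (e.symm : (Fin n → ℂ) → M) =ᶠ[nhds z] e'.symm ∘ transition e e' := by
    filter_upwards [(isOpen_overlap e e').mem_nhds hz] with w hw
    exact (symm_transition hw).symm
  exact (h4.mfderiv_eq).trans h3

lemma isUnit_det_jac_transition (he : e ∈ holAtlas n M) (he' : e' ∈ holAtlas n M)
    (hz : z ∈ overlap e e') : (jac (transition e e') z).det ≠ 0 := by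
  have h1 : Function.Injective (fderiv ℂ (transition e e') z) := by
    have h := symmDeriv_injective he (mem_overlap.1 hz).1
    rw [symmDeriv_eq he he' hz] at h
    exact Function.Injective.of_comp h
  have h2 : jac (transition e e') z =
      (LinearMap.toMatrix' (fderiv ℂ (transition e e') z : (Fin n → ℂ) →ₗ[ℂ] (Fin n → ℂ)))ᵀ := by
    ext i a
    simp [jac, LinearMap.toMatrix'_apply]
  rw [h2, Matrix.det_transpose, LinearMap.det_toMatrix']
  intro h
  exact (LinearMap.bot_lt_ker_of_det_eq_zero h).ne' (LinearMap.ker_eq_bot.2 h1)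

/-- The transformation law of the coefficients of a `J`-invariant bilinear form. -/
lemma coeff_change {b : ∀ x : M, LinearMap.BilinForm ℝ (Tan (n := n) x)}
    (hc : ∀ x u v, b x (I • u) (I • v) = b x u v)
    (he : e ∈ holAtlas n M) (he' : e' ∈ holAtlas n M) (hz : z ∈ overlap e e') :
    coeff b e z = jac (transition e e') z * coeff b e' (transition e e' z) *
      (jac (transition e e') z)ᴴ := by
  have hX : ∀ i, symmDeriv e z (Pi.single i 1) = ∑ a, jac (transition e e') z i a •
      symmDeriv e' (transition e e' z) (Pi.single a 1) := by
    intro i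
    rw [symmDeriv_eq he he' hz, ContinuousLinearMap.comp_apply]
    conv_lhs => rw [pi_eq_sum_univ' (fderiv ℂ (transition e e') z (Pi.single i 1)), map_sum]
    refine Finset.sum_congr rfl fun a _ => ?_
    rw [map_smul]
    rfl
  ext i j
  rw [coeff_apply, hX, hX, sesqForm_sum_smul_left (B := formAt b (e.symm z)) (hc (e.symm z))]
  simp only [sesqForm_sum_smul_right, Matrix.mul_apply, Matrix.conjTranspose_apply, coeff_apply,
    Finset.sum_mul, Finset.mul_sum, symm_transition hz]
  rw [Finset.sum_comm]
  exact Finset.sum_congr rfl fun a _ => Finset.sum_congr rfl fun b _ => by ring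

open scoped ComplexOrder

namespace HermitianMetric

variable (g : HermitianMetric n M)

lemma posDef_mat (he : e ∈ holAtlas n M) (hz : z ∈ e.target) : (g.mat e z).PosDef := by
  refine Matrix.PosDef.of_dotProduct_mulVec_pos ?_ fun c hc => ?_
  · ext i j
    rw [Matrix.conjTranspose_apply, mat, coeff_apply, coeff_apply]
    exact star_sesqForm (B := formAt g.form (e.symm z)) (g.symm _) (g.compat _) _ _
  -- The coefficients are conjugated because `sesqForm` is linear in its first argument, where the
  -- matrix expression carries `star c`.
  · set w : Fin n → ℂ := ∑ i, star (c i) • symmDeriv e z (Pi.single i 1) with hw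
    have h1 : star c ⬝ᵥ g.mat e z *ᵥ c =
        sesqForm (formAt g.form (e.symm z)) w w := by
      rw [hw, sesqForm_sum_smul_left (B := formAt g.form (e.symm z)) (g.compat _)]
      simp only [sesqForm_sum_smul_right, star_star, dotProduct, Matrix.mulVec, mat, coeff_apply,
        Pi.star_apply]
      exact Finset.sum_congr rfl fun i _ => by
        congr 1
        exact Finset.sum_congr rfl fun j _ => mul_comm _ _
    have h2 : w ≠ 0 := by
      have : w = symmDeriv e z (star c) := by
        conv_rhs => rw [pi_eq_sum_univ' (star c), map_sum]
        refine Finset.sum_congr rfl fun a _ => ?_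
        rw [map_smul]
        rfl
      rw [this, Ne, map_eq_zero_iff _ (symmDeriv_injective he hz)]
      simpa using hc
    rw [h1, sesqForm_self (B := formAt g.form (e.symm z)) (g.symm _) (g.compat _)]
    exact_mod_cast g.pos (e.symm z) w h2

lemma isHermitian_mat (he : e ∈ holAtlas n M) (hz : z ∈ e.target) : (g.mat e z).IsHermitian :=
  (g.posDef_mat he hz).isHermitian

lemma det_mat_pos (he : e ∈ holAtlas n M) (hz : z ∈ e.target) : 0 < (g.mat e z).det :=
  (g.posDef_mat he hz).det_pos

lemma det_mat_ne_zero (he : e ∈ holAtlas n M) (hz : z ∈ e.target) : (g.mat e z).det ≠ 0 :=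
  (g.det_mat_pos he hz).ne'

lemma smoothMatOn_mat (he : e ∈ holAtlas n M) : SmoothMatOn (g.mat e) e.target := g.smooth e he

lemma mat_change (he : e ∈ holAtlas n M) (he' : e' ∈ holAtlas n M) :
    ∀ z ∈ overlap e e', g.mat e z = jac (transition e e') z *
      g.mat e' (transition e e' z) * (jac (transition e e') z)ᴴ := fun _ hz =>
  coeff_change g.compat he he' hz

/-- Frees `traceSQ` from the preferred chart at each point used in its definition. -/
lemma traceSQ_apply [IsManifold 𝓘(ℂ, Fin n → ℂ) ω M] (he : e ∈ holAtlas n M)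
    (hz : z ∈ e.target) : g.traceSQ (e.symm z) = scalSQ hol (g.mat e) z := by
  set e' := chartAt (Fin n → ℂ) (e.symm z)
  have hmem : e' ∈ holAtlas n M := IsManifold.chart_mem_maximalAtlas _
  have hz' : z ∈ overlap e e' := mem_overlap.2 ⟨hz, mem_chart_source _ _⟩
  change HermitianFlow.traceSQ (g.mat e') (transition e e' z) = _
  rw [traceSQ_eq e'.open_target (g.smoothMatOn_mat hmem)
    (fun y hy => g.det_mat_ne_zero hmem hy) (mapsTo_transition e e' hz')]
  exact (scalSQ_change (isOpen_overlap e e') e'.open_target (contDiffOn_transition he hmem)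
    (mapsTo_transition e e') (g.smoothMatOn_mat hmem) (fun y hy => g.det_mat_ne_zero hmem hy)
    (fun y hy => g.isHermitian_mat hmem hy) (fun w hw => isUnit_det_jac_transition he hmem hw)
    (g.mat_change he hmem) hz').symm

end HermitianMetric

end Charts

end HermitianFlow

/-! ### The volume measure in charts. -/

namespace HermitianFlow

open Complex Matrix MeasureTheory

open scoped ComplexOrder

lemma measurableSet_target_inter_preimage {n : ℕ} {M : Type*} [TopologicalSpace M]
    [MeasurableSpace M] [BorelSpace M] (e : OpenPartialHomeomorph M (Fin n → ℂ)) {B : Set M}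
    (hB : MeasurableSet B) : MeasurableSet (e.target ∩ e.symm ⁻¹' B) := by
  have h := (continuousOn_iff_continuous_domRestrict.1 e.continuousOn_symm).measurable hB
  have h2 := e.open_target.measurableSet.subtype_image h
  convert h2 using 1
  ext z
  simp [and_comm]

namespace HermitianMetric

variable {n : ℕ} {M : Type*} [TopologicalSpace M] [ChartedSpace (Fin n → ℂ) M]
  {e e' : OpenPartialHomeomorph M (Fin n → ℂ)} (g : HermitianMetric n M)

/-- The density of the volume in a chart. -/
noncomputable def density (e : OpenPartialHomeomorph M (Fin n → ℂ)) (z : Fin n → ℂ) : ENNReal :=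
  ENNReal.ofReal (g.mat e z).det.re

/-- The real Jacobian determinant of a holomorphic map is |det A|², which is the factor relating
det(A G' Aᴴ) to det G'. -/
lemma density_change (he : e ∈ holAtlas n M) (he' : e' ∈ holAtlas n M) {z : Fin n → ℂ}
    (hz : z ∈ overlap e e') :
    g.density e z = ENNReal.ofReal
      |((fderiv ℂ (transition e e') z).restrictScalars ℝ).det| *
        g.density e' (transition e e' z) := by
  have h1 : ((fderiv ℂ (transition e e') z).restrictScalars ℝ).det =
      Complex.normSq (jac (transition e e') z).det := by
    have : (jac (transition e e') z) =
      (LinearMap.toMatrix' (fderiv ℂ (transition e e') z : (Fin n → ℂ) →ₗ[ℂ] (Fin n → ℂ)))ᵀ := by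
      ext i a
      simp [jac, LinearMap.toMatrix'_apply]
    rw [this, Matrix.det_transpose, LinearMap.det_toMatrix', ← Algebra.norm_complex_apply,
      ← LinearMap.det_restrictScalars]
    rfl
  rw [h1, abs_of_nonneg (Complex.normSq_nonneg _), density, density,
    ← ENNReal.ofReal_mul (Complex.normSq_nonneg _), g.mat_change he he' z hz, Matrix.det_mul,
    Matrix.det_mul, Matrix.det_conjTranspose]
  congr 1
  have h2 : ∀ a b : ℂ, (a * b * star a).re = Complex.normSq a * b.re := by
    intro a b
    rw [mul_right_comm, RCLike.star_def, Complex.mul_conj, Complex.re_ofReal_mul]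
  exact h2 _ _

variable [MeasurableSpace M]

/-- The Riemannian volume measure of the domain of a chart. -/
noncomputable def chartVol (e : OpenPartialHomeomorph M (Fin n → ℂ)) : Measure M :=
  Measure.map e.symm ((volume.restrict e.target).withDensity (g.density e))

lemma vol_eq : g.vol = ⨆ e ∈ holAtlas n M, g.chartVol e := rfl

lemma chartVol_le_vol (he : e ∈ holAtlas n M) : g.chartVol e ≤ g.vol :=
  le_iSup₂_of_le (f := fun e (_ : e ∈ holAtlas n M) => g.chartVol e) e he le_rfl

variable [BorelSpace M]

lemma aemeasurable_symm (e : OpenPartialHomeomorph M (Fin n → ℂ)) :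
    AEMeasurable e.symm ((volume.restrict e.target).withDensity (g.density e)) :=
  (e.continuousOn_symm.aemeasurable e.open_target.measurableSet).mono_ac
    (withDensity_absolutelyContinuous _ _)

lemma chartVol_apply (e : OpenPartialHomeomorph M (Fin n → ℂ)) {B : Set M}
    (hB : MeasurableSet B) :
    g.chartVol e B = ∫⁻ z in e.target ∩ e.symm ⁻¹' B, g.density e z := by
  rw [chartVol, Measure.map_apply_of_aemeasurable (g.aemeasurable_symm e) hB, withDensity_apply',
    Measure.restrict_restrict' e.open_target.measurableSet, Set.inter_comm]

lemma chartVol_inter_source (e : OpenPartialHomeomorph M (Fin n → ℂ)) {B : Set M}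
    (hB : MeasurableSet B) : g.chartVol e (B ∩ e.source) = g.chartVol e B := by
  rw [g.chartVol_apply e hB, g.chartVol_apply e (hB.inter e.open_source.measurableSet)]
  congr 2
  ext z
  simp only [Set.mem_inter_iff, Set.mem_preimage]
  exact ⟨fun h => ⟨h.1, h.2.1⟩, fun h => ⟨h.1, h.2, e.map_target h.1⟩⟩

/-- The change of variables formula for the transition map, whose Jacobian is absorbed by
`density_change`. -/
lemma chartVol_compat (he : e ∈ holAtlas n M) (he' : e' ∈ holAtlas n M) {B : Set M}
    (hB : MeasurableSet B) : g.chartVol e (B ∩ e'.source) = g.chartVol e' (B ∩ e.source) := by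
  have hB' := hB.inter e'.open_source.measurableSet
  rw [g.chartVol_apply e hB', g.chartVol_apply e' (hB.inter e.open_source.measurableSet)]
  set A := e.target ∩ e.symm ⁻¹' (B ∩ e'.source) with hA
  have hAo : ∀ z ∈ A, z ∈ overlap e e' := fun z hz => mem_overlap.2 ⟨hz.1, hz.2.2⟩
  have himg : e'.target ∩ e'.symm ⁻¹' (B ∩ e.source) = transition e e' '' A := by
    ext w
    constructor
    · rintro ⟨h1, h2, h3⟩
      refine ⟨e (e'.symm w), ⟨e.map_source h3, ?_⟩, ?_⟩
      · rw [Set.mem_preimage, e.left_inv h3]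
        exact ⟨h2, e'.map_target h1⟩
      · rw [transition, e.left_inv h3, e'.right_inv h1]
    · rintro ⟨z, hz, rfl⟩
      have h := hAo z hz
      refine ⟨mapsTo_transition e e' h, ?_⟩
      rw [Set.mem_preimage, symm_transition h]
      exact ⟨hz.2.1, e.map_target hz.1⟩
  have hinj : Set.InjOn (transition e e') A := by
    intro z hz w hw hzw
    have h1 := symm_transition (hAo z hz)
    rw [hzw, symm_transition (hAo w hw)] at h1
    exact (e.symm.injOn hw.1 hz.1 h1).symm
  rw [himg, lintegral_image_eq_lintegral_abs_det_fderiv_mul volume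
    (measurableSet_target_inter_preimage e hB')
    (f' := fun z => (fderiv ℂ (transition e e') z).restrictScalars ℝ) (fun z hz => ?_) hinj]
  · exact setLIntegral_congr_fun (measurableSet_target_inter_preimage e hB') fun z hz =>
      g.density_change he he' (hAo z hz)
  · exact ((differentiableAt_of_contDiffOn_omega (isOpen_overlap e e')
      (contDiffOn_transition he he') (hAo z hz)).hasFDerivAt.restrictScalars ℝ).hasFDerivWithinAt

/-- In a chart the volume measure is the chart measure. -/
lemma vol_restrict_source (he : e ∈ holAtlas n M) : g.vol.restrict e.source = g.chartVol e := by
  have hs := e.open_source.measurableSet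
  -- Every chart measure agrees with that of `e` on `e.source` and is at most `vol` off it, so the
  -- right-hand side bounds them all and hence their supremum. This prevents the supremum from
  -- exceeding `chartVol e` on `e.source`.
  have hle : g.vol ≤ g.chartVol e + g.vol.restrict e.sourceᶜ := by
    rw [vol_eq]
    refine iSup₂_le fun e' he' => Measure.le_iff.2 fun B hB => ?_
    rw [← vol_eq, Measure.add_apply, Measure.restrict_apply hB, ← measure_inter_add_sdiff B hs,
      g.chartVol_compat he' he hB]
    exact add_le_add (measure_mono Set.inter_subset_left) (g.chartVol_le_vol he' _)
  refine le_antisymm (Measure.le_iff.2 fun B hB => ?_) (Measure.le_iff.2 fun B hB => ?_)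
  · rw [Measure.restrict_apply hB]
    refine (hle _).trans ?_
    rw [Measure.add_apply, Measure.restrict_apply (hB.inter hs), g.chartVol_inter_source e hB,
      Set.inter_assoc, Set.inter_compl_self, Set.inter_empty, measure_empty, add_zero]
  · rw [Measure.restrict_apply hB, ← g.chartVol_inter_source e hB]
    exact g.chartVol_le_vol he _

/-- The integral of a function supported in a chart. -/
lemma integral_vol_eq (he : e ∈ holAtlas n M) {F : M → ℂ} (hF : ContinuousOn F e.source)
    (h0 : ∀ x, x ∉ e.source → F x = 0) :
    ∫ x, F x ∂g.vol = ∫ z in e.target, (g.mat e z).det * F (e.symm z) := by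
  have hs := e.open_source.measurableSet
  have ht := e.open_target.measurableSet
  have hdet : ContinuousOn (fun z => (g.mat e z).det) e.target :=
    (g.smoothMatOn_mat he).det.continuousOn
  have hdens : AEMeasurable (g.density e) (volume.restrict e.target) :=
    ENNReal.measurable_ofReal.comp_aemeasurable
      (Complex.measurable_re.comp_aemeasurable (hdet.aemeasurable ht))
  rw [← setIntegral_eq_integral_of_forall_compl_eq_zero h0, g.vol_restrict_source he]
  have hm : AEStronglyMeasurable F (g.chartVol e) := by
    rw [← g.vol_restrict_source he]
    exact hF.aestronglyMeasurable hs
  rw [chartVol, integral_map (g.aemeasurable_symm e) hm,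
    integral_withDensity_eq_integral_toReal_smul₀ hdens
      (Filter.Eventually.of_forall fun z => ENNReal.ofReal_lt_top)]
  refine setIntegral_congr_fun ht fun z hz => ?_
  have hp := g.det_mat_pos he hz
  have h1 : ((g.density e z).toReal : ℂ) = (g.mat e z).det := by
    rw [density, ENNReal.toReal_ofReal (Complex.pos_iff.1 hp).1.le]
    exact Complex.ext rfl (Complex.pos_iff.1 hp).2
  simp only [Complex.real_smul, h1]

end HermitianMetric

end HermitianFlow

namespace HermitianFlow

open Complex Matrix MeasureTheory

/-! ### Differentiation under the integral and integration by parts in a chart. -/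

section Analysis

variable {n : ℕ} {U K : Set (Fin n → ℂ)}

lemma integrableOn_of_eq_zero_off_compact {f : (Fin n → ℂ) → ℂ} (hU : IsOpen U)
    (hK : IsCompact K) (hKU : K ⊆ U) (hf : ContinuousOn f U) (h0 : ∀ z ∈ U, z ∉ K → f z = 0) :
    IntegrableOn f U :=
  ((hf.mono hKU).integrableOn_compact hK).of_forall_sdiff_eq_zero hU.measurableSet
    fun z hz => h0 z hz.1 hz.2

/-- Differentiation under the integral sign, with a compactly supported weight. -/
lemma hasDerivAt_integral_mul {ε : ℝ} (hε : 0 < ε) (hU : IsOpen U) (hK : IsCompact K)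
    (hKU : K ⊆ U) {ρ : (Fin n → ℂ) → ℂ} (hρ : ContinuousOn ρ U)
    (hρ0 : ∀ z ∈ U, z ∉ K → ρ z = 0) {Φ : ℝ × (Fin n → ℂ) → ℂ}
    (hΦ : ContDiffOn ℝ ∞ Φ (Set.Ioo (-ε) ε ×ˢ U)) :
    HasDerivAt (fun a => ∫ z in U, ρ z * Φ (a, z))
      (∫ z in U, ρ z * cfd (paramDir _) Φ (0, z)) 0 := by
  have hV : IsOpen (Set.Ioo (-ε) ε ×ˢ U) := isOpen_Ioo.prod hU
  have hD : ContinuousOn (cfd (paramDir (Fin n → ℂ)) Φ) (Set.Ioo (-ε) ε ×ˢ U) :=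
    (contDiffOn_cfd hV hΦ).continuousOn
  have hslice : ∀ {f : ℝ × (Fin n → ℂ) → ℂ}, ContinuousOn f (Set.Ioo (-ε) ε ×ˢ U) →
      ∀ a ∈ Set.Ioo (-ε) ε, ContinuousOn (fun z => ρ z * f (a, z)) U := by
    intro f hf a ha
    exact hρ.mul (hf.comp (by fun_prop) fun z hz => ⟨ha, hz⟩)
  have hsub : Set.Icc (-(ε / 2)) (ε / 2) ⊆ Set.Ioo (-ε) ε := fun a ha =>
    ⟨by linarith [ha.1], by linarith [ha.2]⟩
  -- Halving the parameter interval makes its product with K compact, which gives a uniform bound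
  -- for the parameter derivative; off K the weight ρ vanishes.
  obtain ⟨C, hC⟩ := ((isCompact_Icc (a := -(ε / 2)) (b := ε / 2)).prod hK).exists_bound_of_continuousOn
    (hD.mono (Set.prod_mono hsub hKU))
  have h0 : (0 : ℝ) ∈ Set.Ioo (-ε) ε := ⟨by linarith, hε⟩
  refine (hasDerivAt_integral_of_dominated_loc_of_deriv_le (μ := volume.restrict U)
    (F' := fun a z => ρ z * cfd (paramDir _) Φ (a, z)) (bound := fun z => C * ‖ρ z‖)
    (s := Set.Ioo (-(ε / 2)) (ε / 2)) (Ioo_mem_nhds (by linarith) (by linarith)) ?_ ?_ ?_ ?_ ?_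
    ?_).2
  · filter_upwards [Ioo_mem_nhds h0.1 h0.2] with a ha
    exact (hslice hΦ.continuousOn a ha).aestronglyMeasurable hU.measurableSet
  · exact integrableOn_of_eq_zero_off_compact hU hK hKU (hslice hΦ.continuousOn 0 h0)
      fun z hz hzK => by rw [hρ0 z hz hzK, zero_mul]
  · exact (hslice hD 0 h0).aestronglyMeasurable hU.measurableSet
  · filter_upwards [ae_restrict_mem hU.measurableSet] with z hz a ha
    by_cases hzK : z ∈ K
    · rw [norm_mul, mul_comm]
      exact mul_le_mul_of_nonneg_right (hC (a, z) ⟨⟨ha.1.le, ha.2.le⟩, hzK⟩) (norm_nonneg _)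
    · simp [hρ0 z hz hzK]
  · exact ((integrableOn_of_eq_zero_off_compact hU hK hKU hρ hρ0).norm).const_mul C
  · filter_upwards [ae_restrict_mem hU.measurableSet] with z hz a ha
    exact (hasDerivAt_cfd_paramDir (differentiableAt_of_contDiffOn hV hΦ
      ⟨hsub ⟨ha.1.le, ha.2.le⟩, hz⟩)).const_mul (ρ z)

/-- Integration by parts against the constant function 1. -/
lemma integral_cfd_eq_zero {Y : (Fin n → ℂ) → ℂ} (hY : ContDiff ℝ ∞ Y) (hc : HasCompactSupport Y)
    (ξ : (Fin n → ℂ) × (Fin n → ℂ)) : ∫ z, cfd ξ Y z = 0 := by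
  have hcont : ∀ v, Continuous fun z => fderiv ℝ Y z v := fun v =>
    (hY.continuous_fderiv (by simp)).clm_apply continuous_const
  have hint : ∀ v, Integrable fun z => fderiv ℝ Y z v := fun v =>
    (hcont v).integrable_of_hasCompactSupport (hc.fderiv_apply ℝ v)
  have h : ∀ v, ∫ z, fderiv ℝ Y z v = 0 := by
    intro v
    have := integral_mul_fderiv_eq_neg_fderiv_mul_of_integrable (μ := volume)
      (f := fun _ : Fin n → ℂ => (1 : ℂ)) (g := Y) (v := v) (by simp)
      (by simpa using hint v)
      (by simpa using hY.continuous.integrable_of_hasCompactSupport hc)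
      (fun x _ => differentiableAt_const _) (fun x _ => hY.differentiable (by simp) x)
    simpa using this
  simp only [cfd]
  rw [integral_add (hint _) ((hint _).const_mul I), integral_const_mul, h, h]
  simp

/-- The integral of a derivative of a function with compact support in `U` vanishes. -/
lemma setIntegral_cfd_eq_zero (hU : IsOpen U) (hK : IsCompact K) (hKU : K ⊆ U)
    {Y : (Fin n → ℂ) → ℂ} (hY : ContDiffOn ℝ ∞ Y U) (h0 : ∀ z ∈ U, z ∉ K → Y z = 0)
    (ξ : (Fin n → ℂ) × (Fin n → ℂ)) : ∫ z in U, cfd ξ Y z = 0 := by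
  classical
  -- Extension by zero is smooth on the whole space, because U and the complement of K form an open
  -- cover.
  set Z : (Fin n → ℂ) → ℂ := U.indicator Y with hZ
  have hZ0 : ∀ z, z ∉ K → Z z = 0 := by
    intro z hz
    by_cases hzU : z ∈ U
    · rw [hZ, Set.indicator_of_mem hzU, h0 z hzU hz]
    · rw [hZ, Set.indicator_of_notMem hzU]
  have hZU : ∀ z ∈ U, Z =ᶠ[nhds z] Y := fun z hz => by
    filter_upwards [hU.mem_nhds hz] with w hw using Set.indicator_of_mem hw Y
  have hZK : ∀ z, z ∉ K → Z =ᶠ[nhds z] fun _ => 0 := fun z hz => by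
    filter_upwards [hK.isClosed.isOpen_compl.mem_nhds hz] with w hw using hZ0 w hw
  have hZs : ContDiff ℝ ∞ Z := by
    rw [contDiff_iff_contDiffAt]
    intro z
    by_cases hz : z ∈ U
    · exact (hY.contDiffAt (hU.mem_nhds hz)).congr_of_eventuallyEq (hZU z hz)
    · exact contDiffAt_const.congr_of_eventuallyEq (hZK z fun h => hz (hKU h))
  have hZc : HasCompactSupport Z := HasCompactSupport.intro hK hZ0
  rw [← integral_cfd_eq_zero hZs hZc ξ, ← setIntegral_eq_integral_of_forall_compl_eq_zero (s := U)
    (f := cfd ξ Z)]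
  · exact setIntegral_congr_fun hU.measurableSet fun z hz => (cfd_congr (hZU z hz)).symm
  · intro z hz
    rw [cfd_congr (hZK z fun h => hz (hKU h)), cfd_const]

/-- On a Kähler manifold the Laplacian of a function with compact support in a chart has vanishing
integral. -/
lemma setIntegral_det_mul_lapl (hU : IsOpen U) (hK : IsCompact K) (hKU : K ⊆ U)
    {G : (Fin n → ℂ) → Matrix (Fin n) (Fin n) ℂ} (hG : SmoothMatOn G U)
    (hG0 : ∀ y ∈ U, (G y).det ≠ 0) (hT : ∀ y ∈ U, ∀ i, torMat hol G y i = 0)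
    {v : (Fin n → ℂ) → ℂ} (hv : ContDiffOn ℝ ∞ v U) (h0 : ∀ z ∈ U, z ∉ K → v z = 0) :
    ∫ z in U, (G z).det * lapl hol G v z = 0 := by
  have hI := hG.inv hG0
  set Y : Fin n → (Fin n → ℂ) → ℂ := fun l y =>
    ∑ m, (G y).det * (G y)⁻¹ m l * cfd (conjDir (hol m)) v y with hYdef
  have hY : ∀ l, ContDiffOn ℝ ∞ (Y l) U := fun l =>
    ContDiffOn.sum fun m _ => (hG.det.mul (hI m l)).mul (contDiffOn_cfd hU hv)
  have hev : ∀ z ∈ U, z ∉ K → v =ᶠ[nhds z] fun _ => 0 := fun z hz hzK => by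
    filter_upwards [hU.mem_nhds hz, hK.isClosed.isOpen_compl.mem_nhds hzK] with w hw hwK
      using h0 w hw hwK
  have hY0 : ∀ l, ∀ z ∈ U, z ∉ K → Y l z = 0 := fun l z hz hzK =>
    Finset.sum_eq_zero fun m _ => by rw [cfd_congr (hev z hz hzK), cfd_const, mul_zero]
  have hYi : ∀ l, IntegrableOn (cfd (hol l) (Y l)) U := fun l =>
    integrableOn_of_eq_zero_off_compact hU hK hKU (contDiffOn_cfd hU (hY l)).continuousOn
      fun z hz hzK => by
        rw [cfd_congr (g := fun _ => 0), cfd_const]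
        filter_upwards [hU.mem_nhds hz, hK.isClosed.isOpen_compl.mem_nhds hzK] with w hw hwK
          using hY0 l w hw hwK
  rw [setIntegral_congr_fun (g := fun z => ∑ l, cfd (hol l) (Y l) z) hU.measurableSet
    fun z hz => det_mul_lapl hU hG hG0 hT hz hv, integral_finsetSum _ fun l _ => hYi l]
  exact Finset.sum_eq_zero fun l _ => setIntegral_cfd_eq_zero hU hK hKU (hY l) (hY0 l) _

end Analysis

end HermitianFlow

namespace HermitianFlow

open Complex Matrix MeasureTheory

/-! ### Smooth functions on M and partitions of unity. -/

section SmoothFunctions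

variable {n : ℕ} {M : Type*} [TopologicalSpace M] [ChartedSpace (Fin n → ℂ) M]

/-- A complex-valued function on `M` that is smooth in every holomorphic chart. -/
def IsSmoothFun (v : M → ℂ) : Prop :=
  ∀ e ∈ holAtlas n M, ContDiffOn ℝ ∞ (fun z => v (e.symm z)) e.target

variable [IsManifold 𝓘(ℂ, Fin n → ℂ) ω M]

lemma chartAt_mem_holAtlas (x : M) : chartAt (Fin n → ℂ) x ∈ holAtlas n M :=
  IsManifold.chart_mem_maximalAtlas x

lemma continuous_of_charts {F : M → ℂ}
    (hF : ∀ e ∈ holAtlas n M, ContinuousOn (fun z => F (e.symm z)) e.target) : Continuous F := by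
  rw [continuous_iff_continuousAt]
  intro x
  set e := chartAt (Fin n → ℂ) x
  have hx : x ∈ e.source := mem_chart_source _ x
  have h1 : ContinuousOn (fun y => F (e.symm (e y))) e.source :=
    (hF e (chartAt_mem_holAtlas x)).comp e.continuousOn fun y hy => e.map_source hy
  exact (h1.congr fun y hy => by rw [e.left_inv hy]).continuousAt (e.open_source.mem_nhds hx)

lemma IsSmoothFun.continuous {v : M → ℂ} (hv : IsSmoothFun (n := n) v) : Continuous v :=
  continuous_of_charts fun e he => (hv e he).continuousOn

variable (n M) in
-- The partition of unity is taken on M as a real smooth manifold, whose transition maps are the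
-- holomorphic ones with scalars restricted.
lemma isManifold_real : IsManifold 𝓘(ℝ, Fin n → ℂ) ∞ M :=
  isManifold_of_contDiffOn _ _ _ fun e e' he he' => by
    have h := contDiffOn_real_of_omega (contDiffOn_transition
      (IsManifold.subset_maximalAtlas (I := 𝓘(ℂ, Fin n → ℂ)) (n := ω) he)
      (IsManifold.subset_maximalAtlas (I := 𝓘(ℂ, Fin n → ℂ)) (n := ω) he'))
    simp only [modelWithCornersSelf_coe, modelWithCornersSelf_coe_symm, Set.preimage_id,
      Set.range_id, Set.inter_univ]
    exact h

/-- A finite smooth partition of unity subordinate to the coordinate charts. -/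
lemma exists_partition [T2Space M] [CompactSpace M] :
    ∃ (s : Finset M) (ρ : M → M → ℂ), (∀ x, ∑ i ∈ s, ρ i x = 1) ∧
      (∀ i, tsupport (ρ i) ⊆ (chartAt (Fin n → ℂ) i).source) ∧
      ∀ i, IsSmoothFun (n := n) (ρ i) := by
  have := isManifold_real n M
  obtain ⟨f, hf⟩ := SmoothPartitionOfUnity.exists_isSubordinate 𝓘(ℝ, Fin n → ℂ)
    (isClosed_univ (X := M)) (fun i : M => (chartAt (Fin n → ℂ) i).source)
    (fun i => (chartAt (Fin n → ℂ) i).open_source)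
    (fun x _ => Set.mem_iUnion.2 ⟨x, mem_chart_source _ x⟩)
  have hfin := f.locallyFinite.finite_nonempty_of_compact
  refine ⟨hfin.toFinset, fun i x => (f i x : ℂ), fun x => ?_, fun i => ?_, fun i e he => ?_⟩
  · have h1 := f.sum_eq_one (Set.mem_univ x)
    rw [finsum_eq_sum_of_support_subset (s := hfin.toFinset)] at h1
    · rw [← Complex.ofReal_sum, h1, Complex.ofReal_one]
    · intro i hi
      simp only [Set.Finite.coe_toFinset, Set.mem_ofPred_eq]
      exact ⟨x, hi⟩
  · refine subset_trans (closure_mono fun x hx => ?_) (hf i)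
    simpa using hx
  -- Smoothness is known in the preferred charts and is carried to an arbitrary holomorphic chart by
  -- the transition map.
  · intro z hz
    set e' := chartAt (Fin n → ℂ) (e.symm z)
    have he' : e' ∈ holAtlas n M := chartAt_mem_holAtlas _
    have hz' : z ∈ overlap e e' := mem_overlap.2 ⟨hz, mem_chart_source _ _⟩
    have h1 : ContDiffOn ℝ ∞ (fun w => f i (e'.symm w)) e'.target := by
      rw [← contMDiffOn_iff_contDiffOn]
      exact (f i).contMDiff.comp_contMDiffOn contMDiffOn_chart_symm
    have h2 : ContDiffOn ℝ ∞ (fun w => f i (e.symm w)) (overlap e e') :=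
      (h1.comp (contDiffOn_real_of_omega (contDiffOn_transition he he'))
        (mapsTo_transition e e')).congr fun w hw => by
          simp only [Function.comp_apply, symm_transition hw]
    have h3 : ContDiffAt ℝ ∞ (fun w => ((f i (e.symm w) : ℝ) : ℂ)) z :=
      Complex.ofRealCLM.contDiff.contDiffAt.comp z
        (h2.contDiffAt ((isOpen_overlap e e').mem_nhds hz'))
    exact h3.contDiffWithinAt

end SmoothFunctions

/-! ### The global Laplacian and the divergence theorem. -/

section Laplacian

variable {n : ℕ} {M : Type*} [TopologicalSpace M] [ChartedSpace (Fin n → ℂ) M]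
  {e : OpenPartialHomeomorph M (Fin n → ℂ)} {z : Fin n → ℂ}

lemma lapl_congr {X : Type*} [NormedAddCommGroup X] [NormedSpace ℝ X] {ζ : Fin n → X × X}
    {G : X → Matrix (Fin n) (Fin n) ℂ} {v w : X → ℂ} {x : X} (h : v =ᶠ[nhds x] w) :
    lapl ζ G v x = lapl ζ G w x := by
  simp only [lapl]
  refine Finset.sum_congr rfl fun l _ => Finset.sum_congr rfl fun m _ => ?_
  congr 1
  refine cfd_congr ?_
  filter_upwards [h.eventuallyEq_nhds] with y hy using cfd_congr hy

lemma contDiffOn_lapl {X : Type*} [NormedAddCommGroup X] [NormedSpace ℝ X] {ζ : Fin n → X × X}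
    {G : X → Matrix (Fin n) (Fin n) ℂ} {v : X → ℂ} {U : Set X} (hU : IsOpen U)
    (hG : SmoothMatOn G U) (h0 : ∀ y ∈ U, (G y).det ≠ 0) (hv : ContDiffOn ℝ ∞ v U) :
    ContDiffOn ℝ ∞ (lapl ζ G v) U :=
  ContDiffOn.sum fun l _ => ContDiffOn.sum fun m _ =>
    (hG.inv h0 m l).mul (contDiffOn_cfd hU (contDiffOn_cfd hU hv))

lemma lapl_sum {X : Type*} [NormedAddCommGroup X] [NormedSpace ℝ X] {ζ : Fin n → X × X}
    {G : X → Matrix (Fin n) (Fin n) ℂ} {ι : Type*} {s : Finset ι} {v : ι → X → ℂ} {U : Set X}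
    {x : X} (hU : IsOpen U) (hv : ∀ i ∈ s, ContDiffOn ℝ ∞ (v i) U) (hx : x ∈ U) :
    lapl ζ G (fun y => ∑ i ∈ s, v i y) x = ∑ i ∈ s, lapl ζ G (v i) x := by
  have key : ∀ l m, cfd (ζ l) (cfd (conjDir (ζ m)) fun y => ∑ i ∈ s, v i y) x =
      ∑ i ∈ s, cfd (ζ l) (cfd (conjDir (ζ m)) (v i)) x := by
    intro l m
    rw [← cfd_sum fun i hi =>
      differentiableAt_of_contDiffOn hU (contDiffOn_cfd hU (hv i hi)) hx]
    refine cfd_congr ?_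
    filter_upwards [hU.mem_nhds hx] with y hy
    exact cfd_sum fun i hi => differentiableAt_of_contDiffOn hU (hv i hi) hy
  simp only [lapl, key, Finset.mul_sum]
  rw [Finset.sum_comm (s := s)]
  exact Finset.sum_congr rfl fun l _ => Finset.sum_comm

lemma isCompact_image_tsupport [CompactSpace M] {i : M} {f : M → ℂ}
    (hf : tsupport f ⊆ (chartAt (Fin n → ℂ) i).source) :
    IsCompact ((chartAt (Fin n → ℂ) i) '' tsupport f) ∧
    (chartAt (Fin n → ℂ) i) '' tsupport f ⊆ (chartAt (Fin n → ℂ) i).target ∧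
    ∀ z ∈ (chartAt (Fin n → ℂ) i).target, z ∉ (chartAt (Fin n → ℂ) i) '' tsupport f →
      f ((chartAt (Fin n → ℂ) i).symm z) = 0 := by
  refine ⟨(isClosed_tsupport f).isCompact.image_of_continuousOn
    ((chartAt (Fin n → ℂ) i).continuousOn.mono hf), ?_, fun z hz hzK => ?_⟩
  · rintro _ ⟨x, hx, rfl⟩
    exact (chartAt (Fin n → ℂ) i).map_source (hf hx)
  · by_contra h
    exact hzK ⟨_, subset_tsupport f h, (chartAt (Fin n → ℂ) i).right_inv hz⟩

namespace HermitianMetric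

variable (g : HermitianMetric n M)

lemma torMat_eq_zero (hg : g.IsKahler) (he : e ∈ holAtlas n M) :
    ∀ y ∈ e.target, ∀ i, torMat hol (g.mat e) y i = 0 := fun y hy i => by
  ext j k
  rw [← torsion_eq, hg e he y hy]
  rfl

/-- The Laplacian `g^{l m̄} ∂_l ∂_m̄ v` of a function on `M`. -/
noncomputable def laplacian (v : M → ℂ) (x : M) : ℂ :=
  lapl hol (g.mat (chartAt (Fin n → ℂ) x)) (fun z => v ((chartAt (Fin n → ℂ) x).symm z))
    (chartAt (Fin n → ℂ) x x)

variable [IsManifold 𝓘(ℂ, Fin n → ℂ) ω M]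

lemma laplacian_apply {v : M → ℂ} (hv : IsSmoothFun (n := n) v) (he : e ∈ holAtlas n M)
    (hz : z ∈ e.target) :
    g.laplacian v (e.symm z) = lapl hol (g.mat e) (fun w => v (e.symm w)) z := by
  set e' := chartAt (Fin n → ℂ) (e.symm z)
  have hmem : e' ∈ holAtlas n M := chartAt_mem_holAtlas _
  have hz' : z ∈ overlap e e' := mem_overlap.2 ⟨hz, mem_chart_source _ _⟩
  change lapl hol (g.mat e') (fun w => v (e'.symm w)) (transition e e' z) = _
  rw [← lapl_change (isOpen_overlap e e') e'.open_target (contDiffOn_transition he hmem)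
    (mapsTo_transition e e') (fun w hw => isUnit_det_jac_transition he hmem hw)
    (g.mat_change he hmem) hz' (hv e' hmem)]
  refine lapl_congr ?_
  filter_upwards [(isOpen_overlap e e').mem_nhds hz'] with w hw
  rw [symm_transition hw]

lemma isSmoothFun_laplacian {v : M → ℂ} (hv : IsSmoothFun (n := n) v) :
    IsSmoothFun (n := n) (g.laplacian v) := fun e he =>
  (contDiffOn_lapl e.open_target (g.smoothMatOn_mat he) (fun _ hy => g.det_mat_ne_zero he hy)
    (hv e he)).congr fun _ hz => g.laplacian_apply hv he hz

variable [T2Space M] [CompactSpace M] [MeasurableSpace M] [BorelSpace M]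

/-- The divergence theorem for the Laplacian of a Kähler metric. -/
lemma integral_laplacian (hg : g.IsKahler) [IsFiniteMeasure g.vol] {v : M → ℂ}
    (hv : IsSmoothFun (n := n) v) : ∫ x, g.laplacian v x ∂g.vol = 0 := by
  obtain ⟨s, ρ, hsum, hsupp, hsm⟩ := exists_partition (n := n) (M := M)
  have hvi : ∀ i, IsSmoothFun (n := n) fun x => ρ i x * v x := fun i e he =>
    (hsm i e he).mul (hv e he)
  -- Cutting v, rather than Δv, with the partition makes each summand the Laplacian of a function
  -- with compact support in one chart.
  have h1 : ∀ x, g.laplacian v x = ∑ i ∈ s, g.laplacian (fun x => ρ i x * v x) x := by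
    intro x
    have hx := mem_chart_source (Fin n → ℂ) x
    set e := chartAt (Fin n → ℂ) x
    have he : e ∈ holAtlas n M := chartAt_mem_holAtlas _
    have hz := e.map_source hx
    rw [← e.left_inv hx, g.laplacian_apply hv he hz]
    simp only [fun i => g.laplacian_apply (hvi i) he hz]
    rw [← lapl_sum e.open_target (fun i _ => hvi i e he) hz]
    simp only [← Finset.sum_mul, hsum, one_mul]
  simp only [h1]
  rw [integral_finsetSum]
  · refine Finset.sum_eq_zero fun i _ => ?_
    set e := chartAt (Fin n → ℂ) i
    have he : e ∈ holAtlas n M := chartAt_mem_holAtlas _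
    have hsup : tsupport (fun x => ρ i x * v x) ⊆ e.source :=
      (tsupport_mul_subset_left).trans (hsupp i)
    obtain ⟨hK, hKU, hK0⟩ := isCompact_image_tsupport hsup
    rw [g.integral_vol_eq he (g.isSmoothFun_laplacian (hvi i)).continuous.continuousOn]
    · rw [← setIntegral_det_mul_lapl e.open_target hK hKU (g.smoothMatOn_mat he)
        (fun y hy => g.det_mat_ne_zero he hy) (g.torMat_eq_zero hg he) (hvi i e he) hK0]
      exact setIntegral_congr_fun e.open_target.measurableSet fun z hz => by
        simp only [g.laplacian_apply (hvi i) he hz]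
    -- At x the Laplacian is computed in the chart at x, not in `e`. It depends only on the germ of
    -- the function, which is zero off the support.
    · intro x hx
      have hx' : (fun x => ρ i x * v x) =ᶠ[nhds x] 0 :=
        notMem_tsupport_iff_eventuallyEq.1 fun h => hx (hsup h)
      have hxs := mem_chart_source (Fin n → ℂ) x
      set e' := chartAt (Fin n → ℂ) x with he'
      have hz := e'.map_source hxs
      rw [laplacian, ← he', lapl_congr (w := fun _ => 0)]
      · have h0 : ∀ m : Fin n, cfd (conjDir (hol m)) (fun _ => 0) = fun _ => 0 := fun m =>
          funext fun y => cfd_const 0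
        simp [lapl, h0]
      · have hc : Filter.Tendsto e'.symm (nhds (e' x)) (nhds x) := by
          have := e'.continuousAt_symm hz
          rwa [ContinuousAt, e'.left_inv hxs] at this
        exact hc.eventually hx'
  · intro i _
    have hc := (g.isSmoothFun_laplacian (hvi i)).continuous
    exact hc.integrable_of_hasCompactSupport (HasCompactSupport.of_compactSpace _)

end HermitianMetric

end Laplacian

end HermitianFlow

namespace HermitianFlow

open Complex Matrix MeasureTheory

/-! ### Smooth families of metrics and derivatives of their integrals. -/

section FamilyDomain

variable {n : ℕ} {M : Type*} [TopologicalSpace M]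
  {e : OpenPartialHomeomorph M (Fin n → ℂ)} {z : Fin n → ℂ} {ε : ℝ}

/-- The domain of a chart, times the parameter interval. -/
def famDomain (ε : ℝ) (e : OpenPartialHomeomorph M (Fin n → ℂ)) : Set (ℝ × (Fin n → ℂ)) :=
  Set.Ioo (-ε) ε ×ˢ e.target

lemma isOpen_famDomain (ε : ℝ) (e : OpenPartialHomeomorph M (Fin n → ℂ)) :
    IsOpen (famDomain ε e) := isOpen_Ioo.prod e.open_target

lemma zero_mem_famDomain (hε : 0 < ε) (hz : z ∈ e.target) : ((0 : ℝ), z) ∈ famDomain ε e :=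
  ⟨⟨by linarith, hε⟩, hz⟩

end FamilyDomain

section Family

variable {n : ℕ} {M : Type*} [TopologicalSpace M] [ChartedSpace (Fin n → ℂ) M]
  {e e' : OpenPartialHomeomorph M (Fin n → ℂ)} {z : Fin n → ℂ}
  {g : ℝ → HermitianMetric n M} {ε : ℝ}

/-- The coefficients of a family of metrics, as a function of the parameter and the point. -/
noncomputable def famMat (g : ℝ → HermitianMetric n M) (e : OpenPartialHomeomorph M (Fin n → ℂ))
    (p : ℝ × (Fin n → ℂ)) : Matrix (Fin n) (Fin n) ℂ := (g p.1).mat e p.2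

/-- The coordinate directions in `ℝ × ℂⁿ`. -/
noncomputable def holSlice (i : Fin n) :
    (ℝ × (Fin n → ℂ)) × (ℝ × (Fin n → ℂ)) := sliceDir (hol i)

lemma SmoothFamily.smoothMatOn (hg : SmoothFamily g ε) (he : e ∈ holAtlas n M) :
    SmoothMatOn (famMat g e) (famDomain ε e) := hg e he

lemma det_famMat_ne_zero (he : e ∈ holAtlas n M) :
    ∀ p ∈ famDomain ε e, (famMat g e p).det ≠ 0 := fun p hp =>
  (g p.1).det_mat_ne_zero he hp.2

variable [IsManifold 𝓘(ℂ, Fin n → ℂ) ω M] [CompactSpace M] [MeasurableSpace M]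
  [BorelSpace M]

/-- The partition does not involve the metric, so the integrals for all parameters become sums over
the same fixed chart domains, with the metric only in the integrand. -/
lemma integral_vol_eq_sum (g : HermitianMetric n M) [IsFiniteMeasure g.vol] {s : Finset M}
    {ρ : M → M → ℂ} (hsum : ∀ x, ∑ i ∈ s, ρ i x = 1)
    (hsupp : ∀ i, tsupport (ρ i) ⊆ (chartAt (Fin n → ℂ) i).source)
    (hsm : ∀ i, IsSmoothFun (n := n) (ρ i)) {F : M → ℂ} (hF : Continuous F) :
    ∫ x, F x ∂g.vol = ∑ i ∈ s, ∫ z in (chartAt (Fin n → ℂ) i).target,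
      ρ i ((chartAt (Fin n → ℂ) i).symm z) * ((g.mat (chartAt (Fin n → ℂ) i) z).det *
        F ((chartAt (Fin n → ℂ) i).symm z)) := by
  have hc : ∀ i, Continuous fun x => ρ i x * F x := fun i => (hsm i).continuous.mul hF
  have h1 : ∀ x, F x = ∑ i ∈ s, ρ i x * F x := fun x => by rw [← Finset.sum_mul, hsum, one_mul]
  rw [integral_congr_ae (Filter.Eventually.of_forall h1), integral_finsetSum]
  · refine Finset.sum_congr rfl fun i _ => ?_
    rw [g.integral_vol_eq (chartAt_mem_holAtlas i) (hc i).continuousOn]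
    · exact integral_congr_ae (Filter.Eventually.of_forall fun z => by ring)
    · intro x hx
      rw [image_eq_zero_of_notMem_tsupport fun h => hx (hsupp i h), zero_mul]
  · exact fun i _ => (hc i).integrable_of_hasCompactSupport (HasCompactSupport.of_compactSpace _)

/-- Differentiation of the integral over `M` of a smooth family of functions with respect to the
volumes of a smooth family of metrics. -/
lemma hasDerivAt_integral_vol [T2Space M] (hε : 0 < ε) (hg : SmoothFamily g ε)
    (hvol : ∀ a ∈ Set.Ioo (-ε) ε, IsFiniteMeasure (g a).vol) {F : ℝ → M → ℂ}
    {Φ : OpenPartialHomeomorph M (Fin n → ℂ) → ℝ × (Fin n → ℂ) → ℂ}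
    (hΦ : ∀ e ∈ holAtlas n M, ContDiffOn ℝ ∞ (Φ e) (famDomain ε e))
    (hF : ∀ e ∈ holAtlas n M, ∀ a ∈ Set.Ioo (-ε) ε, ∀ z ∈ e.target, F a (e.symm z) = Φ e (a, z))
    {D : M → ℂ} (hD : ∀ e ∈ holAtlas n M, ∀ z ∈ e.target,
      cfd (paramDir _) (fun p => (famMat g e p).det * Φ e p) (0, z) =
        ((g 0).mat e z).det * D (e.symm z)) :
    HasDerivAt (fun a => ∫ x, F a x ∂(g a).vol) (∫ x, D x ∂(g 0).vol) 0 := by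
  have h0 : (0 : ℝ) ∈ Set.Ioo (-ε) ε := ⟨by linarith, hε⟩
  obtain ⟨s, ρ, hsum, hsupp, hsm⟩ := exists_partition (n := n) (M := M)
  have hΨ : ∀ e ∈ holAtlas n M,
      ContDiffOn ℝ ∞ (fun p => (famMat g e p).det * Φ e p) (famDomain ε e) := fun e he =>
    (hg.smoothMatOn he).det.mul (hΦ e he)
  have hFc : ∀ a ∈ Set.Ioo (-ε) ε, Continuous (F a) := fun a ha =>
    continuous_of_charts (n := n) fun e he =>
      ((hΦ e he).continuousOn.comp (by fun_prop) fun z hz => ⟨ha, hz⟩ :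
        ContinuousOn (fun z => Φ e (a, z)) e.target).congr fun z hz => hF e he a ha z hz
  -- Continuity of D is not assumed: in a chart it is a smooth expression divided by the
  -- nonvanishing determinant.
  have hDc : Continuous D := continuous_of_charts (n := n) fun e he => by
    have h1 : ContinuousOn (fun z => cfd (paramDir _) (fun p => (famMat g e p).det * Φ e p)
        ((0 : ℝ), z)) e.target :=
      (contDiffOn_cfd (isOpen_famDomain ε e) (hΨ e he)).continuousOn.comp (by fun_prop)
        fun z hz => ⟨h0, hz⟩
    refine (h1.div ((g 0).smoothMatOn_mat he).det.continuousOn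
      fun z hz => (g 0).det_mat_ne_zero he hz).congr fun z hz => ?_
    rw [Pi.div_apply, hD e he z hz, mul_div_cancel_left₀ _ ((g 0).det_mat_ne_zero he hz)]
  have := hvol 0 h0
  rw [integral_vol_eq_sum (g 0) hsum hsupp hsm hDc]
  have key : HasDerivAt (fun a => ∑ i ∈ s, ∫ z in (chartAt (Fin n → ℂ) i).target,
      ρ i ((chartAt (Fin n → ℂ) i).symm z) * ((famMat g (chartAt (Fin n → ℂ) i) (a, z)).det *
        Φ (chartAt (Fin n → ℂ) i) (a, z)))
      (∑ i ∈ s, ∫ z in (chartAt (Fin n → ℂ) i).target,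
        ρ i ((chartAt (Fin n → ℂ) i).symm z) * (((g 0).mat (chartAt (Fin n → ℂ) i) z).det *
          D ((chartAt (Fin n → ℂ) i).symm z))) 0 := by
    refine HasDerivAt.fun_sum fun i _ => ?_
    set e := chartAt (Fin n → ℂ) i
    have he : e ∈ holAtlas n M := chartAt_mem_holAtlas i
    obtain ⟨hK, hKU, hK0⟩ := isCompact_image_tsupport (hsupp i)
    have h := hasDerivAt_integral_mul hε e.open_target hK hKU (hsm i e he).continuousOn hK0
      (hΨ e he)
    have heq := setIntegral_congr_fun (μ := volume) e.open_target.measurableSet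
      fun z hz => congrArg (fun t => ρ i (e.symm z) * t) (hD e he z hz)
    rwa [heq] at h
  refine key.congr_of_eventuallyEq ?_
  filter_upwards [Ioo_mem_nhds h0.1 h0.2] with a ha
  have := hvol a ha
  rw [integral_vol_eq_sum (g a) hsum hsupp hsm (hFc a ha)]
  refine Finset.sum_congr rfl fun i _ => ?_
  refine setIntegral_congr_fun (chartAt (Fin n → ℂ) i).open_target.measurableSet fun z hz => ?_
  simp only [hF _ (chartAt_mem_holAtlas i) a ha z hz, famMat]

end Family

/-! ### The variation h as a tensor, and its trace. -/

section Derivative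

variable {n : ℕ} {M : Type*} [TopologicalSpace M] [ChartedSpace (Fin n → ℂ) M]
  {e e' : OpenPartialHomeomorph M (Fin n → ℂ)} {z : Fin n → ℂ}
  {g : ℝ → HermitianMetric n M} {ε : ℝ}
  {h : ∀ x : M, LinearMap.BilinForm ℝ (Tan (n := n) x)}

lemma hasDerivAt_mat (hderiv : ∀ x u v, HasDerivAt (fun a => (g a).form x u v) (h x u v) 0)
    (e : OpenPartialHomeomorph M (Fin n → ℂ)) (z : Fin n → ℂ) (i j : Fin n) :
    HasDerivAt (fun a => (g a).mat e z i j) (coeff h e z i j) 0 :=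
  (hderiv _ _ _).ofReal_comp.add ((hderiv _ _ _).ofReal_comp.const_mul I)

/-- The variation inherits J-invariance, which `coeff_change` requires in order to change charts for
h. -/
lemma compat_of_hasDerivAt
    (hderiv : ∀ x u v, HasDerivAt (fun a => (g a).form x u v) (h x u v) 0) (x : M)
    (u v : Tan (n := n) x) : h x (I • u) (I • v) = h x u v := by
  have h1 := hderiv x (I • u) (I • v)
  have h2 : (fun a => (g a).form x (I • u) (I • v)) = fun a => (g a).form x u v :=
    funext fun a => (g a).compat x u v
  rw [h2] at h1
  exact h1.unique (hderiv x u v)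

/-- Since h is given only by pointwise derivatives, its smoothness comes from this identification
with a derivative of the jointly smooth family. -/
lemma coeff_eq_cfdM (hε : 0 < ε) (hg : SmoothFamily g ε)
    (hderiv : ∀ x u v, HasDerivAt (fun a => (g a).form x u v) (h x u v) 0)
    (he : e ∈ holAtlas n M) (hz : z ∈ e.target) :
    coeff h e z = cfdM (paramDir _) (famMat g e) (0, z) := by
  ext i j
  exact (hasDerivAt_mat hderiv e z i j).unique (hasDerivAt_cfd_paramDir
    ((hg.smoothMatOn he).diffMatAt (isOpen_famDomain ε e) (zero_mem_famDomain hε hz) i j))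

/-- The trace `tr_g h` as a function on `M`. -/
noncomputable def traceForm (g : HermitianMetric n M)
    (h : ∀ x : M, LinearMap.BilinForm ℝ (Tan (n := n) x)) (x : M) : ℂ :=
  ((g.mat (chartAt (Fin n → ℂ) x) (chartAt (Fin n → ℂ) x x))⁻¹ *
    coeff h (chartAt (Fin n → ℂ) x) (chartAt (Fin n → ℂ) x x)).trace

variable [IsManifold 𝓘(ℂ, Fin n → ℂ) ω M]

lemma traceForm_apply (g : HermitianMetric n M) (hc : ∀ x u v, h x (I • u) (I • v) = h x u v)
    (he : e ∈ holAtlas n M) (hz : z ∈ e.target) :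
    traceForm g h (e.symm z) = ((g.mat e z)⁻¹ * coeff h e z).trace := by
  set e' := chartAt (Fin n → ℂ) (e.symm z)
  have hmem : e' ∈ holAtlas n M := chartAt_mem_holAtlas _
  have hz' : z ∈ overlap e e' := mem_overlap.2 ⟨hz, mem_chart_source _ _⟩
  change ((g.mat e' (transition e e' z))⁻¹ * coeff h e' (transition e e' z)).trace = _
  have hu := isUnit_iff_ne_zero.2 (isUnit_det_jac_transition he hmem hz')
  have hu' : IsUnit ((jac (transition e e') z)ᴴ).det := by
    rw [Matrix.det_conjTranspose]; exact hu.star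
  rw [g.mat_change he hmem z hz', coeff_change hc he hmem hz', inv_change]
  simp only [mul_assoc]
  rw [← mul_assoc ((jac (transition e e') z)⁻¹), Matrix.nonsing_inv_mul _ hu, one_mul,
    Matrix.trace_mul_comm ((jac (transition e e') z)ᴴ)⁻¹]
  simp only [mul_assoc, Matrix.mul_nonsing_inv _ hu', mul_one]

lemma isSmoothFun_traceForm (hε : 0 < ε) (hg : SmoothFamily g ε)
    (hderiv : ∀ x u v, HasDerivAt (fun a => (g a).form x u v) (h x u v) 0) :
    IsSmoothFun (n := n) (traceForm (g 0) h) := fun e he => by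
  have hV := isOpen_famDomain ε e
  have hH : SmoothMatOn (fun z => cfdM (paramDir _) (famMat g e) (0, z)) e.target := fun j k =>
    (contDiffOn_slice ((hg.smoothMatOn he).cfdM hV j k) 0).mono
      fun z hz => zero_mem_famDomain hε hz
  refine ContDiffOn.congr ((((g 0).smoothMatOn_mat he).inv
    fun y hy => (g 0).det_mat_ne_zero he hy).mul hH).trace fun z hz => ?_
  rw [traceForm_apply (g 0) (compat_of_hasDerivAt hderiv) he hz,
    coeff_eq_cfdM hε hg hderiv he hz]

end Derivative

end HermitianFlow

namespace HermitianFlow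

open Complex Matrix MeasureTheory

/-! ### Stationarity of the normalising integral at a Kähler–Einstein metric. -/

section KahlerEinstein

variable {n : ℕ} {M : Type*} [TopologicalSpace M] [ChartedSpace (Fin n → ℂ) M]
  {e : OpenPartialHomeomorph M (Fin n → ℂ)} {z : Fin n → ℂ}
  {g : ℝ → HermitianMetric n M} {ε : ℝ} {c : ℂ}
  {h : ∀ x : M, LinearMap.BilinForm ℝ (Tan (n := n) x)}

lemma sMat_eq_smul {g : HermitianMetric n M} (hS : ∀ e ∈ holAtlas n M, ∀ z ∈ e.target, ∀ j k,
      chernS (g.mat e) z j k = c * g.mat e z j k) (he : e ∈ holAtlas n M) (hz : z ∈ e.target) :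
    sMat hol (g.mat e) z = c • g.mat e z := by
  ext j k
  rw [← chernS_eq e.open_target (g.smoothMatOn_mat he) (fun y hy => g.det_mat_ne_zero he hy) hz,
    hS e he z hz]
  rfl

lemma scalSQ_of_kahlerEinstein {g : HermitianMetric n M} (hK : g.IsKahler)
    (hS : ∀ e ∈ holAtlas n M, ∀ z ∈ e.target, ∀ j k,
      chernS (g.mat e) z j k = c * g.mat e z j k) (he : e ∈ holAtlas n M) (hz : z ∈ e.target) :
    scalSQ hol (g.mat e) z = n * c := by
  have hT := g.torMat_eq_zero hK he z hz
  rw [scalSQ, sMat_eq_smul hS he hz, Matrix.mul_smul,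
    Matrix.nonsing_inv_mul _ (isUnit_iff_ne_zero.2 (g.det_mat_ne_zero he hz))]
  simp [qForm, hT, mul_comm]

lemma curvMat_slice_famMat (hε : 0 < ε) (hg : SmoothFamily g ε) (he : e ∈ holAtlas n M)
    (hz : z ∈ e.target) (l m : Fin n) :
    curvMat (hol l) (conjDir (hol m)) ((g 0).mat e) z =
      curvMat (holSlice l) (conjDir (holSlice m)) (famMat g e) (0, z) := by
  have h1 := curvMat_slice (ξ := hol l) (η := conjDir (hol m)) (isOpen_famDomain ε e)
    (hg.smoothMatOn he) (a := 0) (x := z) (zero_mem_famDomain hε hz)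
  rw [holSlice, holSlice, conjDir_sliceDir]
  exact h1

/-- The first variation of the trace of `S - Q` at a Kähler–Einstein metric, in a chart. -/
lemma cfd_scalSQ_family (hε : 0 < ε) (hg : SmoothFamily g ε)
    (hderiv : ∀ x u v, HasDerivAt (fun a => (g a).form x u v) (h x u v) 0)
    [IsManifold 𝓘(ℂ, Fin n → ℂ) ω M] (hK : (g 0).IsKahler)
    (hS : ∀ e ∈ holAtlas n M, ∀ z ∈ e.target, ∀ j k,
      chernS ((g 0).mat e) z j k = c * (g 0).mat e z j k)
    (he : e ∈ holAtlas n M) (hz : z ∈ e.target) :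
    cfd (paramDir _) (scalSQ holSlice (famMat g e)) (0, z) =
      -(g 0).laplacian (traceForm (g 0) h) (e.symm z) - c * traceForm (g 0) h (e.symm z) := by
  have hV := isOpen_famDomain ε e
  have hF := hg.smoothMatOn he
  have h0 := det_famMat_ne_zero (ε := ε) (g := g) he
  have hx := zero_mem_famDomain hε hz
  have hG := (g 0).smoothMatOn_mat he
  have hG0 : ∀ y ∈ e.target, ((g 0).mat e y).det ≠ 0 := fun y hy => (g 0).det_mat_ne_zero he hy
  have hGh : ∀ y ∈ e.target, ((g 0).mat e y).IsHermitian := fun y hy =>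
    (g 0).isHermitian_mat he hy
  have hT : ∀ i, torMat holSlice (famMat g e) (0, z) i = 0 := fun i =>
    (congrFun (torMat_slice (ζ := hol) hV hF hx) i).symm.trans ((g 0).torMat_eq_zero hK he z hz i)
  have hS' : sMat holSlice (famMat g e) (0, z) = c • famMat g e (0, z) :=
    (sMat_slice (ζ := hol) hV hF hx).symm.trans (sMat_eq_smul hS he hz)
  have hcurv : ∀ l m, curvMat (holSlice l) (conjDir (holSlice m)) (famMat g e) (0, z) =
      curvMat (hol l) (conjDir (hol m)) ((g 0).mat e) z := fun l m =>
    (curvMat_slice_famMat hε hg he hz l m).symm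
  -- The pair symmetry needs vanishing torsion on an open set, so it is proved on the slice a = 0 as
  -- a domain in ℂⁿ and then transferred to ℝ × ℂⁿ.
  rw [cfd_scalSQ hV hF h0 hx hT hS' fun l m j k => by
    rw [hcurv, hcurv, curvMat_symm e.open_target hG hG0 hGh ((g 0).torMat_eq_zero hK he) hz]]
  have hu : ∀ w ∈ e.target, traceForm (g 0) h (e.symm w) =
      ((famMat g e (0, w))⁻¹ * cfdM (paramDir _) (famMat g e) (0, w)).trace := fun w hw => by
    rw [traceForm_apply (g 0) (compat_of_hasDerivAt hderiv) he hw,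
      coeff_eq_cfdM hε hg hderiv he hw]
    rfl
  have hl : lapl holSlice (famMat g e)
      (fun y => ((famMat g e y)⁻¹ * cfdM (paramDir _) (famMat g e) y).trace) (0, z) =
      (g 0).laplacian (traceForm (g 0) h) (e.symm z) := by
    rw [(g 0).laplacian_apply (isSmoothFun_traceForm hε hg hderiv) he hz]
    refine (lapl_slice (ζ := hol) (F := famMat g e) hV
      ((hF.inv h0).mul (hF.cfdM hV)).trace hx).symm.trans (lapl_congr ?_)
    filter_upwards [e.open_target.mem_nhds hz] with w hw using (hu w hw).symm
  rw [hl, hu z hz]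

lemma scalSQ_slice_famMat (hg : SmoothFamily g ε) {a : ℝ} (he : e ∈ holAtlas n M)
    (ha : a ∈ Set.Ioo (-ε) ε) (hz : z ∈ e.target) :
    scalSQ hol ((g a).mat e) z = scalSQ holSlice (famMat g e) (a, z) := by
  have h1 := scalSQ_slice (ζ := hol) (isOpen_famDomain ε e) (hg.smoothMatOn he)
    (a := a) (x := z) ⟨ha, hz⟩
  exact h1

lemma torMat_slice_famMat (hg : SmoothFamily g ε) {a : ℝ} (he : e ∈ holAtlas n M)
    (ha : a ∈ Set.Ioo (-ε) ε) (hz : z ∈ e.target) :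
    torMat hol ((g a).mat e) z = torMat holSlice (famMat g e) (a, z) := by
  have h1 := torMat_slice (ζ := hol) (isOpen_famDomain ε e) (hg.smoothMatOn he)
    (a := a) (x := z) ⟨ha, hz⟩
  exact h1

lemma cov2Mat_congr {X : Type*} [NormedAddCommGroup X] [NormedSpace ℝ X] {ζ η : X × X}
    {G H H' : X → Matrix (Fin n) (Fin n) ℂ} {U : Set X} {x : X} (hU : IsOpen U) (hx : x ∈ U)
    (hH : ∀ y ∈ U, H y = H' y) : cov2Mat ζ η G H x = cov2Mat ζ η G H' x := by
  have h1 : ∀ y ∈ U, covMat η G H y = covMat η G H' y := fun y hy => by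
    rw [covMat, covMat, hH y hy, cfdM_congr (H := H')]
    filter_upwards [hU.mem_nhds hy] with w hw using hH w hw
  rw [cov2Mat, cov2Mat, h1 x hx, cfdM_congr (H := covMat η G H')]
  filter_upwards [hU.mem_nhds hx] with y hy using h1 y hy

/-- The first variation of the determinant of the metric. -/
lemma cfd_det_family (hε : 0 < ε) (hg : SmoothFamily g ε)
    (hderiv : ∀ x u v, HasDerivAt (fun a => (g a).form x u v) (h x u v) 0)
    [IsManifold 𝓘(ℂ, Fin n → ℂ) ω M] (he : e ∈ holAtlas n M) (hz : z ∈ e.target) :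
    cfd (paramDir _) (fun p => (famMat g e p).det) (0, z) =
      ((g 0).mat e z).det * traceForm (g 0) h (e.symm z) := by
  have hx := zero_mem_famDomain hε hz
  rw [cfd_det ((hg.smoothMatOn he).diffMatAt (isOpen_famDomain ε e) hx)
    (det_famMat_ne_zero he _ hx), traceForm_apply (g 0) (compat_of_hasDerivAt hderiv) he hz,
    coeff_eq_cfdM hε hg hderiv he hz]
  rfl

/-- At a Kähler–Einstein metric the integral of the trace of `S - Q` is stationary under
variations of constant volume. -/
lemma hasDerivAt_integral_traceSQ [IsManifold 𝓘(ℂ, Fin n → ℂ) ω M] [T2Space M] [CompactSpace M]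
    [MeasurableSpace M] [BorelSpace M] (hε : 0 < ε) (hg : SmoothFamily g ε)
    (hvol : ∀ a ∈ Set.Ioo (-ε) ε, (g a).vol Set.univ = 1)
    (hderiv : ∀ x u v, HasDerivAt (fun a => (g a).form x u v) (h x u v) 0)
    (hK : (g 0).IsKahler)
    (hS : ∀ e ∈ holAtlas n M, ∀ z ∈ e.target, ∀ j k,
      chernS ((g 0).mat e) z j k = c * (g 0).mat e z j k) :
    HasDerivAt (fun a => ∫ x, (g a).traceSQ x ∂(g a).vol) 0 0 := by
  have h0 : (0 : ℝ) ∈ Set.Ioo (-ε) ε := ⟨by linarith, hε⟩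
  have hfin : ∀ a ∈ Set.Ioo (-ε) ε, IsFiniteMeasure (g a).vol := fun a ha =>
    ⟨by rw [hvol a ha]; exact ENNReal.one_lt_top⟩
  have hfin0 := hfin 0 h0
  set u : M → ℂ := traceForm (g 0) h with hu
  have hus : IsSmoothFun (n := n) u := isSmoothFun_traceForm hε hg hderiv
  have hint : ∀ {v : M → ℂ}, Continuous v → Integrable v (g 0).vol := fun hv =>
    hv.integrable_of_hasCompactSupport (HasCompactSupport.of_compactSpace _)
  -- The derivative of the volume, as the case F = 1; constancy of the volume then gives ∫ tr h = 0.
  have hV : HasDerivAt (fun a => ∫ _, (1 : ℂ) ∂(g a).vol) (∫ x, u x ∂(g 0).vol) 0 :=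
    hasDerivAt_integral_vol hε hg hfin (F := fun _ _ => 1) (Φ := fun _ _ => 1)
      (fun e he => contDiffOn_const) (fun e he a ha z hz => rfl) fun e he z hz => by
        simp only [mul_one]
        exact cfd_det_family hε hg hderiv he hz
  have hu0 : ∫ x, u x ∂(g 0).vol = 0 := by
    refine hV.unique ((hasDerivAt_const (0 : ℝ) (1 : ℂ)).congr_of_eventuallyEq ?_)
    filter_upwards [Ioo_mem_nhds h0.1 h0.2] with a ha
    simp [Measure.real, hvol a ha]
  -- In the integrand, nc tr h comes from the volume form, and -c tr h - Δ tr h from the variation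
  -- of tr(S - Q).
  have hmain : HasDerivAt (fun a => ∫ x, (g a).traceSQ x ∂(g a).vol)
      (∫ x, ((n * c - c) * u x - (g 0).laplacian u x) ∂(g 0).vol) 0 := by
    refine hasDerivAt_integral_vol hε hg hfin
      (Φ := fun e => scalSQ holSlice (famMat g e))
      (fun e he => contDiffOn_scalSQ (isOpen_famDomain ε e) (hg.smoothMatOn he)
        (det_famMat_ne_zero he)) (fun e he a ha z hz => ?_) fun e he z hz => ?_
    · rw [(g a).traceSQ_apply he hz]
      exact scalSQ_slice_famMat hg he ha hz
    · have hx := zero_mem_famDomain hε hz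
      have hO := isOpen_famDomain ε e
      have hF := hg.smoothMatOn he
      rw [cfd_mul (differentiableAt_of_contDiffOn hO hF.det hx)
        (differentiableAt_of_contDiffOn hO (contDiffOn_scalSQ hO hF (det_famMat_ne_zero he)) hx),
        cfd_det_family hε hg hderiv he hz, cfd_scalSQ_family hε hg hderiv hK hS he hz]
      have hsc : scalSQ holSlice (famMat g e) (0, z) = n * c :=
        (scalSQ_slice_famMat hg he h0 hz).symm.trans (scalSQ_of_kahlerEinstein hK hS he hz)
      rw [hsc, hu]
      simp only [famMat]
      ring
  have hz : ∫ x, ((n * c - c) * u x - (g 0).laplacian u x) ∂(g 0).vol = 0 := by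
    rw [integral_sub ((hint hus.continuous).const_mul _)
      (hint ((g 0).isSmoothFun_laplacian hus).continuous), integral_const_mul, hu0,
      (g 0).integral_laplacian hK hus]
    ring
  rwa [hz] at hmain

end KahlerEinstein

end HermitianFlow

/-! ### Assembly of the variation formula. -/

open HermitianFlow in
theorem mainTheorem9 {n : ℕ} {M : Type*} [TopologicalSpace M] [T2Space M] [CompactSpace M]
    [ChartedSpace (Fin n → ℂ) M] [IsManifold 𝓘(ℂ, Fin n → ℂ) ω M]
    [MeasurableSpace M] [BorelSpace M]
    (ε : ℝ) (hε : 0 < ε)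
    (g : ℝ → HermitianFlow.HermitianMetric n M)
    (hsmooth : HermitianFlow.SmoothFamily g ε)
    (hvol : ∀ a ∈ Set.Ioo (-ε) ε, (g a).vol Set.univ = 1)
    (h : ∀ x : M, LinearMap.BilinForm ℝ (TangentSpace 𝓘(ℂ, Fin n → ℂ) x))
    (hderiv : ∀ x u v, HasDerivAt (fun a => (g a).form x u v) (h x u v) 0)
    (hKE : (g 0).IsKahlerEinstein) :
    ∀ e ∈ IsManifold.maximalAtlas 𝓘(ℂ, Fin n → ℂ) ω M, ∀ z ∈ e.target, ∀ k l : Fin n,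
      HasDerivAt (fun a => (g a).opF e z k l)
        (HermitianFlow.roughLaplacian ((g 0).mat e) (HermitianFlow.coeff h e) z k l
          - HermitianFlow.curvAction ((g 0).mat e) (HermitianFlow.coeff h e) z k l) 0 := by
  intro e he z hz k l
  obtain ⟨hK, c, hS⟩ := hKE
  have h0 : (0 : ℝ) ∈ Set.Ioo (-ε) ε := ⟨by linarith, hε⟩
  have hV := isOpen_famDomain ε e
  have hF := hsmooth.smoothMatOn he
  have hF0 := det_famMat_ne_zero (ε := ε) (g := g) he
  have hx := zero_mem_famDomain hε hz
  have hG := (g 0).smoothMatOn_mat he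
  have hG0 : ∀ y ∈ e.target, ((g 0).mat e y).det ≠ 0 := fun y hy => (g 0).det_mat_ne_zero he hy
  have hGh : ∀ y ∈ e.target, ((g 0).mat e y).IsHermitian := fun y hy =>
    (g 0).isHermitian_mat he hy
  have hH : ∀ y ∈ e.target,
      HermitianFlow.coeff h e y = cfdM (paramDir _) (famMat g e) (0, y) := fun y hy =>
    coeff_eq_cfdM hε hsmooth hderiv he hy
  -- The index k exists, so n is positive and the factor 1/n is genuine.
  have hn : (n : ℂ) ≠ 0 := Nat.cast_ne_zero.2 (Fin.pos k).ne'
  have hint := hasDerivAt_integral_traceSQ hε hsmooth hvol hderiv hK hS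
  have hint0 : ∫ x, (g 0).traceSQ x ∂(g 0).vol = n * c := by
    have e1 : ∀ x, (g 0).traceSQ x = n * c := fun x => by
      have hxs := mem_chart_source (Fin n → ℂ) x
      rw [← (chartAt (Fin n → ℂ) x).left_inv hxs,
        (g 0).traceSQ_apply (chartAt_mem_holAtlas x) ((chartAt (Fin n → ℂ) x).map_source hxs),
        scalSQ_of_kahlerEinstein hK hS (chartAt_mem_holAtlas x)
          ((chartAt (Fin n → ℂ) x).map_source hxs)]
    simp [e1, MeasureTheory.Measure.real, hvol 0 h0]
  have hSd : HasDerivAt (fun a => chernS ((g a).mat e) z k l)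
      (cfdM (paramDir _) (sMat holSlice (famMat g e)) (0, z) k l) 0 := by
    refine (hasDerivAt_cfd_paramDir (f := fun p => sMat holSlice (famMat g e) p k l)
      ((smoothMatOn_sMat hV hF hF0).diffMatAt hV hx k l)).congr_of_eventuallyEq ?_
    filter_upwards [Ioo_mem_nhds h0.1 h0.2] with a ha
    rw [chernS_eq e.open_target ((g a).smoothMatOn_mat he)
      (fun y hy => (g a).det_mat_ne_zero he hy) hz]
    exact congrFun (congrFun (sMat_slice (ζ := hol) hV hF ⟨ha, hz⟩) k) l
  -- Q is quadratic in the torsion, which vanishes at a = 0.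
  have hQd : HasDerivAt (fun a => torsionQ ((g a).mat e) z k l) 0 0 := by
    have hT : ∀ i, torMat holSlice (famMat g e) (0, z) i = 0 := fun i =>
      (congrFun (torMat_slice (ζ := hol) hV hF hx) i).symm.trans
        ((g 0).torMat_eq_zero hK he z hz i)
    have hd := hasDerivAt_cfd_paramDir (f := fun p =>
        qForm (famMat g e p)⁻¹ (torMat holSlice (famMat g e) p) k l)
      (differentiableAt_of_contDiffOn hV
        (contDiffOn_qForm (hF.inv hF0) (contDiffOn_torMat hV hF) k l) hx)
    rw [cfd_qForm ((hF.inv hF0).diffMatAt hV hx)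
      (fun i => (contDiffOn_torMat hV hF i).diffMatAt hV hx) hT] at hd
    refine hd.congr_of_eventuallyEq ?_
    filter_upwards [Ioo_mem_nhds h0.1 h0.2] with a ha
    rw [torsionQ_eq, torMat_slice_famMat hsmooth he ha hz]
    rfl
  have hmat := hasDerivAt_mat hderiv e z k l
  have htot := (hSd.sub hQd).sub ((hint.const_mul (1 / n : ℂ)).mul hmat)
  refine htot.congr_deriv ?_
  -- The variation formula lives on ℝ × ℂⁿ, the claim on the slice a = 0. Both h and the metric are
  -- compared there; as ∇∇h involves derivatives of h, the agreement of h is used on the whole chart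
  -- domain.
  have hcov : ∀ i j, cov2Mat (hol i) (conjDir (hol j)) ((g 0).mat e) (HermitianFlow.coeff h e) z =
      cov2Mat (holSlice i) (conjDir (holSlice j)) (famMat g e)
        (cfdM (paramDir _) (famMat g e)) (0, z) := fun i j => by
    rw [holSlice, holSlice, conjDir_sliceDir, ← cov2Mat_slice hV hF hF0 (hF.cfdM hV) hx]
    exact cov2Mat_congr e.open_target hz hH
  have hcurv : ∀ i j, curvMat (hol i) (conjDir (hol j)) ((g 0).mat e) z =
      curvMat (holSlice i) (conjDir (holSlice j)) (famMat g e) (0, z) := fun i j =>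
    curvMat_slice_famMat hε hsmooth he hz i j
  have hS' : sMat holSlice (famMat g e) (0, z) = (c : ℂ) • famMat g e (0, z) :=
    (sMat_slice (ζ := hol) hV hF hx).symm.trans (sMat_eq_smul hS he hz)
  rw [roughLaplacian_eq e.open_target hGh hz, curvAction_eq e.open_target hG hG0
    ((g 0).torMat_eq_zero hK he) hz, cfdM_sMat hV hF hF0 hx, hS', hint0]
  simp only [hcov, hcurv, hH z hz, Matrix.sub_apply]
  -- With S = c g the term h g⁻¹ S is c h, which cancels against the variation of (1/n)(nc) g.
  have e1 : (cfdM (paramDir _) (famMat g e) (0, z) * (famMat g e (0, z))⁻¹ *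
      ((c : ℂ) • famMat g e (0, z))) = (c : ℂ) • cfdM (paramDir _) (famMat g e) (0, z) := by
    rw [Matrix.mul_smul, mul_assoc,
      Matrix.nonsing_inv_mul _ (isUnit_iff_ne_zero.2 (hF0 _ hx)), mul_one]
  rw [e1, Matrix.smul_apply, smul_eq_mul]
  have e2 : (1 / (n : ℂ)) * (n * c) = c := by field_simp
  rw [e2]
  simp only [famMat]
  ring
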